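/- All manifolds are smooth, finite-dimensional (all components of the same dimension), Hausdorff and second countable. An $S^1$-central extension $\tilde X_1 \xrightarrow{\pi} X_1 \rightrightarrows X_0$ of a Lie groupoid $X_1 \rightrightarrows X_0$ is a Lie groupoid $\tilde X_1 \rightrightarrows X_0$ with a Lie groupoid morphism $\pi$ over the identity of $X_0$ and an $S^1$-action making $\pi : \tilde X_1 \to X_1$ a principal $S^1$-bundle, such that $(\lambda \tilde x)(\mu \tilde y) = (\lambda\mu)(\tilde x \tilde y)$ for all composable $\tilde x, \tilde y$ and all $\lambda, \mu \in S^1$. A connection on it is a connection form $\theta \in \Omega^1(\tilde X_1)$ of this principal bundle (smooth, real-valued, $S^1$-invariant, equal to $1$ on the generator $\frac{d}{dt}\big|_{t=0} e^{2\pi i t}\cdot\tilde x$) with $\tilde\partial\theta = p_2^*\theta - m^*\theta + p_1^*\theta = 0$ on the manifold of composable pairs of $\tilde X_1 \rightrightarrows X_0$, where $p_1, p_2$ are the two projections and $m$ is the multiplication. **Proposition.** (1) If $X_1 \rightrightarrows X_0$ is a proper Lie groupoid (that is, $(t,s) : X_1 \to X_0 \times X_0$ is a proper map), then every $S^1$-central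 extension $\tilde X_1 \to X_1 \rightrightarrows X_0$ admits a connection. (2) In particular, let $G$ be a compact Lie group acting smoothly from the right on a manifold $M$, let $\alpha \in H^3_G(M, \mathbb Z) \cong H^3((M \rtimes G)_\bullet, \mathbb Z)$, and let $\tilde X_1 \to X_1 \rightrightarrows X_0$ be an $S^1$-central extension representing $\alpha$, i.e. $X_1 \rightrightarrows X_0$ is Morita equivalent to $M \rtimes G \rightrightarrows M$ and, under the induced identification of degree-three integral cohomology, the Dixmier–Douady class of the extension is $\alpha$. Then this extension admits a connection. -/

import Mathlib

open scoped Manifold ContDiff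

universe u

noncomputable section

/-- A smooth manifold: Hausdorff, second countable, finite-dimensional, without boundary. -/
structure SmoothManifold : Type (u + 1) where
  carrier : Type u
  E : Type
  H : Type
  [normedAddCommGroup : NormedAddCommGroup E]
  [normedSpace : NormedSpace ℝ E]
  [finiteDimensional : FiniteDimensional ℝ E]
  [topH : TopologicalSpace H]
  I : ModelWithCorners ℝ E H
  [boundaryless : I.Boundaryless]
  [top : TopologicalSpace carrier]
  [chartedSpace : ChartedSpace H carrier]
  [isManifold : IsManifold I ∞ carrier]
  [t2 : T2Space carrier]
  [secondCountable : SecondCountableTopology carrier]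

namespace SmoothManifold

instance : CoeSort SmoothManifold.{u} (Type u) := ⟨SmoothManifold.carrier⟩

attribute [instance] normedAddCommGroup normedSpace finiteDimensional topH boundaryless top
  chartedSpace isManifold t2 secondCountable

/-- The product of two manifolds. -/
def prod (M N : SmoothManifold.{u}) : SmoothManifold.{u} where
  carrier := M × N
  E := M.E × N.E
  H := ModelProd M.H N.H
  I := M.I.prod N.I

end SmoothManifold

/-- A Lie groupoid `X₁ ⇉ X₀`. The product `mul g h` is meaningful only for composable pairs,
`src g = tgt h`; its values at other pairs are irrelevant. Since `src` and `tgt` are submersions,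
the set of composable pairs is an embedded submanifold of `X₁ × X₁`, and smoothness of `mul` on that
set in the sense of local smooth extensions is smoothness on the submanifold. -/
structure LieGroupoid (X₁ X₀ : SmoothManifold.{u}) where
  src : X₁ → X₀
  tgt : X₁ → X₀
  unit : X₀ → X₁
  inv : X₁ → X₁
  mul : X₁ → X₁ → X₁
  src_submersion : Manifold.IsSubmersion X₁.I X₀.I ∞ src
  tgt_submersion : Manifold.IsSubmersion X₁.I X₀.I ∞ tgt
  smooth_unit : ContMDiff X₀.I X₁.I ∞ unit
  smooth_inv : ContMDiff X₁.I X₁.I ∞ inv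
  smooth_mul : ContMDiffOn (X₁.I.prod X₁.I) X₁.I ∞ (fun p : X₁ × X₁ => mul p.1 p.2)
    {p : X₁ × X₁ | src p.1 = tgt p.2}
  src_unit : ∀ x, src (unit x) = x
  tgt_unit : ∀ x, tgt (unit x) = x
  src_inv : ∀ g, src (inv g) = tgt g
  tgt_inv : ∀ g, tgt (inv g) = src g
  src_mul : ∀ g h, src g = tgt h → src (mul g h) = src h
  tgt_mul : ∀ g h, src g = tgt h → tgt (mul g h) = tgt g
  mul_assoc : ∀ g h k, src g = tgt h → src h = tgt k → mul (mul g h) k = mul g (mul h k)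
  unit_mul : ∀ g, mul (unit (tgt g)) g = g
  mul_unit : ∀ g, mul g (unit (src g)) = g
  mul_inv : ∀ g, mul g (inv g) = unit (tgt g)
  inv_mul : ∀ g, mul (inv g) g = unit (src g)

/-- A morphism of Lie groupoids. -/
structure LieGroupoidHom {Z₁ Z₀ X₁ X₀ : SmoothManifold.{u}}
    (𝒵 : LieGroupoid Z₁ Z₀) (𝒳 : LieGroupoid X₁ X₀) where
  map₁ : Z₁ → X₁
  map₀ : Z₀ → X₀
  smooth₁ : ContMDiff Z₁.I X₁.I ∞ map₁
  smooth₀ : ContMDiff Z₀.I X₀.I ∞ map₀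
  src_map : ∀ g, 𝒳.src (map₁ g) = map₀ (𝒵.src g)
  tgt_map : ∀ g, 𝒳.tgt (map₁ g) = map₀ (𝒵.tgt g)
  map_mul : ∀ g h, 𝒵.src g = 𝒵.tgt h → map₁ (𝒵.mul g h) = 𝒳.mul (map₁ g) (map₁ h)

/-- A Morita morphism: `φ₀` is a surjective submersion, and `Z₁` is the pullback of `X₁` along
`φ₀ × φ₀`, that is, `z ↦ (tgt z, φ₁ z, src z)` is a diffeomorphism onto the fibre product
`Z₀ ×_{X₀} X₁ ×_{X₀} Z₀` (an embedded submanifold of `Z₀ × X₁ × Z₀`); `ψ` is its inverse. -/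
structure LieGroupoidHom.IsMorita {Z₁ Z₀ X₁ X₀ : SmoothManifold.{u}}
    {𝒵 : LieGroupoid Z₁ Z₀} {𝒳 : LieGroupoid X₁ X₀} (φ : LieGroupoidHom 𝒵 𝒳) : Prop where
  surjective : Function.Surjective φ.map₀
  submersion : Manifold.IsSubmersion Z₀.I X₀.I ∞ φ.map₀
  cartesian : ∃ ψ : Z₀ × (X₁ × Z₀) → Z₁,
    ContMDiffOn (Z₀.I.prod (X₁.I.prod Z₀.I)) Z₁.I ∞ ψ
      {p | φ.map₀ p.1 = 𝒳.tgt p.2.1 ∧ φ.map₀ p.2.2 = 𝒳.src p.2.1} ∧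
    (∀ z, ψ (𝒵.tgt z, φ.map₁ z, 𝒵.src z) = z) ∧
    (∀ x g y, φ.map₀ x = 𝒳.tgt g → φ.map₀ y = 𝒳.src g →
      𝒵.tgt (ψ (x, g, y)) = x ∧ φ.map₁ (ψ (x, g, y)) = g ∧ 𝒵.src (ψ (x, g, y)) = y)

namespace LieGroupoid

variable {X₁ X₀ : SmoothManifold.{u}}

/-- A Lie groupoid is proper if `(tgt, src) : X₁ → X₀ × X₀` is a proper map. -/
def IsProper (𝒳 : LieGroupoid X₁ X₀) : Prop :=
  IsProperMap (fun g : X₁ => (𝒳.tgt g, 𝒳.src g))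

/-- The simplicial differential of a one-form `θ` on `X₁`,
`∂θ = d₀^*θ - d₁^*θ + d₂^*θ` with `d₀ (g, h) = h`, `d₁ (g, h) = gh`, `d₂ (g, h) = g`,
evaluated at a tangent vector `(v, w)` of the manifold of composable pairs at `(g, h)`. -/
def simplicialDifferential (𝒳 : LieGroupoid X₁ X₀) (θ : ∀ g : X₁, TangentSpace X₁.I g →L[ℝ] ℝ)
    (g h : X₁) (v : TangentSpace X₁.I g) (w : TangentSpace X₁.I h) : ℝ :=
  θ h w
    - θ (𝒳.mul g h) (mfderivWithin (X₁.I.prod X₁.I) X₁.I (fun p : X₁ × X₁ => 𝒳.mul p.1 p.2)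
        {p : X₁ × X₁ | 𝒳.src p.1 = 𝒳.tgt p.2} (g, h) ((v, w) : X₁.E × X₁.E))
    + θ g v

/-- The space `X_p` of strings of `p` composable arrows. A string
`x₀ ← x₁ ← ⋯ ← x_p` is recorded by all its composites `γ i j : x_j → x_i`, `0 ≤ i, j ≤ p`
(for `i > j` these are inverses), so that the simplicial maps are plain reindexings. -/
def Nerve (𝒳 : LieGroupoid X₁ X₀) (p : ℕ) : Type u :=
  {γ : Fin (p + 1) → Fin (p + 1) → X₁ //
    ∀ i j k, 𝒳.src (γ i j) = 𝒳.tgt (γ j k) ∧ 𝒳.mul (γ i j) (γ j k) = γ i k}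

instance (𝒳 : LieGroupoid X₁ X₀) (p : ℕ) : TopologicalSpace (𝒳.Nerve p) :=
  inferInstanceAs (TopologicalSpace {γ : Fin (p + 1) → Fin (p + 1) → X₁ //
    ∀ i j k, 𝒳.src (γ i j) = 𝒳.tgt (γ j k) ∧ 𝒳.mul (γ i j) (γ j k) = γ i k})

/-- The `i`-th face map `X_{p+1} → X_p`, which forgets the object `x_i`. -/
def nerveFace (𝒳 : LieGroupoid X₁ X₀) (p : ℕ) (i : Fin (p + 2)) :
    C(𝒳.Nerve (p + 1), 𝒳.Nerve p) where
  toFun γ := ⟨fun a b => γ.1 (i.succAbove a) (i.succAbove b), fun _ _ _ => γ.2 _ _ _⟩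
  continuous_toFun := by
    refine Continuous.subtype_mk ?_ _
    refine continuous_pi fun a => continuous_pi fun b => ?_
    exact (continuous_apply _).comp ((continuous_apply _).comp continuous_subtype_val)

/-- The `i`-th coface map of standard simplices. -/
def simplexFace (q : ℕ) (i : Fin (q + 2)) :
    C(stdSimplex ℝ (Fin (q + 1)), stdSimplex ℝ (Fin (q + 2))) :=
  ⟨stdSimplex.map i.succAbove, stdSimplex.continuous_map _⟩

/-- Integral singular `q`-cochains on `X_p`. -/
abbrev Cochain (𝒳 : LieGroupoid X₁ X₀) (p q : ℕ) : Type u :=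
  C(stdSimplex ℝ (Fin (q + 1)), 𝒳.Nerve p) → ℤ

/-- The simplicial differential `C^q(X_p) → C^q(X_{p+1})`. -/
def cochainHoriz (𝒳 : LieGroupoid X₁ X₀) {p q : ℕ} (c : 𝒳.Cochain p q) : 𝒳.Cochain (p + 1) q :=
  fun σ => ∑ i : Fin (p + 2), (-1) ^ (i : ℕ) * c ((𝒳.nerveFace p i).comp σ)

/-- The singular differential `C^q(X_p) → C^{q+1}(X_p)`. -/
def cochainVert (𝒳 : LieGroupoid X₁ X₀) {p q : ℕ} (c : 𝒳.Cochain p q) : 𝒳.Cochain p (q + 1) :=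
  fun σ => ∑ i : Fin (q + 2), (-1) ^ (i : ℕ) * c (σ.comp (simplexFace q i))

/-- Families of cochains of all bidegrees. -/
abbrev TotalCochain (𝒳 : LieGroupoid X₁ X₀) : Type u := ∀ p q : ℕ, 𝒳.Cochain p q

/-- The simplicial summand of the total differential. -/
def totalHoriz (𝒳 : LieGroupoid X₁ X₀) (c : 𝒳.TotalCochain) : 𝒳.TotalCochain
  | 0, _ => 0
  | p + 1, q => 𝒳.cochainHoriz (c p q)

/-- The singular summand of the total differential, `(-1)^p δ` on `C^q(X_p)`. -/
def totalVert (𝒳 : LieGroupoid X₁ X₀) (c : 𝒳.TotalCochain) : 𝒳.TotalCochain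
  | _, 0 => 0
  | p, q + 1 => (-1 : ℤ) ^ p • 𝒳.cochainVert (c p q)

/-- The total differential `D = ∂ + (-1)^p δ`. -/
def totalD (𝒳 : LieGroupoid X₁ X₀) : 𝒳.TotalCochain →+ 𝒳.TotalCochain where
  toFun c := 𝒳.totalHoriz c + 𝒳.totalVert c
  map_zero' := by
    funext p q σ
    rcases p with _ | p <;> rcases q with _ | q <;>
      simp [totalHoriz, totalVert, cochainHoriz, cochainVert]
  map_add' c d := by
    funext p q σ
    rcases p with _ | p <;> rcases q with _ | q <;>
      simp [totalHoriz, totalVert, cochainHoriz, cochainVert, mul_add, Finset.sum_add_distrib]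
    ring

/-- Total cochains of degree `n`: those supported in bidegrees `p + q = n`. -/
def homogeneous (𝒳 : LieGroupoid X₁ X₀) (n : ℕ) : AddSubgroup 𝒳.TotalCochain where
  carrier := {c | ∀ p q, p + q ≠ n → c p q = 0}
  zero_mem' := fun _ _ _ => rfl
  add_mem' := fun ha hb p q h => by simp [ha p q h, hb p q h]
  neg_mem' := fun ha p q h => by simp [ha p q h]

/-- Total cocycles of degree `n`. -/
def cocycles (𝒳 : LieGroupoid X₁ X₀) (n : ℕ) : AddSubgroup 𝒳.TotalCochain :=
  𝒳.homogeneous n ⊓ 𝒳.totalD.ker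

/-- Total coboundaries of degree `n`. -/
def coboundaries (𝒳 : LieGroupoid X₁ X₀) (n : ℕ) : AddSubgroup 𝒳.TotalCochain where
  carrier := {c | ∃ m, m + 1 = n ∧ ∃ b ∈ 𝒳.homogeneous m, 𝒳.totalD b = c} ∪ {0}
  zero_mem' := Or.inr rfl
  add_mem' := by
    rintro a b (⟨m, hm, x, hx, rfl⟩ | rfl) (⟨m', hm', y, hy, rfl⟩ | rfl)
    · obtain rfl : m = m' := by omega
      exact Or.inl ⟨m, hm, x + y, add_mem hx hy, map_add _ _ _⟩
    · exact Or.inl ⟨m, hm, x, hx, (add_zero _).symm⟩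
    · exact Or.inl ⟨m', hm', y, hy, (zero_add _).symm⟩
    · exact Or.inr (add_zero _)
  neg_mem' := by
    rintro a (⟨m, hm, x, hx, rfl⟩ | rfl)
    · exact Or.inl ⟨m, hm, -x, neg_mem hx, map_neg _ _⟩
    · exact Or.inr neg_zero

/-- The integral cohomology `H^n(X_•, ℤ)` of the groupoid: the cohomology of the total complex of
the double complex `C^q(X_p, ℤ)`. -/
abbrev Cohomology (𝒳 : LieGroupoid X₁ X₀) (n : ℕ) : Type u :=
  𝒳.cocycles n ⧸ (𝒳.coboundaries n).addSubgroupOf (𝒳.cocycles n)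

end LieGroupoid

namespace LieGroupoidHom

variable {Z₁ Z₀ X₁ X₀ : SmoothManifold.{u}} {𝒵 : LieGroupoid Z₁ Z₀} {𝒳 : LieGroupoid X₁ X₀}

/-- The induced map of nerves. -/
def nerveMap (φ : LieGroupoidHom 𝒵 𝒳) (p : ℕ) : C(𝒵.Nerve p, 𝒳.Nerve p) where
  toFun γ := ⟨fun i j => φ.map₁ (γ.1 i j), fun i j k => by
    obtain ⟨h₁, h₂⟩ := γ.2 i j k
    exact ⟨by rw [φ.src_map, φ.tgt_map, h₁], by rw [← φ.map_mul _ _ h₁, h₂]⟩⟩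
  continuous_toFun := by
    refine Continuous.subtype_mk ?_ _
    refine continuous_pi fun a => continuous_pi fun b => φ.smooth₁.continuous.comp ?_
    exact (continuous_apply _).comp ((continuous_apply _).comp continuous_subtype_val)

/-- Pullback of total cochains. -/
def pullbackCochain (φ : LieGroupoidHom 𝒵 𝒳) : 𝒳.TotalCochain →+ 𝒵.TotalCochain where
  toFun c := fun p _ σ => c p _ ((φ.nerveMap p).comp σ)
  map_zero' := rfl
  map_add' _ _ := rfl

theorem totalD_pullbackCochain (φ : LieGroupoidHom 𝒵 𝒳) (c : 𝒳.TotalCochain) :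
    𝒵.totalD (φ.pullbackCochain c) = φ.pullbackCochain (𝒳.totalD c) := by
  funext p q σ
  rcases p with _ | p <;> rcases q with _ | q <;> rfl

theorem pullbackCochain_mem_homogeneous (φ : LieGroupoidHom 𝒵 𝒳) {n : ℕ} {c : 𝒳.TotalCochain}
    (hc : c ∈ 𝒳.homogeneous n) : φ.pullbackCochain c ∈ 𝒵.homogeneous n := by
  intro p q h
  funext σ
  exact congrFun (hc p q h) _

/-- Pullback of cocycles. -/
def pullbackCocycle (φ : LieGroupoidHom 𝒵 𝒳) (n : ℕ) : 𝒳.cocycles n →+ 𝒵.cocycles n :=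
  (φ.pullbackCochain.comp (𝒳.cocycles n).subtype).codRestrict (𝒵.cocycles n) fun c => by
    refine ⟨φ.pullbackCochain_mem_homogeneous c.2.1, ?_⟩
    have h : 𝒳.totalD c.1 = 0 := c.2.2
    change 𝒵.totalD (φ.pullbackCochain c.1) = 0
    rw [totalD_pullbackCochain, h, map_zero]

/-- Pullback in integral cohomology. -/
def pullback (φ : LieGroupoidHom 𝒵 𝒳) (n : ℕ) : 𝒳.Cohomology n →+ 𝒵.Cohomology n :=
  QuotientAddGroup.map _ _ (φ.pullbackCocycle n) (by
    rintro ⟨c, hc⟩ (⟨m, hm, b, hb, h⟩ | h)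
    · refine Or.inl ⟨m, hm, φ.pullbackCochain b, φ.pullbackCochain_mem_homogeneous hb, ?_⟩
      rw [totalD_pullbackCochain, h]
      rfl
    · refine Or.inr ?_
      change φ.pullbackCochain c = 0
      rw [show c = 0 from h, map_zero])

end LieGroupoidHom

/-- An `S¹`-central extension `X̃₁ → X₁ ⇉ X₀`: a Lie groupoid `X̃₁ ⇉ X₀` with a groupoid morphism
`X̃₁ → X₁` over the identity of `X₀` and an `S¹`-action on `X̃₁` which makes it a (locally trivial)
principal `S¹`-bundle over `X₁`, such that `(a • x) (b • y) = (a b) • (x y)`. -/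
structure CentralExtension {X₁ X₀ : SmoothManifold.{u}} (𝒳 : LieGroupoid X₁ X₀) where
  total : SmoothManifold.{u}
  groupoid : LieGroupoid total X₀
  proj : total → X₁
  smooth_proj : ContMDiff total.I X₁.I ∞ proj
  src_proj : ∀ x, 𝒳.src (proj x) = groupoid.src x
  tgt_proj : ∀ x, 𝒳.tgt (proj x) = groupoid.tgt x
  proj_mul : ∀ x y, groupoid.src x = groupoid.tgt y →
    proj (groupoid.mul x y) = 𝒳.mul (proj x) (proj y)
  act : Circle → total → total
  smooth_act : ContMDiff ((𝓡 1).prod total.I) total.I ∞ (fun p : Circle × total => act p.1 p.2)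
  act_one : ∀ x, act 1 x = x
  act_mul : ∀ a b x, act (a * b) x = act a (act b x)
  proj_act : ∀ a x, proj (act a x) = proj x
  /-- Over an open neighbourhood `U` of any point, `(u, a) ↦ a • σ u` and `x ↦ (proj x, χ x)` are
  mutually inverse smooth maps between `U × S¹` and the preimage of `U`. -/
  locally_trivial : ∀ g : X₁, ∃ U : Set X₁, IsOpen U ∧ g ∈ U ∧
    ∃ (σ : X₁ → total) (χ : total → Circle),
      ContMDiffOn X₁.I total.I ∞ σ U ∧ ContMDiffOn total.I (𝓡 1) ∞ χ (proj ⁻¹' U) ∧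
      (∀ u ∈ U, proj (σ u) = u) ∧ (∀ u ∈ U, ∀ a, χ (act a (σ u)) = a) ∧
      (∀ x, proj x ∈ U → act (χ x) (σ (proj x)) = x)
  mul_act : ∀ a b x y, groupoid.src x = groupoid.tgt y →
    groupoid.mul (act a x) (act b y) = act (a * b) (groupoid.mul x y)

namespace CentralExtension

variable {X₁ X₀ : SmoothManifold.{u}} {𝒳 : LieGroupoid X₁ X₀}

/-- The projection of a central extension as a morphism of Lie groupoids. -/
def projHom (𝓔 : CentralExtension 𝒳) : LieGroupoidHom 𝓔.groupoid 𝒳 where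
  map₁ := 𝓔.proj
  map₀ := id
  smooth₁ := 𝓔.smooth_proj
  smooth₀ := contMDiff_id
  src_map := 𝓔.src_proj
  tgt_map := 𝓔.tgt_proj
  map_mul := 𝓔.proj_mul

/-- The orbit map `t ↦ exp(2πit) • x`; its velocity at `t = 0` is the fundamental vector field. -/
def orbitMap (𝓔 : CentralExtension 𝒳) (x : 𝓔.total) (t : ℝ) : 𝓔.total :=
  𝓔.act (Circle.exp (2 * Real.pi * t)) x

/-- `θ` is a connection form on the principal `S¹`-bundle `X̃₁ → X₁`: a smooth `S¹`-invariant
one-form which takes the value `1` on the fundamental vector field. -/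
structure IsConnectionForm (𝓔 : CentralExtension 𝒳)
    (θ : ∀ x : 𝓔.total, TangentSpace 𝓔.total.I x →L[ℝ] ℝ) : Prop where
  smooth : ContMDiff 𝓔.total.I (𝓔.total.I.prod 𝓘(ℝ, 𝓔.total.E →L[ℝ] ℝ)) ∞
    (fun x => (Bundle.TotalSpace.mk' (𝓔.total.E →L[ℝ] ℝ) x (θ x) :
      Bundle.TotalSpace (𝓔.total.E →L[ℝ] ℝ)
        (fun x : 𝓔.total => TangentSpace 𝓔.total.I x →L[ℝ] ℝ)))
  invariant : ∀ (a : Circle) (x : 𝓔.total) (v : TangentSpace 𝓔.total.I x),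
    θ (𝓔.act a x) (mfderiv 𝓔.total.I 𝓔.total.I (𝓔.act a) x v) = θ x v
  vertical : ∀ x : 𝓔.total,
    θ (𝓔.orbitMap x 0) (mfderiv 𝓘(ℝ, ℝ) 𝓔.total.I (𝓔.orbitMap x) 0 (1 : ℝ)) = 1

/-- `θ` is a connection on the central extension: a connection form with vanishing simplicial
differential on the manifold of composable pairs of `X̃₁ ⇉ X₀`, whose tangent space at `(x, y)`
consists of the pairs `(v, w)` with `d src (v) = d tgt (w)`. -/
structure IsConnection (𝓔 : CentralExtension 𝒳)
    (θ : ∀ x : 𝓔.total, TangentSpace 𝓔.total.I x →L[ℝ] ℝ) : Prop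
    extends 𝓔.IsConnectionForm θ where
  multiplicative : ∀ x y : 𝓔.total, 𝓔.groupoid.src x = 𝓔.groupoid.tgt y →
    ∀ (v : TangentSpace 𝓔.total.I x) (w : TangentSpace 𝓔.total.I y),
      (mfderiv 𝓔.total.I X₀.I 𝓔.groupoid.src x v : X₀.E) =
        (mfderiv 𝓔.total.I X₀.I 𝓔.groupoid.tgt y w : X₀.E) →
      𝓔.groupoid.simplicialDifferential θ x y v w = 0

/-- `A` is the Dixmier-Douady class of the central extension: it is the transgression of the
generator of the first cohomology of the fibres. That is, there is a total cochain `T` of degree two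
on the nerve of `X̃₁ ⇉ X₀` whose restriction to each fibre of `X̃₁ → X₁` is the
generator of `H¹(S¹, ℤ)` and whose total differential is the pullback of a cocycle representing
`A`. In the fibre condition `σ` is the loop `t ↦ exp(2πit) • x` and `κ` is the constant path at `x`
(the arrow of a one-simplex of the nerve is its `(0, 1)` entry, which determines it). -/
def HasDixmierDouadyClass (𝓔 : CentralExtension 𝒳) (A : 𝒳.Cohomology 3) : Prop :=
  ∃ a : 𝒳.cocycles 3, (QuotientAddGroup.mk a : 𝒳.Cohomology 3) = A ∧
    ∃ T ∈ 𝓔.groupoid.homogeneous 2,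
      𝓔.groupoid.totalD T = 𝓔.projHom.pullbackCochain a ∧
      ∀ (x : 𝓔.total) (σ κ : C(stdSimplex ℝ (Fin 2), 𝓔.groupoid.Nerve 1)),
        (∀ t, (σ t).1 0 1 = 𝓔.orbitMap x (t.1 1)) → (∀ t, (κ t).1 0 1 = x) →
        T 1 1 σ - T 1 1 κ = 1

end CentralExtension

/-- A smooth right action of a Lie group on a manifold. -/
structure SmoothRightAction (M G : SmoothManifold.{u}) [Group G] where
  act : M → G → M
  smooth : ContMDiff (M.I.prod G.I) M.I ∞ (fun p : M × G => act p.1 p.2)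
  act_one : ∀ x, act x 1 = x
  act_mul : ∀ x g h, act x (g * h) = act (act x g) h

namespace SmoothRightAction

variable {M G : SmoothManifold.{u}} [Group G] [LieGroup G.I ∞ G]

theorem isSubmersion_fst {M G : SmoothManifold.{u}} :
    Manifold.IsSubmersion (M.I.prod G.I) M.I ∞ (fun p : M × G => p.1) := by
  refine ⟨G.E, inferInstance, inferInstance, fun p => ?_⟩
  refine Manifold.IsSubmersionAtOfComplement.mk_of_charts (ContinuousLinearEquiv.refl ℝ _)
    ((chartAt M.H p.1).prod (chartAt G.H p.2)) (chartAt M.H p.1)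
    ⟨mem_chart_source _ _, mem_chart_source _ _⟩ (mem_chart_source _ _)
    (IsManifold.mem_maximalAtlas_prod (IsManifold.chart_mem_maximalAtlas _)
      (IsManifold.chart_mem_maximalAtlas _))
    (IsManifold.chart_mem_maximalAtlas _) (fun x hx => hx.1) ?_
  intro v hv
  rw [OpenPartialHomeomorph.extend_prod] at hv
  change (chartAt M.H p.1).extend M.I (((chartAt M.H p.1).extend M.I).symm v.1) = v.1
  exact PartialEquiv.right_inv _ hv.1

theorem isSubmersion_comp_diffeomorph {E H P E' H' N : Type*}
    [NormedAddCommGroup E] [NormedSpace ℝ E] [TopologicalSpace H] {I : ModelWithCorners ℝ E H}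
    [TopologicalSpace P] [ChartedSpace H P] [IsManifold I ∞ P]
    [NormedAddCommGroup E'] [NormedSpace ℝ E'] [TopologicalSpace H'] {J : ModelWithCorners ℝ E' H'}
    [TopologicalSpace N] [ChartedSpace H' N] {f : P → N}
    (hf : Manifold.IsSubmersion I J ∞ f) (Φ : P ≃ₘ⟮I, I⟯ P) :
    Manifold.IsSubmersion I J ∞ (f ∘ Φ) := by
  obtain ⟨F, i₁, i₂, hf⟩ := hf
  refine ⟨F, i₁, i₂, fun x => ?_⟩
  have h := hf (Φ x)
  refine Manifold.IsSubmersionAtOfComplement.mk_of_charts h.equiv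
    (Φ.toHomeomorph.toOpenPartialHomeomorph.trans h.domChart) h.codChart
    (by simpa using h.mem_domChart_source) h.mem_codChart_source ?_ h.codChart_mem_maximalAtlas
    (fun y hy => h.source_subset_preimage_source (by simpa using hy)) ?_
  · rw [IsManifold.mem_maximalAtlas_iff_contMDiffOn]
    have h' := IsManifold.mem_maximalAtlas_iff_contMDiffOn _ |>.1 h.domChart_mem_maximalAtlas
    constructor
    · exact h'.1.comp Φ.contMDiff.contMDiffOn (fun y hy => by simpa using hy)
    · exact Φ.symm.contMDiff.comp_contMDiffOn (h'.2.mono (by simp))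
  · intro v hv
    have hv' : v ∈ (h.domChart.extend I).target := by
      simpa [OpenPartialHomeomorph.extend_target] using hv
    rw [← h.writtenInCharts hv']
    simp

/-- The map `(x, g) ↦ x g` is a submersion, being `Prod.fst` after the diffeomorphism
`(x, g) ↦ (x g, g⁻¹)`. -/
theorem isSubmersion_act (ρ : SmoothRightAction M G) :
    Manifold.IsSubmersion (M.I.prod G.I) M.I ∞ (fun p : M × G => ρ.act p.1 p.2) := by
  let Ψ : M × G → M × G := fun p => (ρ.act p.1 p.2, p.2⁻¹)
  have hΨ : ContMDiff (M.I.prod G.I) (M.I.prod G.I) ∞ Ψ :=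
    ρ.smooth.prodMk ((contMDiff_inv G.I ∞).comp contMDiff_snd)
  have hinv : ∀ p, Ψ (Ψ p) = p := by
    rintro ⟨x, g⟩
    change ((ρ.act (ρ.act x g) g⁻¹, g⁻¹⁻¹) : M × G) = (x, g)
    rw [← ρ.act_mul, mul_inv_cancel, ρ.act_one, inv_inv]
  exact isSubmersion_comp_diffeomorph isSubmersion_fst ⟨⟨Ψ, Ψ, hinv, hinv⟩, hΨ, hΨ⟩

/-- The transformation groupoid `M ⋊ G ⇉ M`: `tgt (x, g) = x`, `src (x, g) = x g` and
`(x, g) (x g, h) = (x, g h)`. -/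
def groupoid (ρ : SmoothRightAction M G) : LieGroupoid (M.prod G) M where
  src := fun p : M × G => ρ.act p.1 p.2
  tgt := fun p : M × G => p.1
  unit := fun x => ((x, 1) : M × G)
  inv := fun p : M × G => ((ρ.act p.1 p.2, p.2⁻¹) : M × G)
  mul := fun p q : M × G => ((p.1, p.2 * q.2) : M × G)
  src_submersion := ρ.isSubmersion_act
  tgt_submersion := isSubmersion_fst
  smooth_unit := contMDiff_id.prodMk contMDiff_const
  smooth_inv := ρ.smooth.prodMk ((contMDiff_inv G.I ∞).comp contMDiff_snd)
  smooth_mul := by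
    have h₁ : ContMDiff ((M.I.prod G.I).prod (M.I.prod G.I)) M.I ∞
        (fun p : (M × G) × (M × G) => p.1.1) := contMDiff_fst.comp contMDiff_fst
    have h₂ : ContMDiff ((M.I.prod G.I).prod (M.I.prod G.I)) G.I ∞
        (fun p : (M × G) × (M × G) => p.1.2 * p.2.2) :=
      (contMDiff_snd.comp contMDiff_fst).mul (contMDiff_snd.comp contMDiff_snd)
    exact (h₁.prodMk h₂).contMDiffOn
  src_unit := ρ.act_one
  tgt_unit := fun _ => rfl
  src_inv := by
    rintro ⟨x, g⟩
    change ρ.act (ρ.act x g) g⁻¹ = x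
    rw [← ρ.act_mul, mul_inv_cancel, ρ.act_one]
  tgt_inv := fun _ => rfl
  src_mul := by
    rintro ⟨x, g⟩ ⟨y, h⟩ (e : ρ.act x g = y)
    change ρ.act x (g * h) = ρ.act y h
    rw [ρ.act_mul, e]
  tgt_mul := fun _ _ _ => rfl
  mul_assoc := by
    rintro ⟨x, g⟩ ⟨y, h⟩ ⟨z, k⟩ _ _
    change ((x, g * h * k) : M × G) = (x, g * (h * k))
    rw [mul_assoc]
  unit_mul := by
    rintro ⟨x, g⟩
    change ((x, 1 * g) : M × G) = (x, g)
    rw [one_mul]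
  mul_unit := by
    rintro ⟨x, g⟩
    change ((x, g * 1) : M × G) = (x, g)
    rw [mul_one]
  mul_inv := by
    rintro ⟨x, g⟩
    change ((x, g * g⁻¹) : M × G) = (x, 1)
    rw [mul_inv_cancel]
  inv_mul := by
    rintro ⟨x, g⟩
    change ((ρ.act x g, g⁻¹ * g) : M × G) = (ρ.act x g, 1)
    rw [inv_mul_cancel]

/-- The integral equivariant cohomology `H^n_G(M, ℤ)`, computed by the simplicial manifold
`(M ⋊ G)_•`, a model of the homotopy quotient. -/
abbrev EquivariantCohomology (ρ : SmoothRightAction M G) (n : ℕ) : Type u :=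
  ρ.groupoid.Cohomology n

end SmoothRightAction

/-- The central extension `𝓔` of `X₁ ⇉ X₀` represents the class `α ∈ H³_G(M, ℤ)`: there are Morita
morphisms from a Lie groupoid `Z₁ ⇉ Z₀` to `X₁ ⇉ X₀` and to `M ⋊ G ⇉ M` such that the
Dixmier-Douady class of `𝓔` and `α` have the same pullback to `Z₁ ⇉ Z₀`. -/
def CentralExtension.Represents {X₁ X₀ M G : SmoothManifold.{u}} [Group G] [LieGroup G.I ∞ G]
    {𝒳 : LieGroupoid X₁ X₀} (𝓔 : CentralExtension 𝒳) (ρ : SmoothRightAction M G)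
    (α : ρ.EquivariantCohomology 3) : Prop :=
  ∃ (Z₁ Z₀ : SmoothManifold.{u}) (𝒵 : LieGroupoid Z₁ Z₀)
    (q : LieGroupoidHom 𝒵 𝒳) (r : LieGroupoidHom 𝒵 ρ.groupoid),
    q.IsMorita ∧ r.IsMorita ∧
      ∃ A : 𝒳.Cohomology 3, 𝓔.HasDixmierDouadyClass A ∧ q.pullback 3 A = r.pullback 3 α

end

open scoped Topology
open Set Filter MeasureTheory

section TDer
variable {E H M E' H' M' E'' H'' M'' : Type*}
  [NormedAddCommGroup E] [NormedSpace ℝ E] [TopologicalSpace H] {I : ModelWithCorners ℝ E H}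
  [TopologicalSpace M] [ChartedSpace H M]
  [NormedAddCommGroup E'] [NormedSpace ℝ E'] [TopologicalSpace H'] {I' : ModelWithCorners ℝ E' H'}
  [TopologicalSpace M'] [ChartedSpace H' M']
  [NormedAddCommGroup E''] [NormedSpace ℝ E''] [TopologicalSpace H'']
  {I'' : ModelWithCorners ℝ E'' H''} [TopologicalSpace M''] [ChartedSpace H'' M'']

variable (I I') in
/-- The derivative of a map of manifolds at a point, as a map between the model spaces. -/
noncomputable def tder (f : M → M') (x : M) : E →L[ℝ] E' := mfderiv I I' f x

theorem tder_comp {g : M' → M''} {f : M → M'} {x : M} (hg : MDifferentiableAt I' I'' g (f x))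
    (hf : MDifferentiableAt I I' f x) :
    tder I I'' (fun y => g (f y)) x = (tder I' I'' g (f x)).comp (tder I I' f x) :=
  mfderiv_comp x hg hf

theorem Filter.EventuallyEq.tder_eq {f g : M → M'} {x : M} (h : f =ᶠ[𝓝 x] g) :
    tder I I' f x = tder I I' g x := h.mfderiv_eq

theorem tder_const (x : M) (c : M') : tder I I' (fun _ : M => c) x = 0 := mfderiv_const

theorem tder_id (x : M) : tder I I (fun y : M => y) x = ContinuousLinearMap.id ℝ E := mfderiv_id

theorem tder_prodMk {f : M → M'} {g : M → M''} {x : M} (hf : MDifferentiableAt I I' f x)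
    (hg : MDifferentiableAt I I'' g x) :
    tder I (I'.prod I'') (fun y => (f y, g y)) x = (tder I I' f x).prod (tder I I'' g x) :=
  mfderiv_prodMk hf hg

theorem tder_eq_fderiv {f : E → E'} {x : E} : tder 𝓘(ℝ, E) 𝓘(ℝ, E') f x = fderiv ℝ f x :=
  mfderiv_eq_fderiv

end TDer

theorem contDiffAt_clm_of_apply {D E F : Type*} [NormedAddCommGroup D] [NormedSpace ℝ D]
    [NormedAddCommGroup E] [NormedSpace ℝ E] [NormedAddCommGroup F] [NormedSpace ℝ F]
    [FiniteDimensional ℝ E] {n : WithTop ℕ∞} {f : D → E →L[ℝ] F} {x : D}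
    (h : ∀ e, ContDiffAt ℝ n (fun y => f y e) x) : ContDiffAt ℝ n f x := by
  let b := Module.finBasis ℝ E
  let c := fun i => LinearMap.toContinuousLinearMap (b.coord i)
  have hf : f = fun y => ∑ i, ContinuousLinearMap.smulRightL ℝ E F (c i) (f y (b i)) := by
    funext y
    ext e
    conv_lhs => rw [← b.sum_repr e, map_sum]
    simp [c]
  rw [hf]
  exact ContDiffAt.sum fun i _ =>
    (ContinuousLinearMap.smulRightL ℝ E F (c i)).contDiff.contDiffAt.comp x (h (b i))

/-- A one-form on a manifold, with tangent spaces identified with the model space. -/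
abbrev OneForm (M : SmoothManifold.{u}) : Type u := M → M.E →L[ℝ] ℝ

/-- Smoothness of a one-form at a point. -/
def OneForm.SmoothAt {M : SmoothManifold.{u}} (θ : OneForm M) (x : M) : Prop :=
  ContMDiffAt M.I (M.I.prod 𝓘(ℝ, M.E →L[ℝ] ℝ)) ∞
    (fun x => (Bundle.TotalSpace.mk' (M.E →L[ℝ] ℝ) x (θ x) :
      Bundle.TotalSpace (M.E →L[ℝ] ℝ) (fun x : M => TangentSpace M.I x →L[ℝ] ℝ))) x

namespace OneForm
variable {M : SmoothManifold.{u}} {P : Type*} [NormedAddCommGroup P] [NormedSpace ℝ P]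

theorem SmoothAt.contDiffAt_pullback {θ : OneForm M} {μ : P → M} {p : P} (hθ : θ.SmoothAt (μ p))
    (hμ : ContMDiffAt 𝓘(ℝ, P) M.I ∞ μ p) (e : P) :
    ContDiffAt ℝ ∞ (fun q => θ (μ q) (tder 𝓘(ℝ, P) M.I μ q e)) p := by
  have h1 := ContMDiffAt.comp p hθ hμ
  have h2 : ContMDiffAt 𝓘(ℝ, P) (M.I.prod 𝓘(ℝ, M.E)) ∞
      (fun q => (Bundle.TotalSpace.mk' M.E (μ q) (mfderiv 𝓘(ℝ, P) M.I μ q e) :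
        Bundle.TotalSpace M.E (TangentSpace M.I))) p := by
    have h3 := hμ.mfderiv_const (m := ∞) (by simp)
    refine ContMDiffAt.clm_apply_of_inCoordinates (E₁ := TangentSpace 𝓘(ℝ, P))
      (b₁ := id) (IB₁ := 𝓘(ℝ, P)) h3 ?_ hμ (v := fun _ => e)
    exact contMDiffAt_vectorSpace_iff_contDiffAt.2 contDiffAt_const
  have h4 := ContMDiffAt.clm_bundle_apply (E₁ := TangentSpace M.I) (E₂ := fun _ : M => ℝ)
    (b := μ) (ϕ := fun q => θ (μ q)) (v := fun q => mfderiv 𝓘(ℝ, P) M.I μ q e) h1 h2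
  rw [Bundle.contMDiffAt_totalSpace] at h4
  exact h4.2.contDiffAt

theorem smoothAt_of_pullback {θ : OneForm M} {x : M}
    (h : ∀ e : M.E, ContDiffAt ℝ ∞ (fun q => θ ((extChartAt M.I x).symm q)
      (tder 𝓘(ℝ, M.E) M.I (extChartAt M.I x).symm q e)) (extChartAt M.I x x)) : θ.SmoothAt x := by
  rw [SmoothAt, contMDiffAt_hom_bundle]
  refine ⟨contMDiffAt_id, ?_⟩
  have hsrc : ∀ᶠ y in 𝓝 x, y ∈ (chartAt M.H x).source := chart_source_mem_nhds _ _
  have h1 : ContMDiffAt M.I 𝓘(ℝ, M.E →L[ℝ] ℝ) ∞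
      (fun y => (θ ((extChartAt M.I x).symm (extChartAt M.I x y))).comp
        (tder 𝓘(ℝ, M.E) M.I (extChartAt M.I x).symm (extChartAt M.I x y))) x := by
    have h2 : ContDiffAt ℝ ∞ (fun q => (θ ((extChartAt M.I x).symm q)).comp
        (tder 𝓘(ℝ, M.E) M.I (extChartAt M.I x).symm q)) (extChartAt M.I x x) :=
      contDiffAt_clm_of_apply h
    exact h2.contMDiffAt.comp x contMDiffAt_extChartAt
  refine h1.congr_of_eventuallyEq ?_
  filter_upwards [hsrc] with y hy
  have h3 := TangentBundle.symmL_trivializationAt (I := M.I) hy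
  have h4 : (extChartAt M.I x).symm (extChartAt M.I x y) = y :=
    (extChartAt M.I x).left_inv (by simpa using hy)
  rw [h4]
  rw [ModelWithCorners.Boundaryless.range_eq_univ, mfderivWithin_univ] at h3
  unfold ContinuousLinearMap.inCoordinates
  rw [h3]
  have h5 : ∀ r : ℝ, Bundle.Trivialization.continuousLinearMapAt ℝ
      (trivializationAt ℝ (fun _ : M => ℝ) x) y r = r := by
    intro r
    have := Bundle.Trivial.continuousLinearMapAt_trivialization ℝ M ℝ y
    exact congrArg (fun f => f r) this
  ext v
  exact h5 _

end OneForm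

/-- A local trivialization of a map `π : T → B`, with fibres modelled on `F`. -/
structure FibreChart {T B : SmoothManifold.{u}} (π : T → B) (F : Type*) [NormedAddCommGroup F]
    [NormedSpace ℝ F] where
  dom : Set T
  cod : Set (B × F)
  coord : T → F
  par : B × F → T
  isOpen_dom : IsOpen dom
  isOpen_cod : IsOpen cod
  smooth_coord : ContMDiffOn T.I 𝓘(ℝ, F) ∞ coord dom
  smooth_par : ContMDiffOn (B.I.prod 𝓘(ℝ, F)) T.I ∞ par cod
  mem_cod : ∀ z ∈ dom, (π z, coord z) ∈ cod
  mem_dom : ∀ p ∈ cod, par p ∈ dom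
  proj_par : ∀ p ∈ cod, π (par p) = p.1
  coord_par : ∀ p ∈ cod, coord (par p) = p.2
  par_coord : ∀ z ∈ dom, par (π z, coord z) = z

namespace FibreChart
variable {T B : SmoothManifold.{u}} {π : T → B} {F : Type*} [NormedAddCommGroup F]
    [NormedSpace ℝ F]

theorem exists_of_isSubmersionAt {z : T}
    (h : Manifold.IsSubmersionAtOfComplement F T.I B.I ∞ π z) :
    ∃ c : FibreChart π F, z ∈ c.dom := by
  set φ := h.domChart with hφ
  set ψ := h.codChart with hψ
  set e := h.equiv with he
  have hπ : ∀ z ∈ φ.source, π z ∈ ψ.source := fun z hz => h.source_subset_preimage_source hz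
  have key : ∀ v ∈ (φ.extend T.I).target, ψ.extend B.I (π ((φ.extend T.I).symm v)) = (e v).1 :=
    fun v hv => h.writtenInCharts hv
  have hφs : ContMDiffOn T.I 𝓘(ℝ, T.E) ∞ (φ.extend T.I) φ.source :=
    OpenPartialHomeomorph.contMDiffOn_extend h.domChart_mem_maximalAtlas
  have hψs : ContMDiffOn B.I 𝓘(ℝ, B.E) ∞ (ψ.extend B.I) ψ.source :=
    OpenPartialHomeomorph.contMDiffOn_extend h.codChart_mem_maximalAtlas
  have hφt : ContMDiffOn 𝓘(ℝ, T.E) T.I ∞ (φ.extend T.I).symm (φ.extend T.I).target := by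
    have := contMDiffOn_extend_symm (I := T.I) h.domChart_mem_maximalAtlas
    rwa [← OpenPartialHomeomorph.extend_target'] at this
  have hto : IsOpen (φ.extend T.I).target := φ.isOpen_extend_target
  have keyz : ∀ z ∈ φ.source, ψ.extend B.I (π z) = (e (φ.extend T.I z)).1 := by
    intro z hz
    rw [← key _ ((φ.extend T.I).map_source (by simpa using hz)), (φ.extend T.I).left_inv (by simpa using hz)]
  have hvz : ∀ z ∈ φ.source, e.symm (ψ.extend B.I (π z), (e (φ.extend T.I z)).2) = φ.extend T.I z := by
    intro z hz
    rw [keyz z hz]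
    simp
  have hg : ContMDiffOn (B.I.prod 𝓘(ℝ, F)) 𝓘(ℝ, T.E) ∞
      (fun p : B × F => e.symm (ψ.extend B.I p.1, p.2)) (ψ.source ×ˢ univ) := by
    have h1 : ContMDiffOn (B.I.prod 𝓘(ℝ, F)) 𝓘(ℝ, B.E × F) ∞
      (fun p : B × F => (ψ.extend B.I p.1, p.2)) (ψ.source ×ˢ univ) :=
      (hψs.comp contMDiffOn_fst (fun p hp => hp.1)).prodMk_space contMDiffOn_snd
    exact e.symm.contDiff.contMDiff.comp_contMDiffOn h1
  refine ⟨{ dom := φ.source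
            cod := (ψ.source ×ˢ univ) ∩
              (fun p : B × F => e.symm (ψ.extend B.I p.1, p.2)) ⁻¹' (φ.extend T.I).target
            coord := fun z => (e (φ.extend T.I z)).2
            par := fun p => (φ.extend T.I).symm (e.symm (ψ.extend B.I p.1, p.2))
            isOpen_dom := φ.open_source
            isOpen_cod := hg.continuousOn.isOpen_inter_preimage (ψ.open_source.prod isOpen_univ) hto
            smooth_coord := ?_
            smooth_par := hφt.comp (hg.mono inter_subset_left) fun p hp => hp.2
            mem_cod := ?_
            mem_dom := ?_
            proj_par := ?_
            coord_par := ?_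
            par_coord := ?_ }, h.mem_domChart_source⟩
  · have h1 : ContDiff ℝ ∞ (fun v => (e v).2) := contDiff_snd.comp e.contDiff
    exact h1.contMDiff.comp_contMDiffOn hφs
  · intro z hz
    refine ⟨⟨hπ z hz, trivial⟩, ?_⟩
    change e.symm (ψ.extend B.I (π z), (e (φ.extend T.I z)).2) ∈ (φ.extend T.I).target
    rw [hvz z hz]
    exact (φ.extend T.I).map_source (by simpa using hz)
  · intro p hp
    simpa using (φ.extend T.I).map_target hp.2
  · intro p hp
    have hz : (φ.extend T.I).symm (e.symm (ψ.extend B.I p.1, p.2)) ∈ φ.source := by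
      simpa using (φ.extend T.I).map_target hp.2
    have h1 := key _ hp.2
    rw [e.apply_symm_apply] at h1
    exact (ψ.extend B.I).injOn (by simpa using hπ _ hz) (by simpa using hp.1.1) h1
  · intro p hp
    rw [(φ.extend T.I).right_inv hp.2, e.apply_symm_apply]
  · intro z hz
    change (φ.extend T.I).symm (e.symm (ψ.extend B.I (π z), (e (φ.extend T.I z)).2)) = z
    rw [hvz z hz, (φ.extend T.I).left_inv (by simpa using hz)]

end FibreChart

namespace FibreChart
variable {T B : SmoothManifold.{u}} {π : T → B} {F : Type*} [NormedAddCommGroup F]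
    [NormedSpace ℝ F] (c : FibreChart π F)

theorem contMDiffAt_coord {z : T} (hz : z ∈ c.dom) : ContMDiffAt T.I 𝓘(ℝ, F) ∞ c.coord z :=
  c.smooth_coord.contMDiffAt (c.isOpen_dom.mem_nhds hz)

theorem contMDiffAt_par {p : B × F} (hp : p ∈ c.cod) :
    ContMDiffAt (B.I.prod 𝓘(ℝ, F)) T.I ∞ c.par p :=
  c.smooth_par.contMDiffAt (c.isOpen_cod.mem_nhds hp)

theorem tder_par_coord (hπ : ContMDiff T.I B.I ∞ π) {z : T} (hz : z ∈ c.dom) (w : T.E) :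
    tder (B.I.prod 𝓘(ℝ, F)) T.I c.par (π z, c.coord z)
      (tder T.I B.I π z w, tder T.I 𝓘(ℝ, F) c.coord z w) = w := by
  have h1 : (fun z => c.par (π z, c.coord z)) =ᶠ[𝓝 z] fun z => z := by
    filter_upwards [c.isOpen_dom.mem_nhds hz] with y hy using c.par_coord y hy
  have hd1 := (hπ z).mdifferentiableAt (by simp)
  have hd2 := (c.contMDiffAt_coord hz).mdifferentiableAt (by simp)
  have h2 := tder_comp (f := fun z => (π z, c.coord z))
    ((c.contMDiffAt_par (c.mem_cod z hz)).mdifferentiableAt (by simp)) (hd1.prodMk hd2)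
  rw [h1.tder_eq, tder_id, tder_prodMk hd1 hd2] at h2
  exact (congrArg (fun f => f w) h2).symm

theorem tder_proj_par (hπ : ContMDiff T.I B.I ∞ π) {p : B × F} (hp : p ∈ c.cod) (u : B.E × F) :
    tder T.I B.I π (c.par p) (tder (B.I.prod 𝓘(ℝ, F)) T.I c.par p u) = u.1 := by
  have h1 : (fun p => π (c.par p)) =ᶠ[𝓝 p] fun p => p.1 := by
    filter_upwards [c.isOpen_cod.mem_nhds hp] with y hy using c.proj_par y hy
  have h2 := tder_comp ((hπ _).mdifferentiableAt (by simp))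
    ((c.contMDiffAt_par hp).mdifferentiableAt (by simp))
  rw [h1.tder_eq] at h2
  have h3 : tder (B.I.prod 𝓘(ℝ, F)) B.I (fun p : B × F => p.1) p =
    ContinuousLinearMap.fst ℝ B.E F := mfderiv_fst
  rw [h3] at h2
  exact (congrArg (fun f => f u) h2).symm

/-- A curve in the base lifts with any prescribed compatible initial velocity. -/
theorem exists_curve (hπ : ContMDiff T.I B.I ∞ π) {b : ℝ → B} (hb : ContMDiffAt 𝓘(ℝ, ℝ) B.I ∞ b 0)
    {z : T} (hz : z ∈ c.dom) (hzb : π z = b 0) {w : T.E}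
    (hw : tder T.I B.I π z w = tder 𝓘(ℝ, ℝ) B.I b 0 1) :
    ∃ ζ : ℝ → T, ContMDiffAt 𝓘(ℝ, ℝ) T.I ∞ ζ 0 ∧ ζ 0 = z ∧ (∀ᶠ ε in 𝓝 0, π (ζ ε) = b ε) ∧
      tder 𝓘(ℝ, ℝ) T.I ζ 0 1 = w := by
  set k := tder T.I 𝓘(ℝ, F) c.coord z w with hk
  have hl : ContDiff ℝ ∞ (fun ε : ℝ => c.coord z + ε • k) := by fun_prop
  have hl' := hl.contMDiff.contMDiffAt (x := 0)
  have h0 : (b 0, c.coord z + (0 : ℝ) • k) = (π z, c.coord z) := by rw [hzb, zero_smul, add_zero]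
  have hm : (b 0, c.coord z + (0 : ℝ) • k) ∈ c.cod := h0 ▸ c.mem_cod z hz
  have hs := hb.prodMk hl'
  refine ⟨fun ε => c.par (b ε, c.coord z + ε • k), (c.contMDiffAt_par hm).comp 0 hs, ?_, ?_, ?_⟩
  · change c.par (b 0, c.coord z + (0 : ℝ) • k) = z
    rw [h0, c.par_coord z hz]
  · have := hs.continuousAt.preimage_mem_nhds (c.isOpen_cod.mem_nhds hm)
    filter_upwards [this] with ε hε using c.proj_par _ hε
  · have hd1 := hb.mdifferentiableAt (by simp)
    have hd2 := hl'.mdifferentiableAt (by simp)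
    have h2 := tder_comp (f := fun ε : ℝ => (b ε, c.coord z + ε • k))
      ((c.contMDiffAt_par hm).mdifferentiableAt (by simp)) (hd1.prodMk hd2)
    rw [h2, tder_prodMk hd1 hd2, h0]
    have h3 : tder 𝓘(ℝ, ℝ) 𝓘(ℝ, F) (fun ε : ℝ => c.coord z + ε • k) 0 1 = k := by
      rw [tder_eq_fderiv, fderiv_const_add, fderiv_smul_const differentiableAt_fun_id]
      simp
    have h4 := c.tder_par_coord hπ hz w
    rw [hw, ← hk, ← h3] at h4
    exact h4

end FibreChart

/-- A curve with prescribed initial velocity. -/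
theorem SmoothManifold.exists_curve {M : SmoothManifold.{u}} (x : M) (v : M.E) :
    ∃ ζ : ℝ → M, ContMDiffAt 𝓘(ℝ, ℝ) M.I ∞ ζ 0 ∧ ζ 0 = x ∧ tder 𝓘(ℝ, ℝ) M.I ζ 0 1 = v := by
  set φ := extChartAt M.I x
  have hφ : ContMDiffAt M.I 𝓘(ℝ, M.E) ∞ φ x := contMDiffAt_extChartAt
  have hψ : ContMDiffAt 𝓘(ℝ, M.E) M.I ∞ φ.symm (φ x) :=
    (contMDiffOn_extChartAt_symm x).contMDiffAt (extChartAt_target_mem_nhds x)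
  set k := tder M.I 𝓘(ℝ, M.E) φ x v with hk
  have hl : ContDiff ℝ ∞ (fun ε : ℝ => φ x + ε • k) := by fun_prop
  have hl' := hl.contMDiff.contMDiffAt (x := 0)
  have h0 : φ x + (0 : ℝ) • k = φ x := by simp
  rw [← h0] at hψ
  refine ⟨fun ε => φ.symm (φ x + ε • k), hψ.comp 0 hl', ?_, ?_⟩
  · simp [φ]
  · rw [tder_comp (g := φ.symm) (f := fun ε : ℝ => φ x + ε • k) (hψ.mdifferentiableAt (by simp))
      (hl'.mdifferentiableAt (by simp)), h0]
    have h3 : tder 𝓘(ℝ, ℝ) 𝓘(ℝ, M.E) (fun ε : ℝ => φ x + ε • k) 0 1 = k := by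
      rw [tder_eq_fderiv, fderiv_const_add, fderiv_smul_const differentiableAt_fun_id]
      simp
    rw [ContinuousLinearMap.comp_apply, h3, hk]
    rw [h0] at hψ
    have h4 := tder_comp (hψ.mdifferentiableAt (by simp)) (hφ.mdifferentiableAt (by simp))
    have h5 : (fun y => φ.symm (φ y)) =ᶠ[𝓝 x] fun y => y := by
      filter_upwards [extChartAt_source_mem_nhds (I := M.I) x] with y hy using φ.left_inv hy
    rw [h5.tder_eq, tder_id] at h4
    exact (congrArg (fun f => f v) h4).symm

namespace LieGroupoid
variable {T B : SmoothManifold.{u}} (Γ : LieGroupoid T B)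

theorem inv_mul_cancel_left {g h : T} (e : Γ.src g = Γ.tgt h) :
    Γ.mul (Γ.inv g) (Γ.mul g h) = h := by
  rw [← Γ.mul_assoc _ _ _ (Γ.src_inv g) e, Γ.inv_mul, e, Γ.unit_mul]

theorem mul_inv_cancel_left {g k : T} (e : Γ.tgt g = Γ.tgt k) :
    Γ.mul g (Γ.mul (Γ.inv g) k) = k := by
  rw [← Γ.mul_assoc _ _ _ (Γ.tgt_inv g).symm ((Γ.src_inv g).trans e), Γ.mul_inv, e, Γ.unit_mul]

theorem inv_mul_mul {g h k : T} (e : Γ.src g = Γ.tgt h) (e' : Γ.tgt h = Γ.tgt k) :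
    Γ.mul (Γ.inv (Γ.mul g h)) (Γ.mul g k) = Γ.mul (Γ.inv h) k := by
  have h1 : Γ.src h = Γ.tgt (Γ.mul (Γ.inv h) k) := by
    rw [Γ.tgt_mul _ _ ((Γ.src_inv h).trans e'), Γ.tgt_inv]
  have h2 : Γ.mul (Γ.mul g h) (Γ.mul (Γ.inv h) k) = Γ.mul g k := by
    rw [Γ.mul_assoc _ _ _ e h1, Γ.mul_inv_cancel_left e']
  rw [← h2, Γ.inv_mul_cancel_left (by rw [Γ.src_mul _ _ e, h1])]

theorem smooth_src : ContMDiff T.I B.I ∞ Γ.src := Γ.src_submersion.contMDiff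

theorem smooth_tgt : ContMDiff T.I B.I ∞ Γ.tgt := Γ.tgt_submersion.contMDiff

section
variable {E H M : Type*} [NormedAddCommGroup E] [NormedSpace ℝ E] [TopologicalSpace H]
  {I : ModelWithCorners ℝ E H} [TopologicalSpace M] [ChartedSpace H M]

theorem contMDiffAt_mul {f g : M → T} {p : M} (hf : ContMDiffAt I T.I ∞ f p)
    (hg : ContMDiffAt I T.I ∞ g p) (h : ∀ᶠ q in 𝓝 p, Γ.src (f q) = Γ.tgt (g q)) :
    ContMDiffAt I T.I ∞ (fun q => Γ.mul (f q) (g q)) p := by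
  have h1 : ContMDiffWithinAt I T.I ∞ (fun q => Γ.mul (f q) (g q))
      {q | Γ.src (f q) = Γ.tgt (g q)} p :=
    ContMDiffWithinAt.comp (g := fun p : T × T => Γ.mul p.1 p.2) p
      (Γ.smooth_mul (f p, g p) h.self_of_nhds) (hf.prodMk hg).contMDiffWithinAt fun q hq => hq
  exact h1.contMDiffAt h

/-- The derivative of the multiplication at a composable pair. -/
noncomputable def dmul (g h : T) : T.E × T.E →L[ℝ] T.E :=
  mfderivWithin (T.I.prod T.I) T.I (fun p : T × T => Γ.mul p.1 p.2)
    {p : T × T | Γ.src p.1 = Γ.tgt p.2} (g, h)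

theorem tder_mul {f g : M → T} {p : M} (hf : MDifferentiableAt I T.I f p)
    (hg : MDifferentiableAt I T.I g p) (h : ∀ᶠ q in 𝓝 p, Γ.src (f q) = Γ.tgt (g q)) (e : E) :
    tder I T.I (fun q => Γ.mul (f q) (g q)) p e =
      Γ.dmul (f p) (g p) (tder I T.I f p e, tder I T.I g p e) := by
  have h1 := ((Γ.smooth_mul (f p, g p) h.self_of_nhds).mdifferentiableWithinAt
    (by simp)).hasMFDerivWithinAt
  have h2 := (hf.prodMk hg).hasMFDerivAt.hasMFDerivWithinAt
    (s := {q | Γ.src (f q) = Γ.tgt (g q)})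
  have h3 := (HasMFDerivWithinAt.comp (u := {p : T × T | Γ.src p.1 = Γ.tgt p.2}) p h1 h2
    fun q hq => hq).hasMFDerivAt h
  have h4 := h3.mfderiv
  rw [mfderiv_prodMk hf hg] at h4
  exact congrArg (fun f : E →L[ℝ] T.E => f e) h4

end

theorem exists_fibreChart : ∃ (F : Type) (_ : NormedAddCommGroup F) (_ : NormedSpace ℝ F)
    (_ : FiniteDimensional ℝ F), ∀ z : T, ∃ c : FibreChart Γ.tgt F, z ∈ c.dom := by
  by_cases hT : Nonempty T
  · obtain ⟨F, i₁, i₂, hF⟩ := Γ.tgt_submersion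
    obtain ⟨z⟩ := hT
    have e := (hF z).equiv
    have : FiniteDimensional ℝ (B.E × F) := e.toLinearEquiv.finiteDimensional
    have : FiniteDimensional ℝ F :=
      Module.Finite.of_surjective (LinearMap.snd ℝ B.E F) Prod.snd_surjective
    exact ⟨F, i₁, i₂, this, fun z => FibreChart.exists_of_isSubmersionAt (hF z)⟩
  · exact ⟨ℝ, inferInstance, inferInstance, inferInstance, fun z => (hT ⟨z⟩).elim⟩

end LieGroupoid

theorem contDiff_continuousLinearMap_det {F : Type*} [NormedAddCommGroup F] [NormedSpace ℝ F]
    [FiniteDimensional ℝ F] {n : WithTop ℕ∞} :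
    ContDiff ℝ n (fun A : F →L[ℝ] F => A.det) := by
  let b := Module.finBasis ℝ F
  have h : (fun A : F →L[ℝ] F => A.det) = fun A : F →L[ℝ] F =>
      (LinearMap.toMatrix b b (A : F →ₗ[ℝ] F)).det := by
    funext A
    rw [LinearMap.det_toMatrix]
  rw [h]
  simp only [Matrix.det_apply]
  refine ContDiff.sum fun σ _ => ContDiff.const_smul _ (contDiff_prod fun i _ => ?_)
  simp only [LinearMap.toMatrix_apply]
  have := (LinearMap.toContinuousLinearMap (b.coord (σ i))).contDiff.comp
    ((ContinuousLinearMap.apply ℝ F (b i)).contDiff (n := n))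
  exact this

namespace LieGroupoid
variable {T B : SmoothManifold.{u}} (Γ : LieGroupoid T B) {F : Type} [NormedAddCommGroup F]
  [NormedSpace ℝ F] (c₀ : FibreChart Γ.tgt F)

theorem contMDiffAt_inv_mul {E H M : Type*} [NormedAddCommGroup E] [NormedSpace ℝ E]
    [TopologicalSpace H] {I : ModelWithCorners ℝ E H} [TopologicalSpace M] [ChartedSpace H M]
    {f g : M → T} {p : M} (hf : ContMDiffAt I T.I ∞ f p)
    (hg : ContMDiffAt I T.I ∞ g p) (h : ∀ᶠ q in 𝓝 p, Γ.tgt (f q) = Γ.tgt (g q)) :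
    ContMDiffAt I T.I ∞ (fun q => Γ.mul (Γ.inv (f q)) (g q)) p :=
  Γ.contMDiffAt_mul ((Γ.smooth_inv _).comp p hf) hg
    (by filter_upwards [h] with q hq using (Γ.src_inv _).trans hq)

/-- The fibre coordinate, in the chart `c₀` around units, of `z⁻¹ z'`, where `z` and `z'` are
points in a common fibre, given in a chart `c`. -/
noncomputable def frame (c : FibreChart Γ.tgt F) (p : B × F) (q : F) : F :=
  c₀.coord (Γ.mul (Γ.inv (c.par p)) (c.par (p.1, q)))

/-- The objects whose unit lies in the chart `c₀`. -/
def base : Set B := Γ.unit ⁻¹' c₀.dom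

theorem isOpen_base : IsOpen (Γ.base c₀) := c₀.isOpen_dom.preimage Γ.smooth_unit.continuous

variable {Γ c₀}

theorem contMDiffAt_frame {c : FibreChart Γ.tgt F} {p : B × F} (hp : p ∈ c.cod)
    (hb : Γ.src (c.par p) ∈ Γ.base c₀) :
    ContMDiffAt ((B.I.prod 𝓘(ℝ, F)).prod 𝓘(ℝ, F)) 𝓘(ℝ, F) ∞
      (fun x : (B × F) × F => Γ.frame c₀ c x.1 x.2) (p, p.2) := by
  have h1 : ContMDiffAt ((B.I.prod 𝓘(ℝ, F)).prod 𝓘(ℝ, F)) T.I ∞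
      (fun x : (B × F) × F => c.par x.1) (p, p.2) :=
    (c.contMDiffAt_par hp).comp (p, p.2) contMDiffAt_fst
  have h2' : ContMDiffAt ((B.I.prod 𝓘(ℝ, F)).prod 𝓘(ℝ, F)) (B.I.prod 𝓘(ℝ, F)) ∞
      (fun x : (B × F) × F => (x.1.1, x.2)) (p, p.2) :=
    (contMDiffAt_fst.comp (p, p.2) contMDiffAt_fst).prodMk contMDiffAt_snd
  have h2 : ContMDiffAt ((B.I.prod 𝓘(ℝ, F)).prod 𝓘(ℝ, F)) T.I ∞
      (fun x : (B × F) × F => c.par (x.1.1, x.2)) (p, p.2) :=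
    ContMDiffAt.comp (p, p.2) (c.contMDiffAt_par hp) h2'
  have h3 : ∀ᶠ x : (B × F) × F in 𝓝 (p, p.2), Γ.tgt (c.par x.1) = Γ.tgt (c.par (x.1.1, x.2)) := by
    filter_upwards [continuousAt_fst.preimage_mem_nhds (c.isOpen_cod.mem_nhds hp),
      h2'.continuousAt.preimage_mem_nhds (c.isOpen_cod.mem_nhds hp)] with x hx hx'
    rw [c.proj_par _ hx, c.proj_par _ hx']
  have h4 := Γ.contMDiffAt_inv_mul h1 h2 h3
  refine ContMDiffAt.comp (p, p.2) (c₀.contMDiffAt_coord (z := Γ.mul _ _) ?_) h4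
  change Γ.mul (Γ.inv (c.par p)) (c.par p) ∈ c₀.dom
  rw [Γ.inv_mul]
  exact hb

theorem differentiableAt_frame {c : FibreChart Γ.tgt F} {p : B × F} (hp : p ∈ c.cod)
    (hb : Γ.src (c.par p) ∈ Γ.base c₀) : DifferentiableAt ℝ (Γ.frame c₀ c p) p.2 := by
  have h : ContMDiffAt 𝓘(ℝ, F) 𝓘(ℝ, F) ∞ (Γ.frame c₀ c p) p.2 :=
    ContMDiffAt.comp (g := fun x : (B × F) × F => Γ.frame c₀ c x.1 x.2) (f := fun q => (p, q)) p.2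
      (contMDiffAt_frame hp hb) (contMDiffAt_const.prodMk contMDiffAt_id)
  exact h.contDiffAt.differentiableAt (by simp)

variable (Γ c₀) in
/-- The density of the Haar measure in a chart. -/
noncomputable def density (c : FibreChart Γ.tgt F) (p : B × F) : ℝ :=
  |(fderiv ℝ (Γ.frame c₀ c p) p.2).det|

theorem det_frame_ne_zero [FiniteDimensional ℝ F] {c : FibreChart Γ.tgt F} {p : B × F}
    (hp : p ∈ c.cod) (hb : Γ.src (c.par p) ∈ Γ.base c₀) :
    (fderiv ℝ (Γ.frame c₀ c p) p.2).det ≠ 0 := by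
  set z := c.par p with hz
  have hzd := c.mem_dom p hp
  have htz : Γ.tgt z = p.1 := c.proj_par p hp
  set q₀ := c₀.coord (Γ.unit (Γ.src z)) with hq₀
  have hub : Γ.unit (Γ.src z) ∈ c₀.dom := hb
  have hfp : Γ.frame c₀ c p p.2 = q₀ := by
    change c₀.coord (Γ.mul (Γ.inv z) z) = q₀
    rw [Γ.inv_mul]
  have hq₀c : (Γ.src z, q₀) ∈ c₀.cod := by
    have := c₀.mem_cod _ hub
    rwa [Γ.tgt_unit] at this
  have hpar : c₀.par (Γ.src z, q₀) = Γ.unit (Γ.src z) := by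
    have := c₀.par_coord _ hub
    rwa [Γ.tgt_unit] at this
  let N : F → F := fun q => c.coord (Γ.mul z (c₀.par (Γ.src z, q)))
  have hl : ContMDiffAt 𝓘(ℝ, F) (B.I.prod 𝓘(ℝ, F)) ∞ (fun q : F => (Γ.src z, q)) q₀ :=
    contMDiffAt_const.prodMk contMDiffAt_id
  have hN : DifferentiableAt ℝ N q₀ := by
    have h1 : ContMDiffAt 𝓘(ℝ, F) T.I ∞ (fun q => Γ.mul z (c₀.par (Γ.src z, q))) q₀ := by
      refine Γ.contMDiffAt_mul contMDiffAt_const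
        (ContMDiffAt.comp q₀ (c₀.contMDiffAt_par hq₀c) hl) ?_
      filter_upwards [hl.continuousAt.preimage_mem_nhds (c₀.isOpen_cod.mem_nhds hq₀c)] with q hq
      exact (c₀.proj_par _ hq).symm
    have h2 : ContMDiffAt 𝓘(ℝ, F) 𝓘(ℝ, F) ∞ N q₀ := by
      refine ContMDiffAt.comp (g := c.coord) q₀ (c.contMDiffAt_coord ?_) h1
      rw [hpar, Γ.mul_unit]
      exact hzd
    exact h2.contDiffAt.differentiableAt (by simp)
  have hl' : ContMDiffAt 𝓘(ℝ, F) (B.I.prod 𝓘(ℝ, F)) ∞ (fun q : F => (p.1, q)) p.2 :=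
    contMDiffAt_const.prodMk contMDiffAt_id
  have hpc : ∀ᶠ q in 𝓝 p.2, (p.1, q) ∈ c.cod :=
    hl'.continuousAt.preimage_mem_nhds (c.isOpen_cod.mem_nhds hp)
  have hw : ContMDiffAt 𝓘(ℝ, F) T.I ∞ (fun q => Γ.mul (Γ.inv z) (c.par (p.1, q))) p.2 := by
    refine Γ.contMDiffAt_inv_mul contMDiffAt_const
      (ContMDiffAt.comp p.2 (c.contMDiffAt_par hp) hl') ?_
    filter_upwards [hpc] with q hq
    rw [htz, c.proj_par _ hq]
  have hwd : ∀ᶠ q in 𝓝 p.2, Γ.mul (Γ.inv z) (c.par (p.1, q)) ∈ c₀.dom := by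
    refine hw.continuousAt.preimage_mem_nhds (c₀.isOpen_dom.mem_nhds ?_)
    change Γ.mul (Γ.inv z) z ∈ c₀.dom
    rw [Γ.inv_mul]
    exact hub
  have hid : (fun q => N (Γ.frame c₀ c p q)) =ᶠ[𝓝 p.2] fun q => q := by
    filter_upwards [hpc, hwd] with q hq hqd
    have h1 : Γ.tgt z = Γ.tgt (c.par (p.1, q)) := by rw [htz, c.proj_par _ hq]
    have h2 := c₀.par_coord _ hqd
    rw [Γ.tgt_mul _ _ ((Γ.src_inv z).trans h1), Γ.tgt_inv] at h2
    change c.coord (Γ.mul z (c₀.par (Γ.src z, c₀.coord (Γ.mul (Γ.inv z) (c.par (p.1, q)))))) = q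
    rw [h2, Γ.mul_inv_cancel_left h1, c.coord_par _ hq]
  have hN' : DifferentiableAt ℝ N (Γ.frame c₀ c p p.2) := by rw [hfp]; exact hN
  have hcomp := fderiv_comp p.2 hN' (differentiableAt_frame hp hb)
  have hid' := hid.fderiv_eq (𝕜 := ℝ)
  rw [show (fun q : F => q) = id from rfl, fderiv_id] at hid'
  rw [show N ∘ Γ.frame c₀ c p = fun q => N (Γ.frame c₀ c p q) from rfl, hid'] at hcomp
  have hdet := congrArg ContinuousLinearMap.det hcomp
  intro h0
  have h3 : ((fderiv ℝ N (Γ.frame c₀ c p p.2)).comp (fderiv ℝ (Γ.frame c₀ c p) p.2)).det =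
      (fderiv ℝ N (Γ.frame c₀ c p p.2)).det * (fderiv ℝ (Γ.frame c₀ c p) p.2).det :=
    LinearMap.det_comp _ _
  rw [h3, h0, mul_zero] at hdet
  have h4 : (ContinuousLinearMap.id ℝ F).det = 1 := LinearMap.det_id
  rw [h4] at hdet
  exact one_ne_zero hdet

theorem density_pos [FiniteDimensional ℝ F] {c : FibreChart Γ.tgt F} {p : B × F}
    (hp : p ∈ c.cod) (hb : Γ.src (c.par p) ∈ Γ.base c₀) : 0 < Γ.density c₀ c p :=
  abs_pos.2 (det_frame_ne_zero hp hb)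

theorem contDiffAt_density [FiniteDimensional ℝ F] {c : FibreChart Γ.tgt F} {P : Type*}
    [NormedAddCommGroup P] [NormedSpace ℝ P] {b : P → B} {p : P} {q : F}
    (hbs : ContMDiffAt 𝓘(ℝ, P) B.I ∞ b p) (hp : (b p, q) ∈ c.cod)
    (hb : Γ.src (c.par (b p, q)) ∈ Γ.base c₀) :
    ContDiffAt ℝ ∞ (fun x : P × F => Γ.density c₀ c (b x.1, x.2)) (p, q) := by
  have h1 : ContMDiffAt 𝓘(ℝ, (P × F) × F) ((B.I.prod 𝓘(ℝ, F)).prod 𝓘(ℝ, F)) ∞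
      (fun x : (P × F) × F => ((b x.1.1, x.1.2), x.2)) ((p, q), q) := by
    have e1 : ContMDiffAt 𝓘(ℝ, (P × F) × F) 𝓘(ℝ, P) ∞ (fun x : (P × F) × F => x.1.1) ((p, q), q) :=
      (contDiff_fst.comp contDiff_fst).contMDiff.contMDiffAt
    have e2 : ContMDiffAt 𝓘(ℝ, (P × F) × F) 𝓘(ℝ, F) ∞ (fun x : (P × F) × F => x.1.2) ((p, q), q) :=
      (contDiff_snd.comp contDiff_fst).contMDiff.contMDiffAt
    have e3 : ContMDiffAt 𝓘(ℝ, (P × F) × F) 𝓘(ℝ, F) ∞ (fun x : (P × F) × F => x.2) ((p, q), q) :=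
      contDiff_snd.contMDiff.contMDiffAt
    exact ((ContMDiffAt.comp (g := b) ((p, q), q) hbs e1).prodMk e2).prodMk e3
  have h2 : ContMDiffAt 𝓘(ℝ, (P × F) × F) 𝓘(ℝ, F) ∞
      (fun x : (P × F) × F => Γ.frame c₀ c (b x.1.1, x.1.2) x.2) ((p, q), q) :=
    ContMDiffAt.comp (g := fun x : (B × F) × F => Γ.frame c₀ c x.1 x.2) ((p, q), q)
      (contMDiffAt_frame hp hb) h1
  have h3 : ContDiffAt ℝ ∞
      (fun x : P × F => fderiv ℝ (Γ.frame c₀ c (b x.1, x.2)) x.2) (p, q) :=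
    ContDiffAt.fderiv (f := fun x : P × F => Γ.frame c₀ c (b x.1, x.2)) (g := fun x => x.2)
      h2.contDiffAt contDiffAt_snd (by simp)
  have h4 := contDiff_continuousLinearMap_det.contDiffAt.comp (p, q) h3
  exact (contDiffAt_abs (det_frame_ne_zero hp hb)).comp (p, q) h4

end LieGroupoid

namespace LieGroupoid
variable {T B : SmoothManifold.{u}} (Γ : LieGroupoid T B) {F : Type} [NormedAddCommGroup F]
  [NormedSpace ℝ F] (c₀ : FibreChart Γ.tgt F)

/-- The coordinates of a fibre in a chart. -/
def slice (c : FibreChart Γ.tgt F) (y : B) : Set F :=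
  {q | (y, q) ∈ c.cod ∧ Γ.src (c.par (y, q)) ∈ Γ.base c₀}

variable {Γ c₀}

theorem continuousOn_par_slice (c : FibreChart Γ.tgt F) (y : B) :
    ContinuousOn (fun q => c.par (y, q)) {q | (y, q) ∈ c.cod} :=
  c.smooth_par.continuousOn.comp (by fun_prop) fun _ hq => hq

theorem isOpen_slice (c : FibreChart Γ.tgt F) (y : B) : IsOpen (Γ.slice c₀ c y) := by
  have h1 : IsOpen {q : F | (y, q) ∈ c.cod} := c.isOpen_cod.preimage (by fun_prop)
  exact (Γ.smooth_src.continuous.comp_continuousOn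
    (continuousOn_par_slice c y)).isOpen_inter_preimage h1 (Γ.isOpen_base c₀)

theorem continuousOn_density [FiniteDimensional ℝ F] (c : FibreChart Γ.tgt F) (y : B) :
    ContinuousOn (fun q => Γ.density c₀ c (y, q)) (Γ.slice c₀ c y) := by
  intro q hq
  have h := contDiffAt_density (P := ℝ) (p := 0) (b := fun _ => y) contMDiffAt_const hq.1 hq.2
  have h2 : ContinuousAt (fun q : F => ((0 : ℝ), q)) q := by fun_prop
  exact (ContinuousAt.comp (f := fun q : F => ((0 : ℝ), q)) h.continuousAt h2).continuousWithinAt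

variable (Γ) in
/-- Left translation by `g`, in charts. -/
noncomputable def transl (c c' : FibreChart Γ.tgt F) (g : T) (q : F) : F :=
  c'.coord (Γ.mul g (c.par (Γ.src g, q)))

section transl
variable {c c' : FibreChart Γ.tgt F} {g : T} {q : F}

theorem par_transl (hq : (Γ.src g, q) ∈ c.cod) (h : Γ.mul g (c.par (Γ.src g, q)) ∈ c'.dom) :
    c'.par (Γ.tgt g, Γ.transl c c' g q) = Γ.mul g (c.par (Γ.src g, q)) := by
  have h1 := c'.par_coord _ h
  rwa [Γ.tgt_mul _ _ (c.proj_par _ hq).symm] at h1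

theorem transl_mem_cod (hq : (Γ.src g, q) ∈ c.cod) (h : Γ.mul g (c.par (Γ.src g, q)) ∈ c'.dom) :
    (Γ.tgt g, Γ.transl c c' g q) ∈ c'.cod := by
  have h1 := c'.mem_cod _ h
  rwa [Γ.tgt_mul _ _ (c.proj_par _ hq).symm] at h1

theorem transl_mem_slice (hq : q ∈ Γ.slice c₀ c (Γ.src g))
    (h : Γ.mul g (c.par (Γ.src g, q)) ∈ c'.dom) :
    Γ.transl c c' g q ∈ Γ.slice c₀ c' (Γ.tgt g) := by
  refine ⟨transl_mem_cod hq.1 h, ?_⟩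
  rw [par_transl hq.1 h, Γ.src_mul _ _ (c.proj_par _ hq.1).symm]
  exact hq.2

theorem contMDiffAt_mul_par (hq : (Γ.src g, q) ∈ c.cod) :
    ContMDiffAt 𝓘(ℝ, F) T.I ∞ (fun q => Γ.mul g (c.par (Γ.src g, q))) q := by
  have hl : ContMDiffAt 𝓘(ℝ, F) (B.I.prod 𝓘(ℝ, F)) ∞ (fun q : F => (Γ.src g, q)) q :=
    contMDiffAt_const.prodMk contMDiffAt_id
  refine Γ.contMDiffAt_mul contMDiffAt_const (ContMDiffAt.comp q (c.contMDiffAt_par hq) hl) ?_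
  filter_upwards [hl.continuousAt.preimage_mem_nhds (c.isOpen_cod.mem_nhds hq)] with q hq
  exact (c.proj_par _ hq).symm

theorem differentiableAt_transl (hq : (Γ.src g, q) ∈ c.cod)
    (h : Γ.mul g (c.par (Γ.src g, q)) ∈ c'.dom) : DifferentiableAt ℝ (Γ.transl c c' g) q :=
  (ContMDiffAt.comp (g := c'.coord) q (c'.contMDiffAt_coord h)
    (contMDiffAt_mul_par hq)).contDiffAt.differentiableAt (by simp)

theorem density_transl (hq : q ∈ Γ.slice c₀ c (Γ.src g))
    (h : Γ.mul g (c.par (Γ.src g, q)) ∈ c'.dom) :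
    Γ.density c₀ c (Γ.src g, q) =
      |(fderiv ℝ (Γ.transl c c' g) q).det| *
        Γ.density c₀ c' (Γ.tgt g, Γ.transl c c' g q) := by
  set τ := Γ.transl c c' g with hτ
  have hs' := transl_mem_slice hq h
  have h1 : ∀ᶠ q' in 𝓝 q, (Γ.src g, q') ∈ c.cod ∧ Γ.mul g (c.par (Γ.src g, q')) ∈ c'.dom := by
    refine Filter.Eventually.and ?_ ((contMDiffAt_mul_par hq.1).continuousAt.preimage_mem_nhds
      (c'.isOpen_dom.mem_nhds h))
    have : ContinuousAt (fun q' : F => (Γ.src g, q')) q := by fun_prop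
    exact this.preimage_mem_nhds (c.isOpen_cod.mem_nhds hq.1)
  have h2 : Γ.frame c₀ c (Γ.src g, q) =ᶠ[𝓝 q]
      fun q' => Γ.frame c₀ c' (Γ.tgt g, τ q) (τ q') := by
    filter_upwards [h1] with q' hq'
    change c₀.coord _ = c₀.coord (Γ.mul (Γ.inv (c'.par (Γ.tgt g, τ q))) (c'.par (Γ.tgt g, τ q')))
    rw [par_transl hq.1 h, par_transl hq'.1 hq'.2, Γ.inv_mul_mul (c.proj_par _ hq.1).symm]
    rw [c.proj_par _ hq.1, c.proj_par _ hq'.1]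
  have h3 := fderiv_comp q (g := Γ.frame c₀ c' (Γ.tgt g, τ q)) (f := τ)
    (differentiableAt_frame hs'.1 hs'.2) (differentiableAt_transl hq.1 h)
  have h4 := h2.fderiv_eq (𝕜 := ℝ)
  rw [show (fun q' => Γ.frame c₀ c' (Γ.tgt g, τ q) (τ q')) =
    Γ.frame c₀ c' (Γ.tgt g, τ q) ∘ τ from rfl, h3] at h4
  unfold density
  change |(fderiv ℝ (Γ.frame c₀ c (Γ.src g, q)) q).det| = _
  rw [h4, mul_comm, ← abs_mul]
  congr 1
  exact LinearMap.det_comp _ _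

theorem injOn_transl :
    InjOn (Γ.transl c c' g)
      {q | (Γ.src g, q) ∈ c.cod ∧ Γ.mul g (c.par (Γ.src g, q)) ∈ c'.dom} := by
  intro q hq q' hq' e
  have h1 : Γ.mul g (c.par (Γ.src g, q)) = Γ.mul g (c.par (Γ.src g, q')) := by
    rw [← par_transl hq.1 hq.2, ← par_transl hq'.1 hq'.2, e]
  have h2 := congrArg (Γ.mul (Γ.inv g)) h1
  rw [Γ.inv_mul_cancel_left (c.proj_par _ hq.1).symm,
    Γ.inv_mul_cancel_left (c.proj_par _ hq'.1).symm] at h2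
  have h3 := congrArg c.coord h2
  rwa [c.coord_par _ hq.1, c.coord_par _ hq'.1] at h3

end transl

variable [MeasurableSpace T] [BorelSpace T] [MeasurableSpace F] [BorelSpace F]
  (μ : Measure F)

variable (Γ c₀) in
/-- The Haar measure on a fibre of the target map, in a chart. -/
noncomputable def fibreMeasure (c : FibreChart Γ.tgt F) (y : B) : Measure T :=
  ((μ.restrict (Γ.slice c₀ c y)).withDensity
    fun q => ENNReal.ofReal (Γ.density c₀ c (y, q))).map fun q => c.par (y, q)

theorem aemeasurable_par (c : FibreChart Γ.tgt F) (y : B) :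
    AEMeasurable (fun q => c.par (y, q)) (μ.restrict (Γ.slice c₀ c y)) :=
  ((continuousOn_par_slice c y).mono fun _ hq => hq.1).aemeasurable (isOpen_slice c y).measurableSet

theorem measurableSet_slice_par (c : FibreChart Γ.tgt F) (y : B) {A : Set T}
    (hA : MeasurableSet A) : MeasurableSet {q | q ∈ Γ.slice c₀ c y ∧ c.par (y, q) ∈ A} := by
  have h : Measurable ((Γ.slice c₀ c y).domRestrict fun q => c.par (y, q)) :=
    (((continuousOn_par_slice c y).mono fun _ hq => hq.1).domRestrict).measurable
  have h2 := (isOpen_slice (c₀ := c₀) c y).measurableSet.subtype_image (h hA)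
  convert h2 using 1
  ext q
  simp [Set.domRestrict, and_comm]

theorem fibreMeasure_apply [SFinite μ] (c : FibreChart Γ.tgt F) (y : B) {A : Set T}
    (hA : MeasurableSet A) :
    Γ.fibreMeasure c₀ μ c y A = ∫⁻ q in {q | q ∈ Γ.slice c₀ c y ∧ c.par (y, q) ∈ A},
      ENNReal.ofReal (Γ.density c₀ c (y, q)) ∂μ := by
  have h := aemeasurable_par (c₀ := c₀) μ c y
  unfold fibreMeasure
  rw [Measure.map_apply_of_aemeasurable (h.mono_ac (withDensity_absolutelyContinuous _ _)) hA,
    withDensity_apply', Measure.restrict_restrict' (isOpen_slice c y).measurableSet]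
  congr 2
  ext q
  exact and_comm

theorem lintegral_transl [μ.IsAddHaarMeasure] [FiniteDimensional ℝ F]
    {c c' : FibreChart Γ.tgt F} {g : T} {A D : Set T}
    (hA : MeasurableSet A) (hD : MeasurableSet D) (hA' : A ⊆ c'.dom) (hD' : D ⊆ c.dom) :
    ∫⁻ q in {q | q ∈ Γ.slice c₀ c (Γ.src g) ∧ c.par (Γ.src g, q) ∈ D ∧
        Γ.mul g (c.par (Γ.src g, q)) ∈ A}, ENNReal.ofReal (Γ.density c₀ c (Γ.src g, q)) ∂μ =
    ∫⁻ q in {q | q ∈ Γ.slice c₀ c' (Γ.tgt g) ∧ c'.par (Γ.tgt g, q) ∈ A ∧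
        Γ.mul (Γ.inv g) (c'.par (Γ.tgt g, q)) ∈ D},
        ENNReal.ofReal (Γ.density c₀ c' (Γ.tgt g, q)) ∂μ := by
  set S := {q | q ∈ Γ.slice c₀ c (Γ.src g) ∧ c.par (Γ.src g, q) ∈ D ∧
        Γ.mul g (c.par (Γ.src g, q)) ∈ A}
  have himg : {q | q ∈ Γ.slice c₀ c' (Γ.tgt g) ∧ c'.par (Γ.tgt g, q) ∈ A ∧
        Γ.mul (Γ.inv g) (c'.par (Γ.tgt g, q)) ∈ D} = Γ.transl c c' g '' S := by
    ext q
    constructor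
    · rintro ⟨h1, h2, h3⟩
      have e1 : Γ.tgt g = Γ.tgt (c'.par (Γ.tgt g, q)) := (c'.proj_par _ h1.1).symm
      have e0 : Γ.src (Γ.inv g) = Γ.tgt (c'.par (Γ.tgt g, q)) := (Γ.src_inv g).trans e1
      have e2 : Γ.tgt (Γ.mul (Γ.inv g) (c'.par (Γ.tgt g, q))) = Γ.src g := by
        rw [Γ.tgt_mul _ _ e0, Γ.tgt_inv]
      have e3 := c.par_coord _ (hD' h3)
      have e4 := c.mem_cod _ (hD' h3)
      rw [e2] at e3 e4
      refine ⟨c.coord (Γ.mul (Γ.inv g) (c'.par (Γ.tgt g, q))), ⟨⟨e4, ?_⟩, ?_, ?_⟩, ?_⟩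
      · rw [e3, Γ.src_mul _ _ e0]
        exact h1.2
      · rw [e3]
        exact h3
      · rw [e3, Γ.mul_inv_cancel_left e1]
        exact h2
      · unfold transl
        rw [e3, Γ.mul_inv_cancel_left e1, c'.coord_par _ h1.1]
    · rintro ⟨q, ⟨h1, h2, h3⟩, rfl⟩
      refine ⟨transl_mem_slice h1 (hA' h3), ?_, ?_⟩
      · rw [par_transl h1.1 (hA' h3)]
        exact h3
      · rw [par_transl h1.1 (hA' h3), Γ.inv_mul_cancel_left (c.proj_par _ h1.1).symm]
        exact h2
  have hS : MeasurableSet S := by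
    have h1 := measurableSet_slice_par (c₀ := c₀) c (Γ.src g) hD
    have h : Measurable ((Γ.slice c₀ c (Γ.src g)).domRestrict
        fun q => Γ.mul g (c.par (Γ.src g, q))) :=
      (ContinuousOn.domRestrict fun q hq =>
        (contMDiffAt_mul_par hq.1).continuousAt.continuousWithinAt).measurable
    have h2 := h1.inter ((isOpen_slice (c₀ := c₀) c (Γ.src g)).measurableSet.subtype_image (h hA))
    convert h2 using 1
    ext q
    simp [Set.domRestrict, S]
    tauto
  have hd : ∀ q ∈ S, HasFDerivWithinAt (Γ.transl c c' g) (fderiv ℝ (Γ.transl c c' g) q) S q :=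
    fun q hq => (differentiableAt_transl hq.1.1 (hA' hq.2.2)).hasFDerivAt.hasFDerivWithinAt
  have hinj : InjOn (Γ.transl c c' g) S :=
    (injOn_transl (c := c) (c' := c') (g := g)).mono (by
      intro q hq
      exact ⟨hq.1.1, hA' hq.2.2⟩)
  rw [himg, lintegral_image_eq_lintegral_abs_det_fderiv_mul μ hS hd hinj]
  refine setLIntegral_congr_fun hS fun q hq => ?_
  rw [density_transl hq.1 (hA' hq.2.2), ENNReal.ofReal_mul (abs_nonneg _)]

end LieGroupoid

namespace LieGroupoid
variable {T B : SmoothManifold.{u}} {Γ : LieGroupoid T B} {F : Type} [NormedAddCommGroup F]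
  [NormedSpace ℝ F] {c₀ : FibreChart Γ.tgt F}

theorem exists_countable_fibreChart [Nonempty T]
    (h : ∀ z : T, ∃ c : FibreChart Γ.tgt F, z ∈ c.dom) :
    ∃ cs : ℕ → FibreChart Γ.tgt F, ⋃ i, (cs i).dom = univ := by
  choose c hc using h
  obtain ⟨s, hs, hcov⟩ := TopologicalSpace.countable_cover_nhds
    fun z => (c z).isOpen_dom.mem_nhds (hc z)
  have hne : s.Nonempty := by
    by_contra h0
    rw [Set.not_nonempty_iff_eq_empty.1 h0] at hcov
    rw [biUnion_empty] at hcov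
    exact empty_ne_univ hcov
  obtain ⟨f, rfl⟩ := hs.exists_eq_range hne
  exact ⟨fun i => c (f i), by simpa using hcov⟩

variable [MeasurableSpace T] [BorelSpace T]

theorem measurableSet_disjointed_dom (cs : ℕ → FibreChart Γ.tgt F) (i : ℕ) :
    MeasurableSet (disjointed (fun i => (cs i).dom) i) :=
  .disjointed (fun i => (cs i).isOpen_dom.measurableSet) i

theorem measurableSet_transl (g : T) {A : Set T} (hA : MeasurableSet A) :
    MeasurableSet {h | Γ.tgt h = Γ.src g ∧ Γ.mul g h ∈ A} := by
  have hc : IsClosed {h | Γ.tgt h = Γ.src g} := isClosed_eq Γ.smooth_tgt.continuous continuous_const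
  have h : Measurable ({h | Γ.tgt h = Γ.src g}.domRestrict fun h => Γ.mul g h) := by
    refine (ContinuousOn.domRestrict ?_).measurable
    have h1 : ContinuousOn (fun h => (g, h)) {h | Γ.tgt h = Γ.src g} := by fun_prop
    exact Γ.smooth_mul.continuousOn.comp h1 fun h hh => hh.symm
  have h2 := hc.measurableSet.subtype_image (h hA)
  convert h2 using 1
  ext q
  simp [Set.domRestrict, and_comm]

variable [MeasurableSpace F] [BorelSpace F] (μ : Measure F)

variable (c₀) in
/-- The Haar measure on the fibre over `y` of the target map, restricted to the arrows whose source
lies in `Γ.base c₀`. -/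
noncomputable def haar (cs : ℕ → FibreChart Γ.tgt F) (y : B) : Measure T :=
  Measure.sum fun i => (Γ.fibreMeasure c₀ μ (cs i) y).restrict (disjointed (fun i => (cs i).dom) i)

variable {μ}

theorem haar_transl [μ.IsAddHaarMeasure] [FiniteDimensional ℝ F] {cs : ℕ → FibreChart Γ.tgt F}
    (hcs : ⋃ i, (cs i).dom = univ) (c : FibreChart Γ.tgt F) (g : T) {A : Set T}
    (hA : MeasurableSet A) (hA' : A ⊆ c.dom) :
    Γ.haar c₀ μ cs (Γ.src g) {h | Γ.tgt h = Γ.src g ∧ Γ.mul g h ∈ A} =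
      Γ.fibreMeasure c₀ μ c (Γ.tgt g) A := by
  have hm := measurableSet_transl (Γ := Γ) g hA
  have hm' : ∀ i, MeasurableSet {k | Γ.tgt k = Γ.tgt g ∧
      Γ.mul (Γ.inv g) k ∈ disjointed (fun i => (cs i).dom) i} := fun i => by
    have := measurableSet_transl (Γ := Γ) (Γ.inv g) (measurableSet_disjointed_dom cs i)
    rwa [Γ.src_inv] at this
  rw [haar, Measure.sum_apply _ hm]
  have key : ∀ i, (Γ.fibreMeasure c₀ μ (cs i) (Γ.src g)).restrict
      (disjointed (fun i => (cs i).dom) i) {h | Γ.tgt h = Γ.src g ∧ Γ.mul g h ∈ A} =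
      Γ.fibreMeasure c₀ μ c (Γ.tgt g) (A ∩ {k | Γ.tgt k = Γ.tgt g ∧
        Γ.mul (Γ.inv g) k ∈ disjointed (fun i => (cs i).dom) i}) := by
    intro i
    rw [Measure.restrict_apply hm,
      fibreMeasure_apply μ _ _ (hm.inter (measurableSet_disjointed_dom cs i)),
      fibreMeasure_apply μ _ _ (hA.inter (hm' i))]
    have h := lintegral_transl (c₀ := c₀) μ (c := cs i) (c' := c) (g := g) hA
      (measurableSet_disjointed_dom cs i) hA' (disjointed_subset _ i)
    convert h using 3
    · ext q
      constructor
      · rintro ⟨h1, ⟨_, h2⟩, h3⟩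
        exact ⟨h1, h3, h2⟩
      · rintro ⟨h1, h2, h3⟩
        exact ⟨h1, ⟨(cs i).proj_par _ h1.1, h3⟩, h2⟩
    · ext q
      constructor
      · rintro ⟨h1, h2, ⟨_, h3⟩⟩
        exact ⟨h1, h2, h3⟩
      · rintro ⟨h1, h2, h3⟩
        exact ⟨h1, h2, c.proj_par _ h1.1, h3⟩
  simp_rw [key]
  rw [← measure_iUnion]
  · rw [fibreMeasure_apply μ _ _ (MeasurableSet.iUnion fun i => hA.inter (hm' i)),
      fibreMeasure_apply μ _ _ hA]
    congr 2
    ext q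
    constructor
    · rintro ⟨h1, h2⟩
      rw [mem_iUnion] at h2
      exact ⟨h1, h2.choose_spec.1⟩
    · rintro ⟨h1, h2⟩
      refine ⟨h1, ?_⟩
      have h3 : Γ.mul (Γ.inv g) (c.par (Γ.tgt g, q)) ∈ ⋃ i, disjointed (fun i => (cs i).dom) i := by
        rw [iUnion_disjointed, hcs]
        trivial
      rw [mem_iUnion] at h3 ⊢
      obtain ⟨i, hi⟩ := h3
      exact ⟨i, h2, c.proj_par _ h1.1, hi⟩
  · intro i j hij
    refine Set.disjoint_left.2 fun k hk hk' => ?_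
    exact Set.disjoint_left.1 (disjoint_disjointed _ hij) hk.2.2 hk'.2.2
  · exact fun i => hA.inter (hm' i)

theorem haar_tgt_ne [SFinite μ] (cs : ℕ → FibreChart Γ.tgt F) (y : B) :
    ∀ᵐ h ∂(Γ.haar c₀ μ cs y), Γ.tgt h = y := by
  have hc : IsClosed {h | Γ.tgt h = y} := isClosed_eq Γ.smooth_tgt.continuous continuous_const
  rw [ae_iff]
  change Γ.haar c₀ μ cs y {h | Γ.tgt h = y}ᶜ = 0
  rw [haar, Measure.sum_apply _ hc.measurableSet.compl, ENNReal.tsum_eq_zero]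
  intro i
  refine le_antisymm ((Measure.restrict_apply_le _ _).trans ?_) zero_le
  change Γ.fibreMeasure c₀ μ (cs i) y {h | Γ.tgt h = y}ᶜ ≤ 0
  rw [fibreMeasure_apply μ _ _ hc.measurableSet.compl]
  have : {q | q ∈ Γ.slice c₀ (cs i) y ∧ (cs i).par (y, q) ∈ {h | Γ.tgt h = y}ᶜ} = ∅ :=
    eq_empty_of_forall_notMem fun q hq => hq.2 ((cs i).proj_par _ hq.1.1)
  rw [this, Measure.restrict_empty, lintegral_zero_measure]

theorem haar_apply [μ.IsAddHaarMeasure] [FiniteDimensional ℝ F] {cs : ℕ → FibreChart Γ.tgt F}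
    (hcs : ⋃ i, (cs i).dom = univ) (c : FibreChart Γ.tgt F) (y : B) {A : Set T}
    (hA : MeasurableSet A) (hA' : A ⊆ c.dom) :
    Γ.haar c₀ μ cs y A = Γ.fibreMeasure c₀ μ c y A := by
  have h := haar_transl (c₀ := c₀) (μ := μ) hcs c (Γ.unit y) hA hA'
  rw [Γ.src_unit, Γ.tgt_unit] at h
  rw [← h]
  refine measure_congr ?_
  filter_upwards [haar_tgt_ne (c₀ := c₀) (μ := μ) cs y] with k hk
  have : Γ.mul (Γ.unit y) k = k := by rw [← hk, Γ.unit_mul]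
  refine propext ⟨fun h => ⟨hk, ?_⟩, fun h => ?_⟩
  · rw [this]; exact h
  · have h' := h.2
    rwa [this] at h'

theorem haar_restrict [μ.IsAddHaarMeasure] [FiniteDimensional ℝ F] {cs : ℕ → FibreChart Γ.tgt F}
    (hcs : ⋃ i, (cs i).dom = univ) (c : FibreChart Γ.tgt F) (y : B) :
    (Γ.haar c₀ μ cs y).restrict c.dom = Γ.fibreMeasure c₀ μ c y := by
  ext A hA
  rw [Measure.restrict_apply hA, haar_apply hcs c y (hA.inter c.isOpen_dom.measurableSet)
    inter_subset_right, fibreMeasure_apply μ _ _ hA,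
    fibreMeasure_apply μ _ _ (hA.inter c.isOpen_dom.measurableSet)]
  congr 2
  ext q
  exact ⟨fun h => ⟨h.1, h.2.1⟩, fun h => ⟨h.1, h.2, c.mem_dom _ h.1.1⟩⟩

theorem aemeasurable_mul [SFinite μ] (cs : ℕ → FibreChart Γ.tgt F) (g : T) :
    AEMeasurable (Γ.mul g) (Γ.haar c₀ μ cs (Γ.src g)) := by
  have hc : IsClosed {h | Γ.tgt h = Γ.src g} := isClosed_eq Γ.smooth_tgt.continuous continuous_const
  rw [← Measure.restrict_eq_self_of_ae_mem (s := {h | Γ.tgt h = Γ.src g}) (haar_tgt_ne cs (Γ.src g))]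
  have h1 : ContinuousOn (fun h => (g, h)) {h | Γ.tgt h = Γ.src g} := by fun_prop
  exact ContinuousOn.aemeasurable
    (Γ.smooth_mul.continuousOn.comp h1 fun h hh => hh.symm) hc.measurableSet

theorem map_mul_haar [μ.IsAddHaarMeasure] [FiniteDimensional ℝ F] {cs : ℕ → FibreChart Γ.tgt F}
    (hcs : ⋃ i, (cs i).dom = univ) (g : T) :
    (Γ.haar c₀ μ cs (Γ.src g)).map (Γ.mul g) = Γ.haar c₀ μ cs (Γ.tgt g) := by
  rw [Measure.ext_iff_of_iUnion_eq_univ hcs]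
  intro i
  rw [haar_restrict hcs]
  ext A hA
  have hA' := hA.inter (cs i).isOpen_dom.measurableSet
  rw [Measure.restrict_apply hA, Measure.map_apply_of_aemeasurable (aemeasurable_mul cs g) hA']
  have h := haar_transl (c₀ := c₀) (μ := μ) hcs (cs i) g hA' inter_subset_right
  rw [← haar_restrict hcs, Measure.restrict_apply hA,
    haar_apply hcs (cs i) _ hA' inter_subset_right, ← h]
  refine measure_congr ?_
  filter_upwards [haar_tgt_ne (c₀ := c₀) (μ := μ) cs (Γ.src g)] with k hk
  exact propext ⟨fun h => ⟨hk, h⟩, fun h => h.2⟩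

end LieGroupoid

theorem contDiffAt_integral_of_compact_support {P F : Type*} [NormedAddCommGroup P]
    [NormedSpace ℝ P] [NormedAddCommGroup F] [NormedSpace ℝ F] [FiniteDimensional ℝ F]
    [MeasurableSpace F] [BorelSpace F] (μ : Measure F) [μ.IsAddHaarMeasure] {Φ : P → F → ℝ}
    {U : Set P} {K : Set F} {p : P} (hU : IsOpen U) (hp : p ∈ U) (hK : IsCompact K)
    (h0 : ∀ p ∈ U, ∀ q ∉ K, Φ p q = 0)
    (hΦ : ∀ p ∈ U, ∀ q, ContDiffAt ℝ ∞ (fun x : P × F => Φ x.1 x.2) (p, q)) :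
    ContDiffAt ℝ ∞ (fun p => ∫ q, Φ p q ∂μ) p := by
  have h := contDiffOn_convolution_right_with_param (n := ⊤) (μ := μ) (f := fun _ : F => (1 : ℝ))
    (ContinuousLinearMap.mul ℝ ℝ) (g := fun p q => Φ p (-q)) (s := U) (k := -K) hU hK.neg
    (fun p q hp hq => h0 p hp (-q) (by simpa using hq)) (locallyIntegrable_const 1) ?_
  · have h2 : ContDiffAt ℝ ∞ _ (p, (0 : F)) :=
      h.contDiffAt ((hU.prod isOpen_univ).mem_nhds ⟨hp, trivial⟩)
    have h3 : ContDiffAt ℝ ∞ (fun p : P => (p, (0 : F))) p := by fun_prop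
    have h4 := ContDiffAt.comp p h2 h3
    convert h4 using 1
    funext p
    simp [convolution]
  · rintro ⟨p, q⟩ ⟨hp, -⟩
    have h1 : ContDiffAt ℝ ∞ (fun x : P × F => (x.1, -x.2)) (p, q) := by fun_prop
    exact (ContDiffAt.comp (p, q) (hΦ p hp (-q)) h1).contDiffWithinAt

namespace LieGroupoid
variable {T B : SmoothManifold.{u}} {Γ : LieGroupoid T B} {F : Type} [NormedAddCommGroup F]
  [NormedSpace ℝ F] [FiniteDimensional ℝ F] {c₀ : FibreChart Γ.tgt F}

section chart
variable (c₀) in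
/-- The integrand, in a chart, of the integral of a function over a fibre. -/
noncomputable def chartIntegrand (c : FibreChart Γ.tgt F) (y : B) (g : T → ℝ) : F → ℝ :=
  (Γ.slice c₀ c y).indicator fun q => Γ.density c₀ c (y, q) * g (c.par (y, q))

variable {P : Type*} [NormedAddCommGroup P] [NormedSpace ℝ P] {b : P → B} {p₀ : P} {K : Set B}
  {G : P → T → ℝ}

theorem contDiffAt_chartIntegrand (c : FibreChart Γ.tgt F) {ψ : T → ℝ}
    (hψ : ContMDiff T.I 𝓘(ℝ, ℝ) ∞ ψ) (hψc : tsupport ψ ⊆ c.dom) {U : Set P} (hU : IsOpen U)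
    {C : Set T} (hC : IsCompact C) (hKb : K ⊆ Γ.base c₀) (hCK : ∀ h ∈ C, Γ.src h ∈ K)
    (hUC : ∀ p ∈ U, ∀ h, Γ.tgt h = b p → Γ.src h ∈ K → h ∈ C)
    (hb : ∀ p ∈ U, ContMDiffAt 𝓘(ℝ, P) B.I ∞ b p)
    (hsupp : ∀ p h, Γ.src h ∉ K → G p h = 0)
    (hG : ∀ p ∈ U, ∀ q : F, ∀ η : P × F → T, ContMDiffAt 𝓘(ℝ, P × F) T.I ∞ η (p, q) →
      (∀ᶠ x in 𝓝 (p, q), Γ.tgt (η x) = b x.1) → Γ.src (η (p, q)) ∈ K →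
      ContDiffAt ℝ ∞ (fun x : P × F => G x.1 (η x)) (p, q)) :
    (∀ p ∈ U, ∀ q, ContDiffAt ℝ ∞
      (fun x : P × F => Γ.chartIntegrand c₀ c (b x.1) (fun h => ψ h * G x.1 h) x.2) (p, q)) ∧
    ∃ k : Set F, IsCompact k ∧ ∀ p ∈ U, ∀ q ∉ k,
      Γ.chartIntegrand c₀ c (b p) (fun h => ψ h * G p h) q = 0 := by
  have hCψ : IsCompact (tsupport ψ ∩ C) := hC.inter_left (isClosed_tsupport ψ)
  have hcc : ContinuousOn (fun h => (Γ.tgt h, c.coord h)) (tsupport ψ ∩ C) :=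
    Γ.smooth_tgt.continuous.continuousOn.prodMk
      (c.smooth_coord.continuousOn.mono fun h hh => hψc hh.1)
  set Z := (fun h => (Γ.tgt h, c.coord h)) '' (tsupport ψ ∩ C) with hZ
  have hZc : IsCompact Z := hCψ.image_of_continuousOn hcc
  have hz : ∀ p ∈ U, ∀ q, (b p, q) ∉ Z →
      Γ.chartIntegrand c₀ c (b p) (fun h => ψ h * G p h) q = 0 := by
    intro p hp q hq
    by_contra hne
    have hs : q ∈ Γ.slice c₀ c (b p) := by
      by_contra hs
      exact hne (indicator_of_notMem hs _)
    rw [chartIntegrand, indicator_of_mem hs] at hne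
    have h1 := right_ne_zero_of_mul (right_ne_zero_of_mul hne)
    have h2 := left_ne_zero_of_mul (right_ne_zero_of_mul hne)
    have h3 : Γ.src (c.par (b p, q)) ∈ K := by
      by_contra h3
      exact h1 (hsupp _ _ h3)
    refine hq ⟨c.par (b p, q), ⟨subset_tsupport _ h2, hUC p hp _ (c.proj_par _ hs.1) h3⟩, ?_⟩
    change (Γ.tgt (c.par (b p, q)), c.coord (c.par (b p, q))) = _
    rw [c.proj_par _ hs.1, c.coord_par _ hs.1]
  refine ⟨fun p hp q => ?_, Prod.snd '' Z, hZc.image continuous_snd, fun p hp q hq =>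
    hz p hp q fun h => hq ⟨_, h, rfl⟩⟩
  have hb' : ContMDiffAt 𝓘(ℝ, P × F) (B.I.prod 𝓘(ℝ, F)) ∞ (fun x : P × F => (b x.1, x.2)) (p, q) :=
    (ContMDiffAt.comp (g := b) (p, q) (hb p hp) contDiff_fst.contMDiff.contMDiffAt).prodMk
      contDiff_snd.contMDiff.contMDiffAt
  have hUx : ∀ᶠ x : P × F in 𝓝 (p, q), x.1 ∈ U :=
    continuousAt_fst.preimage_mem_nhds (hU.mem_nhds hp)
  by_cases hpq : (b p, q) ∈ Z
  · obtain ⟨h, ⟨hh1, hh2⟩, hh3⟩ := hpq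
    have hcod : (b p, q) ∈ c.cod := hh3 ▸ c.mem_cod h (hψc hh1)
    have hpar : c.par (b p, q) = h := by rw [← hh3]; exact c.par_coord h (hψc hh1)
    have hη : ContMDiffAt 𝓘(ℝ, P × F) T.I ∞ (fun x : P × F => c.par (b x.1, x.2)) (p, q) :=
      ContMDiffAt.comp (p, q) (c.contMDiffAt_par hcod) hb'
    have hbase : Γ.src (c.par (b p, q)) ∈ Γ.base c₀ := by rw [hpar]; exact hKb (hCK h hh2)
    have h1 := hG p hp q (fun x => c.par (b x.1, x.2)) hη (by
      filter_upwards [hb'.continuousAt.preimage_mem_nhds (c.isOpen_cod.mem_nhds hcod)] with x hx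
      exact c.proj_par _ hx) (by rw [hpar]; exact hCK h hh2)
    have h2 := contDiffAt_density (c₀ := c₀) (hb p hp) hcod hbase
    have h3 : ContDiffAt ℝ ∞ (fun x : P × F => ψ (c.par (b x.1, x.2))) (p, q) :=
      ((hψ _).comp (p, q) hη).contDiffAt
    refine (h2.mul (h3.mul h1)).congr_of_eventuallyEq ?_
    filter_upwards [hb'.continuousAt.preimage_mem_nhds (c.isOpen_cod.mem_nhds hcod),
      (Γ.smooth_src.continuous.continuousAt.comp hη.continuousAt).preimage_mem_nhds
        ((Γ.isOpen_base c₀).mem_nhds hbase)] with x hx hx'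
    exact indicator_of_mem (s := Γ.slice c₀ c (b x.1)) ⟨hx, hx'⟩ _
  · refine (contDiffAt_const (c := (0 : ℝ))).congr_of_eventuallyEq ?_
    filter_upwards [hb'.continuousAt.preimage_mem_nhds (hZc.isClosed.isOpen_compl.mem_nhds hpq),
      hUx] with x hx hx'
    exact hz x.1 hx' x.2 hx

end chart

variable [MeasurableSpace T] [BorelSpace T] [MeasurableSpace F] [BorelSpace F]
  {μ : Measure F} [μ.IsAddHaarMeasure] {cs : ℕ → FibreChart Γ.tgt F}

theorem aestronglyMeasurable_haar {y : B} {g : T → ℝ} (hg : ContinuousOn g {h | Γ.tgt h = y}) :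
    AEStronglyMeasurable g (Γ.haar c₀ μ cs y) := by
  have hc : IsClosed {h | Γ.tgt h = y} := isClosed_eq Γ.smooth_tgt.continuous continuous_const
  rw [← Measure.restrict_eq_self_of_ae_mem (s := {h | Γ.tgt h = y}) (haar_tgt_ne cs y)]
  exact hg.aestronglyMeasurable hc.measurableSet

theorem integral_haar_of_chart (hcs : ⋃ i, (cs i).dom = univ) (c : FibreChart Γ.tgt F) {y : B}
    {g : T → ℝ} (hg : ContinuousOn g {h | Γ.tgt h = y}) (hgc : ∀ h ∉ c.dom, g h = 0) :
    (Integrable (Γ.chartIntegrand c₀ c y g) μ → Integrable g (Γ.haar c₀ μ cs y)) ∧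
      ∫ h, g h ∂(Γ.haar c₀ μ cs y) = ∫ q, Γ.chartIntegrand c₀ c y g q ∂μ := by
  have hm : AEStronglyMeasurable g (Γ.fibreMeasure c₀ μ c y) := by
    rw [← haar_restrict hcs]
    exact (aestronglyMeasurable_haar hg).restrict
  have hsl := (isOpen_slice (c₀ := c₀) c y).measurableSet
  have hd : AEMeasurable (fun q => ENNReal.ofReal (Γ.density c₀ c (y, q)))
      (μ.restrict (Γ.slice c₀ c y)) :=
    ((continuousOn_density c y).aemeasurable hsl).ennreal_ofReal
  have hlt : ∀ᵐ q ∂(μ.restrict (Γ.slice c₀ c y)),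
      ENNReal.ofReal (Γ.density c₀ c (y, q)) < ⊤ := ae_of_all _ fun q => ENNReal.ofReal_lt_top
  have hpar : AEMeasurable (fun q => c.par (y, q)) ((μ.restrict (Γ.slice c₀ c y)).withDensity
      fun q => ENNReal.ofReal (Γ.density c₀ c (y, q))) :=
    (aemeasurable_par (c₀ := c₀) μ c y).mono_ac (withDensity_absolutelyContinuous _ _)
  have hreal : ∀ q, (ENNReal.ofReal (Γ.density c₀ c (y, q))).toReal = Γ.density c₀ c (y, q) :=
    fun q => ENNReal.toReal_ofReal (abs_nonneg _)
  constructor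
  · intro hi
    rw [← integrableOn_iff_integrable_of_support_subset (s := c.dom)
      (fun h hh => by_contra fun h' => hh (hgc h h')), IntegrableOn, haar_restrict hcs]
    unfold fibreMeasure at hm ⊢
    rw [integrable_map_measure hm hpar, integrable_withDensity_iff_integrable_smul₀' hd hlt]
    rw [chartIntegrand, integrable_indicator_iff hsl] at hi
    simpa only [hreal, smul_eq_mul, IntegrableOn, Function.comp_def] using hi
  · rw [← setIntegral_eq_integral_of_forall_compl_eq_zero hgc, haar_restrict hcs]
    unfold fibreMeasure at hm ⊢
    rw [integral_map hpar hm, integral_withDensity_eq_integral_toReal_smul₀ hd hlt,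
      chartIntegrand, integral_indicator hsl]
    simp only [hreal, smul_eq_mul]

section smooth
variable {P : Type*} [NormedAddCommGroup P] [NormedSpace ℝ P] {b : P → B} {p₀ : P} {K : Set B}
  {G : P → T → ℝ}

/-- Integrals of smooth functions over the fibres of the target map depend smoothly on
parameters. -/
theorem contDiffAt_integral_haar (hΓ : Γ.IsProper) (hcs : ⋃ i, (cs i).dom = univ)
    (hb : ∀ᶠ p in 𝓝 p₀, ContMDiffAt 𝓘(ℝ, P) B.I ∞ b p) (hK : IsCompact K)
    (hKb : K ⊆ Γ.base c₀) (hsupp : ∀ p h, Γ.src h ∉ K → G p h = 0)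
    (hG : ∀ᶠ p in 𝓝 p₀, ∀ q : F, ∀ η : P × F → T, ContMDiffAt 𝓘(ℝ, P × F) T.I ∞ η (p, q) →
      (∀ᶠ x in 𝓝 (p, q), Γ.tgt (η x) = b x.1) → Γ.src (η (p, q)) ∈ K →
      ContDiffAt ℝ ∞ (fun x : P × F => G x.1 (η x)) (p, q)) :
    Integrable (G p₀) (Γ.haar c₀ μ cs (b p₀)) ∧
      ContDiffAt ℝ ∞ (fun p => ∫ h, G p h ∂(Γ.haar c₀ μ cs (b p))) p₀ := by
  obtain ⟨s₀, hs₀, hs₀o, hs₀p⟩ := eventually_nhds_iff.1 (hb.and hG)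
  have hLC : LocallyCompactSpace B := Manifold.locallyCompact_of_finiteDimensional B.I
  obtain ⟨Kb, hKbc, hKbn⟩ := exists_compact_mem_nhds (b p₀)
  have hbp : ContMDiffAt 𝓘(ℝ, P) B.I ∞ b p₀ := (hs₀ p₀ hs₀p).1
  obtain ⟨s₁, hs₁, hs₁o, hs₁p⟩ := mem_nhds_iff.1 (hbp.continuousAt.preimage_mem_nhds hKbn)
  set U : Set P := s₀ ∩ s₁ with hUdef
  have hU : IsOpen U := hs₀o.inter hs₁o
  have hpU : p₀ ∈ U := ⟨hs₀p, hs₁p⟩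
  set C : Set T := (fun g : T => (Γ.tgt g, Γ.src g)) ⁻¹' (Kb ×ˢ K) with hCdef
  have hC : IsCompact C := IsProperMap.isCompact_preimage hΓ (hKbc.prod hK)
  have hUC : ∀ p ∈ U, ∀ h, Γ.tgt h = b p → Γ.src h ∈ K → h ∈ C := fun p hp h h1 h2 =>
    ⟨by change Γ.tgt h ∈ Kb; rw [h1]; exact hs₁ hp.2, h2⟩
  have hbU : ∀ p ∈ U, ContMDiffAt 𝓘(ℝ, P) B.I ∞ b p := fun p hp => (hs₀ p hp.1).1
  have hcont : ∀ p ∈ U, ContinuousOn (G p) {h | Γ.tgt h = b p} := by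
    intro p hp h hh
    by_cases hhK : Γ.src h ∈ K
    · obtain ⟨i, hi⟩ := mem_iUnion.1 (hcs ▸ mem_univ h)
      set c := cs i
      have hcod : (b p, c.coord h) ∈ c.cod := by
        have := c.mem_cod h hi
        rwa [show Γ.tgt h = b p from hh] at this
      have hpar : c.par (b p, c.coord h) = h := by
        have := c.par_coord h hi
        rwa [show Γ.tgt h = b p from hh] at this
      have hb' : ContMDiffAt 𝓘(ℝ, P × F) (B.I.prod 𝓘(ℝ, F)) ∞
          (fun x : P × F => (b x.1, x.2)) (p, c.coord h) :=
        (ContMDiffAt.comp (g := b) (p, c.coord h) (hbU p hp)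
          contDiff_fst.contMDiff.contMDiffAt).prodMk contDiff_snd.contMDiff.contMDiffAt
      have h1 := ((hs₀ p hp.1).2 (c.coord h) (fun x => c.par (b x.1, x.2))
        (ContMDiffAt.comp (p, c.coord h) (c.contMDiffAt_par hcod) hb') (by
          filter_upwards [hb'.continuousAt.preimage_mem_nhds (c.isOpen_cod.mem_nhds hcod)]
            with x hx
          exact c.proj_par _ hx) (by rw [hpar]; exact hhK)).continuousAt
      have h2 : ContinuousAt (fun h' => (p, c.coord h')) h :=
        continuousAt_const.prodMk (c.smooth_coord.continuousOn.continuousAt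
          (c.isOpen_dom.mem_nhds hi))
      have h3 := (ContinuousAt.comp (f := fun h' => (p, c.coord h')) h1 h2).continuousWithinAt
        (s := {h | Γ.tgt h = b p})
      refine h3.congr_of_eventuallyEq ?_ ?_
      · filter_upwards [self_mem_nhdsWithin,
          mem_nhdsWithin_of_mem_nhds (c.isOpen_dom.mem_nhds hi)] with h' hh' hd
        have := c.par_coord h' hd
        rw [show Γ.tgt h' = b p from hh'] at this
        simp only [Function.comp_apply, this]
      · simp only [Function.comp_apply, hpar]
    · refine (continuousAt_const (y := (0 : ℝ))).continuousWithinAt.congr_of_eventuallyEq ?_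
        (hsupp _ _ hhK)
      filter_upwards [mem_nhdsWithin_of_mem_nhds
        (Γ.smooth_src.continuous.continuousAt.preimage_mem_nhds
          (hK.isClosed.isOpen_compl.mem_nhds hhK))] with h' hh'
      exact hsupp _ _ hh'
  obtain ⟨t, ht⟩ := hC.elim_finite_subcover (fun i => (cs i).dom) (fun i => (cs i).isOpen_dom)
    (hcs ▸ subset_univ C)
  have hLT : LocallyCompactSpace T := Manifold.locallyCompact_of_finiteDimensional T.I
  obtain ⟨ψ, hψ⟩ := SmoothPartitionOfUnity.exists_isSubordinate (ι := t) T.I hC.isClosed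
    (fun i => (cs i.1).dom) (fun i => (cs i.1).isOpen_dom) (by
      intro h hh
      obtain ⟨i, hi, hi'⟩ := mem_iUnion₂.1 (ht hh)
      exact mem_iUnion.2 ⟨⟨i, hi⟩, hi'⟩)
  have hsum : ∀ p ∈ U, ∀ h, Γ.tgt h = b p → G p h = ∑ i, ψ i h * G p h := by
    intro p hp h hh
    rw [← Finset.sum_mul]
    by_cases hhK : Γ.src h ∈ K
    · have := ψ.sum_eq_one (hUC p hp h hh hhK)
      rw [finsum_eq_sum_of_fintype] at this
      rw [this, one_mul]
    · rw [hsupp _ _ hhK, mul_zero]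
  have hψG : ∀ i, ∀ p ∈ U, ContinuousOn (fun h => ψ i h * G p h) {h | Γ.tgt h = b p} :=
    fun i p hp => (ψ i).contMDiff.continuous.continuousOn.mul (hcont p hp)
  have hψ0 : ∀ i p, ∀ h ∉ (cs i.1).dom, ψ i h * G p h = 0 := fun i p h hh => by
    rw [image_eq_zero_of_notMem_tsupport (fun h' => hh (hψ i h')), zero_mul]
  have hkey : ∀ i, _ := fun i : t => contDiffAt_chartIntegrand (Γ := Γ) (c₀ := c₀) (cs i.1)
    (ψ i).contMDiff (hψ i) hU hC hKb (fun h hh => hh.2) hUC hbU hsupp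
    (fun p hp => (hs₀ p hp.1).2)
  have hint : ∀ i, ∀ p ∈ U, Integrable (fun h => ψ i h * G p h) (Γ.haar c₀ μ cs (b p)) := by
    intro i p hp
    refine (integral_haar_of_chart hcs _ (hψG i p hp) (hψ0 i p)).1 ?_
    obtain ⟨h1, k, hk, h2⟩ := hkey i
    refine Continuous.integrable_of_hasCompactSupport ?_ (HasCompactSupport.intro hk (h2 p hp))
    refine continuous_iff_continuousAt.2 fun q => ?_
    exact ContinuousAt.comp (f := fun q => (p, q)) (h1 p hp q).continuousAt (by fun_prop)
  have hae : ∀ p ∈ U, G p =ᵐ[Γ.haar c₀ μ cs (b p)] fun h => ∑ i, ψ i h * G p h := fun p hp => by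
    filter_upwards [haar_tgt_ne cs (b p)] with h hh
    exact hsum p hp h hh
  refine ⟨(integrable_congr (hae p₀ hpU)).2 (integrable_finsetSum _ fun i _ => hint i p₀ hpU), ?_⟩
  have hsm : ContDiffAt ℝ ∞ (fun p => ∑ i, ∫ q, Γ.chartIntegrand c₀ (cs i.1) (b p)
      (fun h => ψ i h * G p h) q ∂μ) p₀ := by
    refine ContDiffAt.sum fun i _ => ?_
    obtain ⟨h1, k, hk, h2⟩ := hkey i
    exact contDiffAt_integral_of_compact_support μ hU hpU hk h2 h1
  refine hsm.congr_of_eventuallyEq ?_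
  filter_upwards [hU.mem_nhds hpU] with p hp
  rw [integral_congr_ae (hae p hp), integral_finsetSum _ fun i _ => hint i p hp]
  exact Finset.sum_congr rfl fun i _ => (integral_haar_of_chart hcs _ (hψG i p hp) (hψ0 i p)).2

end smooth

end LieGroupoid

namespace LieGroupoid
variable {T B : SmoothManifold.{u}} (Γ : LieGroupoid T B) {F : Type} [NormedAddCommGroup F]
  [NormedSpace ℝ F]

/-- A one-form whose restriction to the fibres of the target map, over the set of arrows with source
in `K`, is the left translate of the differential of `f` along the units. -/
def IsLeftTranslate (f : T → ℝ) (K : Set B) (θ : OneForm T) : Prop :=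
  ∀ z, Γ.src z ∈ K → ∀ ζ : ℝ → T, ContMDiffAt 𝓘(ℝ, ℝ) T.I ∞ ζ 0 → ζ 0 = z →
    (∀ᶠ ε in 𝓝 0, Γ.tgt (ζ ε) = Γ.tgt z) →
      θ z (tder 𝓘(ℝ, ℝ) T.I ζ 0 1) = deriv (fun ε => f (Γ.mul (Γ.inv z) (ζ ε))) 0

/-- The quotient of an arrow by the arrow of the same target and prescribed fibre coordinate. -/
def chartQuotient (c : FibreChart Γ.tgt F) (q : F) (z : T) : T :=
  Γ.mul (Γ.inv (c.par (Γ.tgt z, q))) z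

variable {Γ} in
theorem contMDiffAt_chartQuotient (c : FibreChart Γ.tgt F) {P : Type*} [NormedAddCommGroup P]
    [NormedSpace ℝ P] {κ : P → F} {ζ : P → T} {p : P} (hκ : ContMDiffAt 𝓘(ℝ, P) 𝓘(ℝ, F) ∞ κ p)
    (hζ : ContMDiffAt 𝓘(ℝ, P) T.I ∞ ζ p) (hm : (Γ.tgt (ζ p), κ p) ∈ c.cod) :
    ContMDiffAt 𝓘(ℝ, P) T.I ∞ (fun x => Γ.chartQuotient c (κ x) (ζ x)) p := by
  have h1 : ContMDiffAt 𝓘(ℝ, P) (B.I.prod 𝓘(ℝ, F)) ∞ (fun x => (Γ.tgt (ζ x), κ x)) p :=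
    ((Γ.smooth_tgt _).comp p hζ).prodMk hκ
  refine Γ.contMDiffAt_mul ((Γ.smooth_inv _).comp p ((c.contMDiffAt_par hm).comp p h1)) hζ ?_
  filter_upwards [h1.continuousAt.preimage_mem_nhds (c.isOpen_cod.mem_nhds hm)] with x hx
  rw [Γ.src_inv]
  exact c.proj_par _ hx

variable {Γ} in
theorem chartQuotient_coord (c : FibreChart Γ.tgt F) {z : T} (hz : z ∈ c.dom) :
    Γ.chartQuotient c (c.coord z) z = Γ.unit (Γ.src z) := by
  rw [chartQuotient, c.par_coord z hz, Γ.inv_mul]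

variable {Γ} in
theorem chartQuotient_coord_of_tgt_eq (c : FibreChart Γ.tgt F) {z w : T} (hz : z ∈ c.dom)
    (h : Γ.tgt w = Γ.tgt z) : Γ.chartQuotient c (c.coord z) w = Γ.mul (Γ.inv z) w := by
  rw [chartQuotient, h, c.par_coord z hz]

/-- The left translate of the differential of `f`, extended to all tangent vectors by means of
a chart. -/
noncomputable def chartForm (f : T → ℝ) (c : FibreChart Γ.tgt F) : OneForm T := fun z =>
  tder T.I 𝓘(ℝ, ℝ) (fun w => f (Γ.chartQuotient c (c.coord z) w)) z

variable {Γ} {f : T → ℝ} {N : Set B}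
  (hf : ∀ y ∈ N, ContMDiffAt T.I 𝓘(ℝ, ℝ) ∞ f (Γ.unit y))
include hf

theorem mdifferentiableAt_chartForm (c : FibreChart Γ.tgt F) {z : T} (hz : z ∈ c.dom)
    (hzN : Γ.src z ∈ N) :
    MDifferentiableAt T.I 𝓘(ℝ, ℝ) (fun w => f (Γ.chartQuotient c (c.coord z) w)) z := by
  have h1 : ContMDiffAt T.I (B.I.prod 𝓘(ℝ, F)) ∞ (fun w => (Γ.tgt w, c.coord z)) z :=
    (Γ.smooth_tgt _).prodMk contMDiffAt_const
  have hm := c.mem_cod z hz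
  have h2 : ContMDiffAt T.I T.I ∞ (fun w => Γ.chartQuotient c (c.coord z) w) z := by
    refine Γ.contMDiffAt_mul ((Γ.smooth_inv _).comp z
      (ContMDiffAt.comp (g := c.par) z (c.contMDiffAt_par hm) h1)) contMDiffAt_id ?_
    filter_upwards [h1.continuousAt.preimage_mem_nhds (c.isOpen_cod.mem_nhds hm)] with x hx
    rw [Γ.src_inv]
    exact c.proj_par _ hx
  have h3 := hf _ hzN
  rw [← chartQuotient_coord c hz] at h3
  exact (h3.comp z h2).mdifferentiableAt (by simp)

theorem smoothAt_chartForm (hN : IsOpen N) (c : FibreChart Γ.tgt F) {z : T} (hz : z ∈ c.dom)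
    (hzN : Γ.src z ∈ N) : (Γ.chartForm f c).SmoothAt z := by
  refine OneForm.smoothAt_of_pullback fun e => ?_
  set φ := extChartAt T.I z
  have hφ : φ.symm (φ z) = z := by simp [φ]
  have hsm : ∀ᶠ q in 𝓝 (φ z), ContMDiffAt 𝓘(ℝ, T.E) T.I ∞ φ.symm q :=
    (eventually_eventually_nhds.2 (extChartAt_target_mem_nhds (I := T.I) z)).mono fun q hq =>
      (contMDiffOn_extChartAt_symm z).contMDiffAt hq
  have hs0 := hsm.self_of_nhds
  have hdom : ∀ᶠ q in 𝓝 (φ z), φ.symm q ∈ c.dom ∧ Γ.src (φ.symm q) ∈ N := by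
    refine hs0.continuousAt.preimage_mem_nhds ((c.isOpen_dom.inter
      (hN.preimage Γ.smooth_src.continuous)).mem_nhds ?_)
    rw [hφ]
    exact ⟨hz, hzN⟩
  have hΦ : ContDiffAt ℝ ∞ (Function.uncurry fun q q' : T.E =>
      f (Γ.chartQuotient c (c.coord (φ.symm q)) (φ.symm q'))) (φ z, φ z) := by
    have h0 : ContMDiffAt 𝓘(ℝ, T.E) 𝓘(ℝ, F) ∞ (fun q => c.coord (φ.symm q)) (φ z) :=
      (c.contMDiffAt_coord (by rwa [hφ])).comp _ hs0
    have h1 : ContMDiffAt 𝓘(ℝ, T.E × T.E) 𝓘(ℝ, F) ∞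
        (fun x : T.E × T.E => c.coord (φ.symm x.1)) (φ z, φ z) :=
      ContMDiffAt.comp (g := fun q => c.coord (φ.symm q)) (φ z, φ z) h0
        contDiff_fst.contMDiff.contMDiffAt
    have h2 : ContMDiffAt 𝓘(ℝ, T.E × T.E) T.I ∞ (fun x : T.E × T.E => φ.symm x.2) (φ z, φ z) :=
      ContMDiffAt.comp (g := φ.symm) (φ z, φ z) hs0 contDiff_snd.contMDiff.contMDiffAt
    have h3 := contMDiffAt_chartQuotient c h1 h2 (by
      change (Γ.tgt (φ.symm (φ z)), c.coord (φ.symm (φ z))) ∈ c.cod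
      rw [hφ]; exact c.mem_cod z hz)
    have h4 := hf _ hzN
    rw [← chartQuotient_coord c hz] at h4
    refine (ContMDiffAt.comp (g := f) (φ z, φ z) ?_ h3).contDiffAt
    change ContMDiffAt _ _ _ f (Γ.chartQuotient c (c.coord (φ.symm (φ z))) (φ.symm (φ z)))
    rwa [hφ]
  have h5 := (ContDiffAt.fderiv hΦ contDiffAt_id (m := ∞) (by simp)).clm_apply
    (contDiffAt_const (c := e))
  refine h5.congr_of_eventuallyEq ?_
  filter_upwards [hsm, hdom] with q h6 h7
  have h8 := tder_comp (mdifferentiableAt_chartForm hf c h7.1 h7.2)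
    (h6.mdifferentiableAt (by simp))
  rw [tder_eq_fderiv] at h8
  exact (congrArg (fun g => g e) h8).symm

theorem chartForm_tder (c : FibreChart Γ.tgt F) {z : T} (hz : z ∈ c.dom)
    (hzN : Γ.src z ∈ N) {ζ : ℝ → T} (hζ : ContMDiffAt 𝓘(ℝ, ℝ) T.I ∞ ζ 0) (h0 : ζ 0 = z)
    (ht : ∀ᶠ ε in 𝓝 0, Γ.tgt (ζ ε) = Γ.tgt z) :
    Γ.chartForm f c z (tder 𝓘(ℝ, ℝ) T.I ζ 0 1) = deriv (fun ε => f (Γ.mul (Γ.inv z) (ζ ε))) 0 := by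
  have h1 := mdifferentiableAt_chartForm hf c hz hzN
  subst h0
  have h2 := tder_comp h1 (hζ.mdifferentiableAt (by simp))
  rw [tder_eq_fderiv] at h2
  have h3 : (fun ε => f (Γ.mul (Γ.inv (ζ 0)) (ζ ε))) =ᶠ[𝓝 0]
      fun ε => f (Γ.chartQuotient c (c.coord (ζ 0)) (ζ ε)) := by
    filter_upwards [ht] with ε hε
    rw [chartQuotient_coord_of_tgt_eq c hz hε]
  rw [h3.deriv_eq, ← fderiv_apply_one_eq_deriv, h2]
  rfl

theorem exists_isLeftTranslate (hN : IsOpen N) {K : Set B} (hK : IsClosed K) (hKN : K ⊆ N)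
    (hch : ∀ z : T, ∃ c : FibreChart Γ.tgt F, z ∈ c.dom) :
    ∃ θ : OneForm T, (∀ z, θ.SmoothAt z) ∧ Γ.IsLeftTranslate f K θ := by
  have hLT : LocallyCompactSpace T := Manifold.locallyCompact_of_finiteDimensional T.I
  obtain ⟨θ, hθ⟩ := exists_contMDiffSection_forall_mem_convex_of_local (n := ⊤) T.I
    (F_fiber := T.E →L[ℝ] ℝ)
    (fun x : T => TangentSpace T.I x →L[ℝ] ℝ)
    (fun z => {α : T.E →L[ℝ] ℝ | Γ.src z ∈ K → ∀ ζ : ℝ → T, ContMDiffAt 𝓘(ℝ, ℝ) T.I ∞ ζ 0 →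
      ζ 0 = z → (∀ᶠ ε in 𝓝 0, Γ.tgt (ζ ε) = Γ.tgt z) →
      α (tder 𝓘(ℝ, ℝ) T.I ζ 0 1) = deriv (fun ε => f (Γ.mul (Γ.inv z) (ζ ε))) 0})
    (fun z => by
      intro α hα β hβ a b _ _ hab h1 ζ h2 h3 h4
      have e1 := hα h1 ζ h2 h3 h4
      have e2 := hβ h1 ζ h2 h3 h4
      refine (congrArg₂ (fun r s => a * r + b * s) e1 e2).trans ?_
      rw [← add_mul, hab, one_mul])
    (fun z => by
      by_cases hz : Γ.src z ∈ N
      · obtain ⟨c, hc⟩ := hch z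
        refine ⟨c.dom ∩ Γ.src ⁻¹' N, (c.isOpen_dom.inter
          (hN.preimage Γ.smooth_src.continuous)).mem_nhds ⟨hc, hz⟩, Γ.chartForm f c, ?_, ?_⟩
        · intro y hy
          exact (smoothAt_chartForm hf hN c hy.1 hy.2).contMDiffWithinAt
        · intro y hy _ ζ h2 h3 h4
          exact chartForm_tder hf c hy.1 hy.2 h2 h3 h4
      · refine ⟨Γ.src ⁻¹' Kᶜ, (hK.isOpen_compl.preimage Γ.smooth_src.continuous).mem_nhds
          fun h => hz (hKN h), fun _ => 0, ?_, fun y hy h => (hy h).elim⟩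
        exact (Bundle.contMDiff_zeroSection ℝ _).contMDiffOn)
  exact ⟨θ, fun z => θ.contMDiff z, fun z => hθ z⟩

end LieGroupoid

namespace SmoothManifold
variable {M : SmoothManifold.{u}} (x : M)

theorem extChartAt_symm_apply_self : (extChartAt M.I x).symm (extChartAt M.I x x) = x :=
  (extChartAt M.I x).left_inv (mem_extChartAt_source x)

theorem eventually_contMDiffAt_extChartAt_symm : ∀ᶠ q in 𝓝 (extChartAt M.I x x),
    ContMDiffAt 𝓘(ℝ, M.E) M.I ∞ (extChartAt M.I x).symm q :=
  (eventually_eventually_nhds.2 (extChartAt_target_mem_nhds (I := M.I) x)).mono fun _ hq =>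
    (contMDiffOn_extChartAt_symm x).contMDiffAt hq

theorem tder_extChartAt_symm_surjective :
    Function.Surjective (tder 𝓘(ℝ, M.E) M.I (extChartAt M.I x).symm (extChartAt M.I x x)) := by
  intro v
  have hψ := (eventually_contMDiffAt_extChartAt_symm x).self_of_nhds
  have hφ : ContMDiffAt M.I 𝓘(ℝ, M.E) ∞ (extChartAt M.I x) x := contMDiffAt_extChartAt
  have h4 := tder_comp (hψ.mdifferentiableAt (by simp)) (hφ.mdifferentiableAt (by simp))
  have h5 : (fun y => (extChartAt M.I x).symm (extChartAt M.I x y)) =ᶠ[𝓝 x] fun y => y := by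
    filter_upwards [extChartAt_source_mem_nhds (I := M.I) x] with y hy
      using (extChartAt M.I x).left_inv hy
  rw [h5.tder_eq, tder_id] at h4
  exact ⟨_, (congrArg (fun f => f v) h4).symm⟩

theorem contMDiff_of_contDiffAt {f : M → ℝ} (h : ∀ x, ContDiffAt ℝ ∞
    (fun q => f ((extChartAt M.I x).symm q)) (extChartAt M.I x x)) : ContMDiff M.I 𝓘(ℝ, ℝ) ∞ f := by
  intro x
  have h1 := (h x).contMDiffAt.comp x (contMDiffAt_extChartAt (I := M.I) (n := ∞))
  refine h1.congr_of_eventuallyEq ?_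
  filter_upwards [extChartAt_source_mem_nhds (I := M.I) x] with y hy
  exact congrArg f ((extChartAt M.I x).left_inv hy).symm

end SmoothManifold

namespace LieGroupoid
variable {T B : SmoothManifold.{u}} {Γ : LieGroupoid T B} {F : Type} [NormedAddCommGroup F]
  [NormedSpace ℝ F] [FiniteDimensional ℝ F] {c₀ : FibreChart Γ.tgt F}
  [MeasurableSpace T] [BorelSpace T] [MeasurableSpace F] [BorelSpace F]
  {μ : Measure F} [μ.IsAddHaarMeasure] {cs : ℕ → FibreChart Γ.tgt F} {φ : B → ℝ} {K : Set B}

variable (c₀ μ cs φ) in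
/-- The total weight, over a fibre of the target map, of a function pulled back along the source
map. -/
noncomputable def weight (y : B) : ℝ := ∫ h, φ (Γ.src h) ∂(Γ.haar c₀ μ cs y)

theorem integral_haar_mul (hcs : ⋃ i, (cs i).dom = univ) (g : T) {k : T → ℝ}
    (hk : Integrable k (Γ.haar c₀ μ cs (Γ.tgt g))) :
    Integrable (fun h => k (Γ.mul g h)) (Γ.haar c₀ μ cs (Γ.src g)) ∧
      ∫ h, k (Γ.mul g h) ∂(Γ.haar c₀ μ cs (Γ.src g)) = ∫ h, k h ∂(Γ.haar c₀ μ cs (Γ.tgt g)) := by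
  rw [← map_mul_haar hcs g] at hk ⊢
  have hm := aemeasurable_mul (c₀ := c₀) (μ := μ) cs g
  exact ⟨(integrable_map_measure hk.1 hm).1 hk, (integral_map hm hk.1).symm⟩

variable (hΓ : Γ.IsProper) (hcs : ⋃ i, (cs i).dom = univ) (hφ : ContMDiff B.I 𝓘(ℝ, ℝ) ∞ φ)
  (hK : IsCompact K) (hKb : K ⊆ Γ.base c₀) (hφK : ∀ y ∉ K, φ y = 0)
include hΓ hcs hφ hK hKb hφK

theorem weight_aux (y : B) :
    Integrable (fun h => φ (Γ.src h)) (Γ.haar c₀ μ cs y) ∧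
      ContDiffAt ℝ ∞ (fun q => Γ.weight c₀ μ cs φ ((extChartAt B.I y).symm q))
        (extChartAt B.I y y) := by
  have h := contDiffAt_integral_haar (Γ := Γ) (c₀ := c₀) (μ := μ) (p₀ := extChartAt B.I y y)
    (b := (extChartAt B.I y).symm) (G := fun _ h => φ (Γ.src h)) hΓ hcs
    (SmoothManifold.eventually_contMDiffAt_extChartAt_symm y) hK hKb (fun _ h hh => hφK _ hh)
    (.of_forall fun p q η hη _ _ =>
      (((hφ _).comp _ (Γ.smooth_src _)).comp (p, q) hη).contDiffAt)
  rw [SmoothManifold.extChartAt_symm_apply_self] at h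
  exact h

theorem integrable_weight (y : B) : Integrable (fun h => φ (Γ.src h)) (Γ.haar c₀ μ cs y) :=
  (weight_aux hΓ hcs hφ hK hKb hφK y).1

theorem contMDiff_weight : ContMDiff B.I 𝓘(ℝ, ℝ) ∞ (Γ.weight c₀ μ cs φ) :=
  SmoothManifold.contMDiff_of_contDiffAt fun y => (weight_aux hΓ hcs hφ hK hKb hφK y).2

theorem weight_src (g : T) :
    Γ.weight c₀ μ cs φ (Γ.src g) = Γ.weight c₀ μ cs φ (Γ.tgt g) := by
  have h := (integral_haar_mul hcs g
    (integrable_weight (μ := μ) (cs := cs) hΓ hcs hφ hK hKb hφK (Γ.tgt g))).2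
  rw [weight, weight, ← h]
  refine integral_congr_ae ?_
  filter_upwards [haar_tgt_ne cs (Γ.src g)] with k hk
  rw [Γ.src_mul _ _ hk.symm]

theorem weight_pos (hφ0 : ∀ y, 0 ≤ φ y) {y : B} (hy : 0 < φ y) : 0 < Γ.weight c₀ μ cs φ y := by
  have hyK : y ∈ K := by_contra fun h => hy.ne' (hφK y h)
  rw [weight, integral_pos_iff_support_of_nonneg (fun h => hφ0 _)
    (integrable_weight hΓ hcs hφ hK hKb hφK y)]
  have hcont : Continuous fun h => φ (Γ.src h) :=
    hφ.continuous.comp Γ.smooth_src.continuous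
  set S := Function.support (fun h => φ (Γ.src h)) with hS
  have hSo : IsOpen S := hcont.isOpen_support
  refine lt_of_lt_of_le ?_ (measure_mono (inter_subset_left (t := c₀.dom)))
  rw [haar_apply hcs c₀ y (hSo.inter c₀.isOpen_dom).measurableSet inter_subset_right,
    fibreMeasure_apply _ _ _ (hSo.inter c₀.isOpen_dom).measurableSet]
  set V := {q | q ∈ Γ.slice c₀ c₀ y ∧ c₀.par (y, q) ∈ S ∩ c₀.dom} with hV
  have hVo : IsOpen V := ((continuousOn_par_slice c₀ y).mono fun q hq => hq.1).isOpen_inter_preimage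
    (isOpen_slice c₀ y) (hSo.inter c₀.isOpen_dom)
  have hu : Γ.unit y ∈ c₀.dom := hKb hyK
  have hpar := c₀.par_coord _ hu
  have hcod := c₀.mem_cod _ hu
  rw [Γ.tgt_unit] at hpar hcod
  have hne : V.Nonempty := by
    refine ⟨c₀.coord (Γ.unit y), ⟨hcod, ?_⟩, ?_⟩
    · rw [hpar, Γ.src_unit]
      exact hKb hyK
    · rw [hpar]
      refine ⟨?_, hu⟩
      rw [hS, Function.mem_support, Γ.src_unit]
      exact hy.ne'
  rw [pos_iff_ne_zero, Ne, lintegral_eq_zero_iff'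
    (((continuousOn_density c₀ y).mono fun q hq => hq.1).aemeasurable
      hVo.measurableSet).ennreal_ofReal]
  intro h
  have h2 : ∀ᵐ q ∂(μ.restrict V), False := by
    filter_upwards [h, ae_restrict_mem hVo.measurableSet] with q hq hqV
    have := density_pos (c₀ := c₀) hqV.1.1 hqV.1.2
    have h3 := ENNReal.ofReal_eq_zero.1 hq
    linarith
  rw [ae_iff] at h2
  simp only [not_false_eq_true, Set.ofPred_true, Measure.restrict_apply_univ] at h2
  exact hVo.measure_ne_zero μ hne h2

end LieGroupoid

namespace LieGroupoid
variable {T B : SmoothManifold.{u}} (Γ : LieGroupoid T B) {F : Type} [NormedAddCommGroup F]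
  [NormedSpace ℝ F] {f : T → ℝ} {K : Set B} {θ : OneForm T}

/-- A one-form is multiplicative if its simplicial differential vanishes. -/
def IsMultiplicative (θ : OneForm T) : Prop :=
  ∀ x y, Γ.src x = Γ.tgt y → ∀ v w, tder T.I B.I Γ.src x v = tder T.I B.I Γ.tgt y w →
    θ (Γ.mul x y) (Γ.dmul x y (v, w)) = θ x v + θ y w

variable {Γ} in
theorem tder_tgt_surjective {c : FibreChart Γ.tgt F} {z : T} (hz : z ∈ c.dom) :
    Function.Surjective (tder T.I B.I Γ.tgt z) := by
  intro b
  have h := c.tder_proj_par Γ.smooth_tgt (c.mem_cod z hz) (b, 0)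
  rw [c.par_coord z hz] at h
  exact ⟨_, h⟩

theorem exists_tgt_lift (h : T) : ∃ R : B.E →L[ℝ] T.E, ∀ b, tder T.I B.I Γ.tgt h (R b) = b := by
  obtain ⟨F, _, _, _, hF⟩ := Γ.exists_fibreChart
  obtain ⟨c, hc⟩ := hF h
  obtain ⟨R, hR⟩ := ((tder T.I B.I Γ.tgt h).toLinearMap).exists_rightInverse_of_surjective
    (LinearMap.range_eq_top.2 (tder_tgt_surjective hc))
  exact ⟨LinearMap.toContinuousLinearMap R, fun b => congrArg (fun g => g b) hR⟩

/-- A right inverse of the derivative of the target map. -/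
noncomputable def tgtLift (h : T) : B.E →L[ℝ] T.E := (Γ.exists_tgt_lift h).choose

theorem tder_tgt_tgtLift (h : T) (b : B.E) : tder T.I B.I Γ.tgt h (Γ.tgtLift h b) = b :=
  (Γ.exists_tgt_lift h).choose_spec b

variable {Γ} in
/-- A pair of composable curves with prescribed velocities, the first of which is given. -/
theorem exists_composable_curve {ζ : ℝ → T} (hζ : ContMDiffAt 𝓘(ℝ, ℝ) T.I ∞ ζ 0) {y : T}
    (hy : Γ.src (ζ 0) = Γ.tgt y) {w : T.E}
    (hw : tder T.I B.I Γ.src (ζ 0) (tder 𝓘(ℝ, ℝ) T.I ζ 0 1) = tder T.I B.I Γ.tgt y w) :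
    ∃ η : ℝ → T, ContMDiffAt 𝓘(ℝ, ℝ) T.I ∞ η 0 ∧ η 0 = y ∧
      (∀ᶠ ε in 𝓝 0, Γ.src (ζ ε) = Γ.tgt (η ε)) ∧ tder 𝓘(ℝ, ℝ) T.I η 0 1 = w := by
  obtain ⟨F, _, _, _, hF⟩ := Γ.exists_fibreChart
  obtain ⟨c, hc⟩ := hF y
  obtain ⟨η, h1, h2, h3, h4⟩ := c.exists_curve Γ.smooth_tgt
    (b := fun ε => Γ.src (ζ ε)) ((Γ.smooth_src _).comp 0 hζ) hc hy.symm (w := w) (by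
      rw [tder_comp ((Γ.smooth_src _).mdifferentiableAt (by simp))
        (hζ.mdifferentiableAt (by simp))]
      exact hw.symm)
  exact ⟨η, h1, h2, h3.mono fun _ h => h.symm, h4⟩

variable {Γ} in
theorem IsLeftTranslate.dmul_eq (hL : Γ.IsLeftTranslate f K θ) {x h : T}
    (hxh : Γ.src x = Γ.tgt h) (hh : Γ.src h ∈ K) {k : T.E} (hk : tder T.I B.I Γ.tgt h k = 0) :
    θ (Γ.mul x h) (Γ.dmul x h (0, k)) = θ h k := by
  have hx0 : tder 𝓘(ℝ, ℝ) T.I (fun _ : ℝ => x) 0 = 0 := tder_const _ _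
  obtain ⟨ζ, h1, h2, h3, h4⟩ := exists_composable_curve (Γ := Γ) (ζ := fun _ => x)
    contMDiffAt_const (y := h) hxh (w := k) (by
      rw [hx0, hk, _root_.zero_apply, map_zero])
  have h5 := Γ.tder_mul (p := (0 : ℝ)) mdifferentiableAt_const (h1.mdifferentiableAt (by simp)) h3 1
  rw [hx0, h2, h4, _root_.zero_apply] at h5
  have e1 := hL h hh ζ h1 h2 (h3.mono fun ε hε => hε.symm.trans hxh)
  have e2 := hL (Γ.mul x h) (by rwa [Γ.src_mul _ _ hxh]) (fun ε => Γ.mul x (ζ ε))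
    (Γ.contMDiffAt_mul contMDiffAt_const h1 h3) (by rw [h2]) (h3.mono fun ε hε => by
      rw [Γ.tgt_mul _ _ hε, Γ.tgt_mul _ _ hxh])
  rw [← h5, ← h4, e1, e2]
  refine EventuallyEq.deriv_eq ?_
  filter_upwards [h3] with ε hε
  rw [Γ.inv_mul_mul hxh (hxh.symm.trans hε)]

/-- The variation of `θ` under left translation by arrows. -/
noncomputable def variation (θ : OneForm T) (x h : T) : T.E →L[ℝ] ℝ :=
  ((θ (Γ.mul x h)).comp ((Γ.dmul x h).comp ((ContinuousLinearMap.id ℝ T.E).prod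
    ((Γ.tgtLift h).comp (tder T.I B.I Γ.src x))))) -
  (θ h).comp ((Γ.tgtLift h).comp (tder T.I B.I Γ.src x))

section
variable {E H M : Type*} [NormedAddCommGroup E] [NormedSpace ℝ E] [TopologicalSpace H]
  {I : ModelWithCorners ℝ E H} [TopologicalSpace M] [ChartedSpace H M]
variable {Γ}

theorem IsLeftTranslate.variation_eq (hL : Γ.IsLeftTranslate f K θ) {x h : M → T} {p : M}
    (hx : MDifferentiableAt I T.I x p) (hh : MDifferentiableAt I T.I h p)
    (hxh : ∀ᶠ q in 𝓝 p, Γ.src (x q) = Γ.tgt (h q)) (hK : Γ.src (h p) ∈ K) (e : E) :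
    Γ.variation θ (x p) (h p) (tder I T.I x p e) =
      θ (Γ.mul (x p) (h p)) (tder I T.I (fun q => Γ.mul (x q) (h q)) p e) -
        θ (h p) (tder I T.I h p e) := by
  set v := tder I T.I x p e with hv
  set w := tder I T.I h p e with hw
  set b := Γ.tgtLift (h p) (tder T.I B.I Γ.src (x p) v) with hb
  have h1 : tder T.I B.I Γ.src (x p) v = tder T.I B.I Γ.tgt (h p) w := by
    have e1 := tder_comp ((Γ.smooth_src (x p)).mdifferentiableAt (by simp)) hx
    have e2 := tder_comp ((Γ.smooth_tgt (h p)).mdifferentiableAt (by simp)) hh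
    have e3 : (fun q => Γ.src (x q)) =ᶠ[𝓝 p] fun q => Γ.tgt (h q) := hxh
    rw [e3.tder_eq, e2] at e1
    exact (congrArg (fun g => g e) e1).symm
  have h2 : tder T.I B.I Γ.tgt (h p) (w - b) = 0 := by
    rw [map_sub, hb, tder_tgt_tgtLift, h1, sub_self]
  have h3 := hL.dmul_eq hxh.self_of_nhds hK h2
  have h4 : Γ.dmul (x p) (h p) (v, w) =
      Γ.dmul (x p) (h p) (v, b) + Γ.dmul (x p) (h p) (0, w - b) := by
    rw [← map_add]
    simp
  rw [Γ.tder_mul hx hh hxh, ← hv, ← hw, h4, map_add, h3, map_sub]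
  change θ (Γ.mul (x p) (h p)) (Γ.dmul (x p) (h p) (v, b)) - θ (h p) b = _
  ring

end

variable {Γ} in
theorem IsLeftTranslate.variation_mul (hL : Γ.IsLeftTranslate f K θ) {x y k : T}
    (hxy : Γ.src x = Γ.tgt y) (hyk : Γ.src y = Γ.tgt k) (hk : Γ.src k ∈ K) {v w : T.E}
    (hvw : tder T.I B.I Γ.src x v = tder T.I B.I Γ.tgt y w) :
    Γ.variation θ (Γ.mul x y) k (Γ.dmul x y (v, w)) =
      Γ.variation θ x (Γ.mul y k) v + Γ.variation θ y k w := by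
  obtain ⟨ξ, a1, rfl, rfl⟩ := SmoothManifold.exists_curve x v
  obtain ⟨η, b1, rfl, b3, rfl⟩ := exists_composable_curve a1 hxy hvw
  obtain ⟨κ, c1, rfl, c3, c4⟩ := exists_composable_curve b1 hyk
    (Γ.tder_tgt_tgtLift k _).symm
  have a1' := a1.mdifferentiableAt (by simp)
  have b1' := b1.mdifferentiableAt (by simp)
  have c1' := c1.mdifferentiableAt (by simp)
  have d1 := (Γ.contMDiffAt_mul a1 b1 b3).mdifferentiableAt (by simp)
  have d2 := (Γ.contMDiffAt_mul b1 c1 c3).mdifferentiableAt (by simp)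
  have d3 : ∀ᶠ ε in 𝓝 0, Γ.src (ξ ε) = Γ.tgt (Γ.mul (η ε) (κ ε)) := by
    filter_upwards [b3, c3] with ε h1 h2
    rw [Γ.tgt_mul _ _ h2, h1]
  have d4 : ∀ᶠ ε in 𝓝 0, Γ.src (Γ.mul (ξ ε) (η ε)) = Γ.tgt (κ ε) := by
    filter_upwards [b3, c3] with ε h1 h2
    rw [Γ.src_mul _ _ h1, h2]
  have d5 : (fun ε => Γ.mul (Γ.mul (ξ ε) (η ε)) (κ ε)) =ᶠ[𝓝 0]
      fun ε => Γ.mul (ξ ε) (Γ.mul (η ε) (κ ε)) := by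
    filter_upwards [b3, c3] with ε h1 h2
    rw [Γ.mul_assoc _ _ _ h1 h2]
  have e1 := hL.variation_eq d1 c1' d4 hk 1
  have e2 := hL.variation_eq a1' d2 d3 (by rwa [Γ.src_mul _ _ hyk]) 1
  have e3 := hL.variation_eq b1' c1' c3 hk 1
  rw [Γ.tder_mul a1' b1' b3, d5.tder_eq, Γ.mul_assoc _ _ _ hxy hyk] at e1
  rw [e1, e2, e3]
  ring

variable {Γ} [FiniteDimensional ℝ F] {c₀ : FibreChart Γ.tgt F}
  [MeasurableSpace T] [BorelSpace T] [MeasurableSpace F] [BorelSpace F]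
  {μ : Measure F} [μ.IsAddHaarMeasure] {cs : ℕ → FibreChart Γ.tgt F} {φ : B → ℝ}
  (hΓ : Γ.IsProper) (hcs : ⋃ i, (cs i).dom = univ) (hφ : ContMDiff B.I 𝓘(ℝ, ℝ) ∞ φ)
  (hK : IsCompact K) (hKb : K ⊆ Γ.base c₀) (hφK : ∀ y ∉ K, φ y = 0)
  (hL : Γ.IsLeftTranslate f K θ) (hθ : ∀ z, θ.SmoothAt z)
include hΓ hcs hφ hK hKb hφK hL hθ

theorem variation_aux (x : T) (e : T.E) :
    Integrable (fun h => φ (Γ.src h) * Γ.variation θ x h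
        (tder 𝓘(ℝ, T.E) T.I (extChartAt T.I x).symm (extChartAt T.I x x) e))
      (Γ.haar c₀ μ cs (Γ.src x)) ∧
    ContDiffAt ℝ ∞ (fun p => ∫ h, φ (Γ.src h) * Γ.variation θ ((extChartAt T.I x).symm p) h
        (tder 𝓘(ℝ, T.E) T.I (extChartAt T.I x).symm p e)
          ∂(Γ.haar c₀ μ cs (Γ.src ((extChartAt T.I x).symm p)))) (extChartAt T.I x x) := by
  set γ := (extChartAt T.I x).symm with hγ
  have hγs : ∀ᶠ p in 𝓝 (extChartAt T.I x x), ContMDiffAt 𝓘(ℝ, T.E) T.I ∞ γ p :=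
    SmoothManifold.eventually_contMDiffAt_extChartAt_symm x
  have h := contDiffAt_integral_haar (Γ := Γ) (c₀ := c₀) (μ := μ) (p₀ := extChartAt T.I x x)
    (b := fun p => Γ.src (γ p))
    (G := fun p h => φ (Γ.src h) * Γ.variation θ (γ p) h (tder 𝓘(ℝ, T.E) T.I γ p e)) hΓ hcs
    (hγs.mono fun p hp => (Γ.smooth_src _).comp p hp) hK hKb
    (fun _ h hh => by rw [hφK _ hh, zero_mul]) ?_
  · have h' : γ (extChartAt T.I x x) = x := SmoothManifold.extChartAt_symm_apply_self x
    have h1 := h.1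
    rw [h'] at h1
    exact ⟨h1, h.2⟩
  filter_upwards [eventually_eventually_nhds.2 hγs] with p hp q η hη hηb hηK
  have hγ1 : ∀ᶠ z : T.E × F in 𝓝 (p, q), ContMDiffAt 𝓘(ℝ, T.E) T.I ∞ γ z.1 :=
    (continuousAt_fst (p := (p, q))).eventually hp
  have hγ2 : ∀ z : T.E × F, ContMDiffAt 𝓘(ℝ, T.E) T.I ∞ γ z.1 →
      ContMDiffAt 𝓘(ℝ, T.E × F) T.I ∞ (fun z : T.E × F => γ z.1) z := fun z hz =>
    ContMDiffAt.comp (g := γ) z hz contDiff_fst.contMDiff.contMDiffAt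
  have hcomp : ∀ᶠ z : T.E × F in 𝓝 (p, q), Γ.src (γ z.1) = Γ.tgt (η z) :=
    hηb.mono fun z hz => hz.symm
  have hmul : ContMDiffAt 𝓘(ℝ, T.E × F) T.I ∞ (fun z : T.E × F => Γ.mul (γ z.1) (η z)) (p, q) :=
    Γ.contMDiffAt_mul (hγ2 _ hp.self_of_nhds) hη hcomp
  have s1 : ContDiffAt ℝ ∞ (fun z => φ (Γ.src (η z))) (p, q) :=
    (((hφ _).comp _ (Γ.smooth_src _)).comp (p, q) hη).contDiffAt
  have s2 := (hθ _).contDiffAt_pullback hmul (e, (0 : F))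
  have s3 := (hθ _).contDiffAt_pullback hη (e, (0 : F))
  refine (s1.mul (s2.sub s3)).congr_of_eventuallyEq ?_
  have hηd : ∀ᶠ z in 𝓝 (p, q), MDifferentiableAt 𝓘(ℝ, T.E × F) T.I η z :=
    have hI : IsManifold T.I 1 T := .of_le (n := ∞) (by norm_num)
    ((contMDiffAt_iff_contMDiffAt_nhds (n := 1) (by simp)).1 (hη.of_le (by norm_num))).mono
      fun z hz => hz.mdifferentiableAt (by simp)
  filter_upwards [hγ1, eventually_eventually_nhds.2 hcomp, hηd] with z hz1 hz2 hz3
  by_cases hzK : Γ.src (η z) ∈ K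
  · have t1 := hL.variation_eq ((hγ2 z hz1).mdifferentiableAt (by simp)) hz3 hz2 hzK (e, 0)
    have t2 : tder 𝓘(ℝ, T.E × F) T.I (fun z : T.E × F => γ z.1) z (e, 0) =
        tder 𝓘(ℝ, T.E) T.I γ z.1 e := by
      have t3 : MDifferentiableAt 𝓘(ℝ, T.E × F) 𝓘(ℝ, T.E) (fun z : T.E × F => z.1) z :=
        (contDiff_fst (n := ∞)).contMDiff.contMDiffAt.mdifferentiableAt (by simp)
      rw [tder_comp (g := γ) (f := fun z : T.E × F => z.1) (hz1.mdifferentiableAt (by simp)) t3,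
        tder_eq_fderiv, fderiv_fst]
      rfl
    rw [t2] at t1
    rw [t1]
  · simp only [hφK _ hzK, zero_mul]

theorem integrable_variation (x : T) (v : T.E) :
    Integrable (fun h => φ (Γ.src h) * Γ.variation θ x h v) (Γ.haar c₀ μ cs (Γ.src x)) := by
  obtain ⟨e, rfl⟩ := SmoothManifold.tder_extChartAt_symm_surjective x v
  exact (variation_aux hΓ hcs hφ hK hKb hφK hL hθ x e).1

/-- Averaging the variation of `θ` over the fibres of the target map gives a multiplicative
form. -/
theorem exists_isMultiplicative : ∃ Θ : OneForm T, (∀ x, Θ.SmoothAt x) ∧ Γ.IsMultiplicative Θ ∧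
    ∀ (x : T) (ζ : ℝ → T) (r : ℝ), ContMDiffAt 𝓘(ℝ, ℝ) T.I ∞ ζ 0 → ζ 0 = x →
      (∀ᶠ ε in 𝓝 0, Γ.src (ζ ε) = Γ.src x) →
      (∀ h, Γ.src x = Γ.tgt h → Γ.src h ∈ K →
        θ (Γ.mul x h) (tder 𝓘(ℝ, ℝ) T.I (fun ε => Γ.mul (ζ ε) h) 0 1) = r) →
      Θ x (tder 𝓘(ℝ, ℝ) T.I ζ 0 1) = r * Γ.weight c₀ μ cs φ (Γ.src x) := by
  have hi := fun x v => integrable_variation (μ := μ) (cs := cs) hΓ hcs hφ hK hKb hφK hL hθ x v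
  have hex : ∀ x, ∃ L : T.E →L[ℝ] ℝ, ∀ v, L v =
      ∫ h, φ (Γ.src h) * Γ.variation θ x h v ∂(Γ.haar c₀ μ cs (Γ.src x)) := fun x =>
    ⟨LinearMap.toContinuousLinearMap
      { toFun := fun v => ∫ h, φ (Γ.src h) * Γ.variation θ x h v ∂(Γ.haar c₀ μ cs (Γ.src x))
        map_add' := fun v w => by
          rw [← integral_add (hi x v) (hi x w)]
          simp only [map_add, mul_add]
        map_smul' := fun a v => by
          rw [RingHom.id_apply, smul_eq_mul, ← integral_const_mul]
          simp only [map_smul, smul_eq_mul, mul_left_comm] }, fun v => rfl⟩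
  choose Θ hΘ using hex
  refine ⟨Θ, fun x => OneForm.smoothAt_of_pullback fun e => ?_, ?_, ?_⟩
  · simp only [hΘ]
    exact (variation_aux hΓ hcs hφ hK hKb hφK hL hθ x e).2
  · intro x y hxy v w hvw
    have h1 := hi x v
    rw [hxy] at h1
    obtain ⟨h2, h3⟩ := integral_haar_mul hcs y h1
    rw [hΘ, hΘ x, hΘ y, hxy, Γ.src_mul _ _ hxy, ← h3, ← integral_add h2 (hi y w)]
    refine integral_congr_ae ?_
    filter_upwards [haar_tgt_ne cs (Γ.src y)] with k hk
    simp only [Γ.src_mul _ _ hk.symm]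
    by_cases hkK : Γ.src k ∈ K
    · rw [hL.variation_mul hxy hk.symm hkK hvw, mul_add]
    · simp only [hφK _ hkK, zero_mul, add_zero]
  · rintro x ζ r hζ rfl hs hr
    rw [hΘ, weight, ← integral_const_mul]
    refine integral_congr_ae ?_
    filter_upwards [haar_tgt_ne cs (Γ.src (ζ 0))] with h hh
    by_cases hhK : Γ.src h ∈ K
    · have h1 := hL.variation_eq (h := fun _ : ℝ => h) (hζ.mdifferentiableAt (by simp))
        mdifferentiableAt_const (hs.mono fun ε hε => hε.trans hh.symm) hhK 1
      rw [hr h hh.symm hhK, tder_const, _root_.zero_apply, map_zero, sub_zero] at h1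
      rw [h1, mul_comm]
    · simp only [hφK _ hhK, zero_mul, mul_zero]

end LieGroupoid

namespace CentralExtension
variable {X₁ X₀ : SmoothManifold.{u}} {𝒳 : LieGroupoid X₁ X₀} (𝓔 : CentralExtension 𝒳)

theorem src_act (a : Circle) (x : 𝓔.total) : 𝓔.groupoid.src (𝓔.act a x) = 𝓔.groupoid.src x := by
  rw [← 𝓔.src_proj, 𝓔.proj_act, 𝓔.src_proj]

theorem tgt_act (a : Circle) (x : 𝓔.total) : 𝓔.groupoid.tgt (𝓔.act a x) = 𝓔.groupoid.tgt x := by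
  rw [← 𝓔.tgt_proj, 𝓔.proj_act, 𝓔.tgt_proj]

theorem act_mul_left (a : Circle) {x y : 𝓔.total} (h : 𝓔.groupoid.src x = 𝓔.groupoid.tgt y) :
    𝓔.groupoid.mul (𝓔.act a x) y = 𝓔.act a (𝓔.groupoid.mul x y) := by
  have := 𝓔.mul_act a 1 x y h
  rwa [𝓔.act_one, mul_one] at this

theorem act_mul_right (a : Circle) {x y : 𝓔.total} (h : 𝓔.groupoid.src x = 𝓔.groupoid.tgt y) :
    𝓔.groupoid.mul x (𝓔.act a y) = 𝓔.act a (𝓔.groupoid.mul x y) := by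
  have := 𝓔.mul_act 1 a x y h
  rwa [𝓔.act_one, one_mul] at this

theorem orbitMap_zero (x : 𝓔.total) : 𝓔.orbitMap x 0 = x := by
  rw [orbitMap, mul_zero, Circle.exp_zero, 𝓔.act_one]

theorem contMDiff_orbitMap (x : 𝓔.total) : ContMDiff 𝓘(ℝ, ℝ) 𝓔.total.I ∞ (𝓔.orbitMap x) := by
  have h : ContMDiff 𝓘(ℝ, ℝ) (𝓡 1) ∞ fun t : ℝ => Circle.exp (2 * Real.pi * t) :=
    contMDiff_circleExp.comp (contDiff_const.mul contDiff_id).contMDiff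
  exact ContMDiff.comp (g := fun p : Circle × 𝓔.total => 𝓔.act p.1 p.2) 𝓔.smooth_act
    (h.prodMk contMDiff_const)

theorem isProperMap_proj : IsProperMap 𝓔.proj := by
  rw [isProperMap_iff_ultrafilter]
  refine ⟨𝓔.smooth_proj.continuous, fun 𝒰 y hy => ?_⟩
  obtain ⟨U, hU, hyU, σ, χ, hσ, -, hσU, -, hχσ⟩ := 𝓔.locally_trivial y
  obtain ⟨a, -, ha⟩ := isCompact_univ.ultrafilter_le_nhds (𝒰.map χ) (by simp)
  refine ⟨𝓔.act a (σ y), by rw [𝓔.proj_act, hσU y hyU], ?_⟩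
  have h1 : Tendsto (fun x => σ (𝓔.proj x)) 𝒰 (𝓝 (σ y)) :=
    ((hσ.contMDiffAt (hU.mem_nhds hyU)).continuousAt.tendsto).comp hy
  have h2 : Tendsto (fun x => 𝓔.act (χ x) (σ (𝓔.proj x))) 𝒰 (𝓝 (𝓔.act a (σ y))) :=
    (𝓔.smooth_act.continuous.tendsto (a, σ y)).comp (Tendsto.prodMk_nhds ha h1)
  refine (h2.congr' (f₂ := id) ?_)
  filter_upwards [hy (hU.mem_nhds hyU)] with x hx using hχσ x hx

variable {𝓔} in
theorem isProper_groupoid (h : 𝒳.IsProper) : 𝓔.groupoid.IsProper := by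
  have h1 : IsProperMap fun x => (𝒳.tgt (𝓔.proj x), 𝒳.src (𝓔.proj x)) :=
    IsProperMap.comp h 𝓔.isProperMap_proj
  simp only [𝓔.src_proj, 𝓔.tgt_proj] at h1
  exact h1

/-- Near the units there are functions whose derivative along the circle action, at the units, is
`1`. -/
theorem exists_angle (y₀ : X₀) : ∃ (N : Set X₀) (f : 𝓔.total → ℝ), IsOpen N ∧ y₀ ∈ N ∧
    (∀ y ∈ N, ContMDiffAt 𝓔.total.I 𝓘(ℝ, ℝ) ∞ f (𝓔.groupoid.unit y)) ∧
    ∀ y ∈ N, deriv (fun t => f (𝓔.orbitMap (𝓔.groupoid.unit y) t)) 0 = 1 := by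
  obtain ⟨U, hU, hyU, σ, χ, -, hχ, hσU, hχa, hχσ⟩ :=
    𝓔.locally_trivial (𝓔.proj (𝓔.groupoid.unit y₀))
  have hχact : ∀ x, 𝓔.proj x ∈ U → ∀ a, χ (𝓔.act a x) = a * χ x := by
    intro x hx a
    conv_lhs => rw [← hχσ x hx, ← 𝓔.act_mul]
    exact hχa _ hx _
  have hus := 𝓔.groupoid.smooth_unit
  refine ⟨(fun y => 𝓔.proj (𝓔.groupoid.unit y)) ⁻¹' U,
    fun z => (((χ z)⁻¹ * χ (𝓔.groupoid.unit (𝓔.groupoid.tgt z)) : Circle) : ℂ).im /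
      (-(2 * Real.pi)), hU.preimage (𝓔.smooth_proj.continuous.comp hus.continuous), hyU, ?_, ?_⟩
  · intro y hy
    have hc : ∀ z, 𝓔.proj z ∈ U → ContMDiffAt 𝓔.total.I (𝓡 1) ∞ χ z := fun z hz =>
      hχ.contMDiffAt ((hU.preimage 𝓔.smooth_proj.continuous).mem_nhds hz)
    have h1 := hc (𝓔.groupoid.unit y) hy
    have h2 : ContMDiffAt 𝓔.total.I (𝓡 1) ∞
        (fun z => χ (𝓔.groupoid.unit (𝓔.groupoid.tgt z))) (𝓔.groupoid.unit y) := by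
      refine ContMDiffAt.comp (g := χ) _ (hc _ ?_)
        ((hus _).comp _ (𝓔.groupoid.smooth_tgt _))
      rw [𝓔.groupoid.tgt_unit]
      exact hy
    have h3 : ContMDiffAt 𝓔.total.I (𝓡 1) ∞
        (fun z => (χ z)⁻¹ * χ (𝓔.groupoid.unit (𝓔.groupoid.tgt z))) (𝓔.groupoid.unit y) :=
      h1.inv.mul h2
    have := finrank_real_complex_fact'
    have h4 : ContMDiff (𝓡 1) 𝓘(ℝ, ℂ) ∞ (fun a : Circle => (a : ℂ)) :=
      contMDiff_coe_sphere (E := ℂ) (n := 1)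
    have h5 : ContDiff ℝ ∞ fun z : ℂ => z.im / (-(2 * Real.pi)) :=
      Complex.imCLM.contDiff.div_const _
    exact (h5.contMDiff _).comp _ ((h4 _).comp _ h3)
  · intro y hy
    have h1 : ∀ t : ℝ, (((χ (𝓔.orbitMap (𝓔.groupoid.unit y) t))⁻¹ *
        χ (𝓔.groupoid.unit (𝓔.groupoid.tgt (𝓔.orbitMap (𝓔.groupoid.unit y) t))) : Circle) : ℂ).im /
      (-(2 * Real.pi)) = Real.sin (2 * Real.pi * t) / (2 * Real.pi) := by
      intro t
      rw [orbitMap, 𝓔.tgt_act, 𝓔.groupoid.tgt_unit, hχact _ hy, mul_inv_rev, mul_comm,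
        mul_inv_cancel_left, ← Circle.exp_neg, Circle.coe_exp, Complex.exp_ofReal_mul_I_im,
        Real.sin_neg, neg_div_neg_eq]
    simp only [h1]
    have h2 : HasDerivAt (fun t => Real.sin (2 * Real.pi * t) / (2 * Real.pi))
        (Real.cos (2 * Real.pi * 0) * (2 * Real.pi * 1) / (2 * Real.pi)) 0 :=
      (((hasDerivAt_id (0 : ℝ)).const_mul (2 * Real.pi)).sin).div_const _
    rw [h2.deriv, mul_zero, Real.cos_zero, mul_one, one_mul, div_self (by positivity)]

theorem mul_orbitMap {x h : 𝓔.total} (hxh : 𝓔.groupoid.src x = 𝓔.groupoid.tgt h) (t : ℝ) :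
    𝓔.groupoid.mul (𝓔.orbitMap x t) h = 𝓔.orbitMap (𝓔.groupoid.mul x h) t :=
  𝓔.act_mul_left _ hxh

theorem inv_mul_orbitMap (z : 𝓔.total) (t : ℝ) :
    𝓔.groupoid.mul (𝓔.groupoid.inv z) (𝓔.orbitMap z t) =
      𝓔.orbitMap (𝓔.groupoid.unit (𝓔.groupoid.src z)) t := by
  rw [orbitMap, 𝓔.act_mul_right _ (𝓔.groupoid.src_inv z), 𝓔.groupoid.inv_mul, orbitMap]

/-- A multiplicative form which is proportional to a connection over each orbit, and nonzero on the
fundamental vector field near `y₀`. -/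
theorem exists_local_form (h𝒳 : 𝒳.IsProper) (y₀ : X₀) : ∃ (Θ : OneForm 𝓔.total) (w : X₀ → ℝ),
    (∀ x, Θ.SmoothAt x) ∧ 𝓔.groupoid.IsMultiplicative Θ ∧ ContMDiff X₀.I 𝓘(ℝ, ℝ) ∞ w ∧
    (∀ y, 0 ≤ w y) ∧ (∀ x, w (𝓔.groupoid.src x) = w (𝓔.groupoid.tgt x)) ∧ 0 < w y₀ ∧
    ∀ x, Θ x (tder 𝓘(ℝ, ℝ) 𝓔.total.I (𝓔.orbitMap x) 0 1) = w (𝓔.groupoid.src x) := by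
  set Γ := 𝓔.groupoid with hΓdef
  have hΓ : Γ.IsProper := isProper_groupoid h𝒳
  have : Nonempty 𝓔.total := ⟨Γ.unit y₀⟩
  obtain ⟨F, _, _, _, hF⟩ := Γ.exists_fibreChart
  obtain ⟨cs, hcs⟩ := LieGroupoid.exists_countable_fibreChart hF
  obtain ⟨c₀, hc₀⟩ := hF (Γ.unit y₀)
  obtain ⟨N, f, hN, hyN, hf, hf1⟩ := 𝓔.exists_angle y₀
  let _ : MeasurableSpace 𝓔.total := borel _
  have : BorelSpace 𝓔.total := ⟨rfl⟩
  let _ : MeasurableSpace F := borel _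
  have : BorelSpace F := ⟨rfl⟩
  have hLC : LocallyCompactSpace X₀ := Manifold.locallyCompact_of_finiteDimensional X₀.I
  obtain ⟨K, hK, hyK, hKN⟩ := exists_compact_subset (hN.inter (Γ.isOpen_base c₀)) ⟨hyN, hc₀⟩
  obtain ⟨φ, hφs, hφr, hφsupp, hφ1⟩ : ∃ φ : X₀ → ℝ, ContMDiff X₀.I 𝓘(ℝ, ℝ) ∞ φ ∧
      (∀ y, 0 ≤ φ y) ∧ (∀ y ∉ K, φ y = 0) ∧ 0 < φ y₀ := by
    obtain ⟨φ, h1, h2, h3⟩ := (isOpen_interior (s := K)).exists_contMDiff_support_eq (n := ⊤) X₀.I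
    refine ⟨φ, h2, h3, fun y hy => ?_, (h3 y₀).lt_of_ne' ?_⟩
    · exact Function.notMem_support.1 (h1 ▸ fun h => hy (interior_subset h))
    · exact Function.mem_support.1 (h1 ▸ hyK)
  obtain ⟨θ, hθ, hL⟩ := LieGroupoid.exists_isLeftTranslate hf hN hK.isClosed
    (hKN.trans inter_subset_left) hF
  have hKb := hKN.trans inter_subset_right
  obtain ⟨Θ, hΘ, hΘm, hΘv⟩ := LieGroupoid.exists_isMultiplicative (c₀ := c₀) (cs := cs)
    (μ := Measure.addHaar) hΓ hcs hφs hK hKb hφsupp hL hθ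
  refine ⟨Θ, Γ.weight c₀ Measure.addHaar cs φ, hΘ, hΘm,
    LieGroupoid.contMDiff_weight hΓ hcs hφs hK hKb hφsupp, fun y => integral_nonneg fun _ => hφr _,
    LieGroupoid.weight_src hΓ hcs hφs hK hKb hφsupp,
    LieGroupoid.weight_pos hΓ hcs hφs hK hKb hφsupp hφr hφ1, fun x => ?_⟩
  have h := hΘv x (𝓔.orbitMap x) 1 (𝓔.contMDiff_orbitMap x _) (𝓔.orbitMap_zero x)
    (.of_forall fun t => 𝓔.src_act _ _) fun h hxh hhK => ?_
  · rwa [one_mul] at h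
  · rw [hL (Γ.mul x h) (by rwa [Γ.src_mul _ _ hxh]) (fun t => Γ.mul (𝓔.orbitMap x t) h)]
    · have e : (fun t => f (Γ.mul (Γ.inv (Γ.mul x h)) (Γ.mul (𝓔.orbitMap x t) h))) =
          fun t => f (𝓔.orbitMap (Γ.unit (Γ.src h)) t) := by
        funext t
        rw [hΓdef, 𝓔.mul_orbitMap hxh, 𝓔.inv_mul_orbitMap, 𝓔.groupoid.src_mul _ _ hxh]
      rw [e]
      exact hf1 _ (hKN hhK).1
    · exact Γ.contMDiffAt_mul (𝓔.contMDiff_orbitMap x _) contMDiffAt_const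
        (.of_forall fun t => (𝓔.src_act _ _).trans hxh)
    · rw [𝓔.orbitMap_zero]
    · refine .of_forall fun t => ?_
      rw [hΓdef, 𝓔.mul_orbitMap hxh]
      exact 𝓔.tgt_act _ _

end CentralExtension

/-- A smooth partition of unity relative to countably many nonnegative functions `u n`, whose members
depend only on the values of these functions. -/
theorem SmoothManifold.exists_partition {B : SmoothManifold.{u}} {u : ℕ → B → ℝ}
    (hu : ∀ n, ContMDiff B.I 𝓘(ℝ, ℝ) ∞ (u n)) (hu0 : ∀ n y, 0 ≤ u n y)
    (hpos : ∀ y, ∃ n, 0 < u n y) :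
    ∃ a : ℕ → B → ℝ, (∀ n, ContMDiff B.I 𝓘(ℝ, ℝ) ∞ (a n)) ∧
      LocallyFinite (fun n => Function.support (a n)) ∧
      (∀ y z, (∀ n, u n y = u n z) → ∀ n, a n y = a n z) ∧
      ∀ y, ∑ᶠ n, a n y * u n y = 1 := by
  set w : ℕ → B → ℝ := fun n y => Real.smoothTransition (u n y) *
    ∏ j ∈ Finset.range n, Real.smoothTransition (1 / ((n : ℝ) + 1) - u j y) with hw
  have hS : ContMDiff 𝓘(ℝ, ℝ) 𝓘(ℝ, ℝ) ∞ Real.smoothTransition :=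
    (Real.smoothTransition.contDiff (n := ⊤)).contMDiff
  have hws : ∀ n, ContMDiff B.I 𝓘(ℝ, ℝ) ∞ (w n) := fun n =>
    (hS.comp (hu n)).mul (contMDiff_finsetProd fun j _ => hS.comp (contMDiff_const.sub (hu j)))
  have hw0 : ∀ n y, 0 ≤ w n y := fun n y => mul_nonneg (Real.smoothTransition.nonneg _)
    (Finset.prod_nonneg fun _ _ => Real.smoothTransition.nonneg _)
  have hwf : LocallyFinite fun n => Function.support (w n) := by
    intro y
    obtain ⟨j, hj⟩ := hpos y
    refine ⟨{z | u j y / 2 < u j z}, (isOpen_lt continuous_const (hu j).continuous).mem_nhds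
      (half_lt_self hj), ?_⟩
    obtain ⟨m, hm⟩ := exists_nat_one_div_lt (half_pos hj)
    refine (finite_lt_nat (max (j + 1) m)).subset ?_
    rintro n ⟨z, hz, hz'⟩
    by_contra hn
    have hn' : max (j + 1) m ≤ n := not_lt.1 hn
    refine hz (mul_eq_zero_of_right _ (Finset.prod_eq_zero (i := j)
      (Finset.mem_range.2 (by omega)) (Real.smoothTransition.zero_of_nonpos ?_)))
    have h1 : 1 / ((n : ℝ) + 1) ≤ 1 / ((m : ℝ) + 1) := by
      apply one_div_le_one_div_of_le (by positivity)
      have : (m : ℝ) ≤ n := by exact_mod_cast (le_max_right _ _).trans hn'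
      linarith
    have h2 : u j y / 2 < u j z := hz'
    linarith
  have hwuf : LocallyFinite fun n => Function.support fun y => w n y * u n y :=
    hwf.subset fun n => Function.support_mul_subset_left _ _
  set W : B → ℝ := fun y => ∑ᶠ n, w n y * u n y with hW
  have hWs : ContMDiff B.I 𝓘(ℝ, ℝ) ∞ W := contMDiff_finsum (fun n => (hws n).mul (hu n)) hwuf
  have hWpos : ∀ y, 0 < W y := by
    classical
    intro y
    set n := Nat.find (hpos y) with hn
    have h1 : 0 < w n y * u n y := by
      refine mul_pos (mul_pos (Real.smoothTransition.pos_of_pos (Nat.find_spec (hpos y)))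
        (Finset.prod_pos fun j hj => Real.smoothTransition.pos_of_pos ?_))
        (Nat.find_spec (hpos y))
      have h2 : ¬ 0 < u j y := Nat.find_min (hpos y) (Finset.mem_range.1 hj)
      have h3 : u j y = 0 := le_antisymm (not_lt.1 h2) (hu0 j y)
      rw [h3, sub_zero]
      positivity
    exact finsum_pos (fun m => mul_nonneg (hw0 m y) (hu0 m y)) ⟨n, h1⟩ (hwuf.point_finite y)
  have hinv : ∀ y z, (∀ n, u n y = u n z) → ∀ n, w n y = w n z := by
    intro y z h n
    simp only [hw, h]
  refine ⟨fun n y => w n y / W y, fun n => (hws n).div₀ hWs fun y => (hWpos y).ne', ?_, ?_, ?_⟩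
  · refine hwf.subset fun n y hy => ?_
    intro h
    exact hy (by simp only [h, zero_div])
  · intro y z h n
    have h1 : W y = W z := by simp only [hW, hinv y z h, h]
    simp only [hinv y z h n, h1]
  · intro y
    have h1 : ∀ n, w n y / W y * u n y = w n y * u n y * (W y)⁻¹ := fun n => by
      rw [div_mul_eq_mul_div, div_eq_mul_inv]
    simp only [h1]
    rw [← finsum_mul' _ _ (hwuf.point_finite y)]
    exact mul_inv_cancel₀ (hWpos y).ne'

theorem finsum_smul_clm_apply {E : Type*} [NormedAddCommGroup E] [NormedSpace ℝ E] {a : ℕ → ℝ}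
    (ha : (Function.support a).Finite) (L : ℕ → E →L[ℝ] ℝ) (v : E) :
    (∑ᶠ n, a n • L n) v = ∑ᶠ n, a n * L n v := by
  have h1 : (Function.support fun n => a n • L n).Finite :=
    ha.subset fun n hn h => hn (by simp only [h, zero_smul])
  exact map_finsum (ContinuousLinearMap.apply ℝ ℝ v) h1

namespace LieGroupoid
variable {T B : SmoothManifold.{u}} {Γ : LieGroupoid T B}

theorem IsMultiplicative.finsum {Θ : ℕ → OneForm T} (hΘ : ∀ n, Γ.IsMultiplicative (Θ n))
    {a : ℕ → B → ℝ} (hf : LocallyFinite fun n => Function.support (a n))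
    (hinv : ∀ n x, a n (Γ.src x) = a n (Γ.tgt x)) :
    Γ.IsMultiplicative fun x => ∑ᶠ n, a n (Γ.tgt x) • Θ n x := by
  intro x y hxy v w hvw
  have hy : ∀ n, a n (Γ.tgt y) = a n (Γ.tgt x) := fun n => by rw [← hinv n x, hxy]
  have hfin := hf.point_finite (Γ.tgt x)
  have hfin' : (Function.support fun n => a n (Γ.tgt x)).Finite := hfin
  simp only [Γ.tgt_mul _ _ hxy, hy]
  rw [finsum_smul_clm_apply hfin', finsum_smul_clm_apply hfin', finsum_smul_clm_apply hfin',
    ← finsum_add_distrib (hfin'.subset (Function.support_mul_subset_left _ _))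
      (hfin'.subset (Function.support_mul_subset_left _ _))]
  exact finsum_congr fun n => by rw [hΘ n x y hxy v w hvw, mul_add]

theorem smoothAt_finsum {Θ : ℕ → OneForm T} (hΘ : ∀ n x, (Θ n).SmoothAt x) {a : ℕ → B → ℝ}
    (ha : ∀ n, ContMDiff B.I 𝓘(ℝ, ℝ) ∞ (a n))
    (hf : LocallyFinite fun n => Function.support (a n)) (x : T) :
    OneForm.SmoothAt (fun x => ∑ᶠ n, a n (Γ.tgt x) • Θ n x) x := by
  have h1 : LocallyFinite fun n => Function.support fun x => a n (Γ.tgt x) :=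
    hf.preimage_continuous Γ.smooth_tgt.continuous
  refine ContMDiffAt.finsum_section_of_locallyFinite (V := fun x : T => TangentSpace T.I x →L[ℝ] ℝ)
    (t := fun n x => a n (Γ.tgt x) • Θ n x)
    (h1.subset fun n x hx h => hx ?_) fun n => ?_
  · simp only [h, zero_smul]
    rfl
  · exact ContMDiffAt.smul_section (((ha n).comp Γ.smooth_tgt) x) (hΘ n x)

end LieGroupoid

namespace CentralExtension
variable {X₁ X₀ : SmoothManifold.{u}} {𝒳 : LieGroupoid X₁ X₀} (𝓔 : CentralExtension 𝒳)

theorem contMDiffAt_act {E H M : Type*} [NormedAddCommGroup E] [NormedSpace ℝ E]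
    [TopologicalSpace H] {I : ModelWithCorners ℝ E H} [TopologicalSpace M] [ChartedSpace H M]
    {a : M → Circle} {z : M → 𝓔.total} {p : M} (ha : ContMDiffAt I (𝓡 1) ∞ a p)
    (hz : ContMDiffAt I 𝓔.total.I ∞ z p) :
    ContMDiffAt I 𝓔.total.I ∞ (fun q => 𝓔.act (a q) (z q)) p :=
  ContMDiffAt.comp (g := fun p : Circle × 𝓔.total => 𝓔.act p.1 p.2) p (𝓔.smooth_act _)
    (ha.prodMk hz)

theorem act_eq_mul (a : Circle) (x : 𝓔.total) :
    𝓔.groupoid.mul (𝓔.act a (𝓔.groupoid.unit (𝓔.groupoid.tgt x))) x = 𝓔.act a x := by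
  rw [𝓔.act_mul_left _ (𝓔.groupoid.src_unit _), 𝓔.groupoid.unit_mul]

variable {𝓔} {θ : OneForm 𝓔.total}

theorem multiplicative_tder (hm : 𝓔.groupoid.IsMultiplicative θ) {E H M : Type*}
    [NormedAddCommGroup E] [NormedSpace ℝ E]
    [TopologicalSpace H] {I : ModelWithCorners ℝ E H} [TopologicalSpace M] [ChartedSpace H M]
    {f g : M → 𝓔.total} {p : M} (hf : ContMDiffAt I 𝓔.total.I ∞ f p)
    (hg : ContMDiffAt I 𝓔.total.I ∞ g p)
    (h : ∀ q, 𝓔.groupoid.src (f q) = 𝓔.groupoid.tgt (g q)) (e : E) :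
    θ (𝓔.groupoid.mul (f p) (g p)) (tder I 𝓔.total.I (fun q => 𝓔.groupoid.mul (f q) (g q)) p e) =
      θ (f p) (tder I 𝓔.total.I f p e) + θ (g p) (tder I 𝓔.total.I g p e) := by
  have hf' := hf.mdifferentiableAt (by simp)
  have hg' := hg.mdifferentiableAt (by simp)
  rw [𝓔.groupoid.tder_mul hf' hg' (.of_forall h)]
  refine hm _ _ (h p) _ _ ?_
  have e1 := tder_comp ((𝓔.groupoid.smooth_src (f p)).mdifferentiableAt (by simp)) hf'
  have e2 := tder_comp ((𝓔.groupoid.smooth_tgt (g p)).mdifferentiableAt (by simp)) hg'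
  have e3 : (fun q => 𝓔.groupoid.src (f q)) = fun q => 𝓔.groupoid.tgt (g q) := funext h
  rw [e3, e2] at e1
  exact (congrArg (fun g => g e) e1).symm

theorem act_unit_eq_zero (hθ : ∀ x, θ.SmoothAt x) (hm : 𝓔.groupoid.IsMultiplicative θ)
    (a : Circle) (y : X₀) (b : X₀.E) :
    θ (𝓔.act a (𝓔.groupoid.unit y))
      (tder X₀.I 𝓔.total.I (fun y => 𝓔.act a (𝓔.groupoid.unit y)) y b) = 0 := by
  set ρ : Circle → ℝ := fun a => θ (𝓔.act a (𝓔.groupoid.unit y))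
      (tder X₀.I 𝓔.total.I (fun y => 𝓔.act a (𝓔.groupoid.unit y)) y b) with hρ
  have hs : ∀ a, ContMDiff X₀.I 𝓔.total.I ∞ fun y => 𝓔.act a (𝓔.groupoid.unit y) := fun a y =>
    𝓔.contMDiffAt_act contMDiffAt_const (𝓔.groupoid.smooth_unit y)
  have hcomp : ∀ a c y, 𝓔.groupoid.src (𝓔.act a (𝓔.groupoid.unit y)) =
      𝓔.groupoid.tgt (𝓔.act c (𝓔.groupoid.unit y)) := fun a c y => by
    rw [𝓔.src_act, 𝓔.tgt_act, 𝓔.groupoid.src_unit, 𝓔.groupoid.tgt_unit]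
  have hmul : ∀ a c y, 𝓔.groupoid.mul (𝓔.act a (𝓔.groupoid.unit y))
      (𝓔.act c (𝓔.groupoid.unit y)) = 𝓔.act (a * c) (𝓔.groupoid.unit y) := fun a c y => by
    have h := 𝓔.groupoid.mul_unit (𝓔.groupoid.unit y)
    rw [𝓔.groupoid.src_unit] at h
    rw [𝓔.mul_act _ _ _ _ (by rw [𝓔.groupoid.src_unit, 𝓔.groupoid.tgt_unit]), h]
  have hadd : ∀ a c, ρ (a * c) = ρ a + ρ c := fun a c => by
    have h := multiplicative_tder hm (hs a y) (hs c y) (hcomp a c) b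
    simp only [hmul] at h
    exact h
  have hcont : Continuous fun r : ℝ => ρ (Circle.exp r) := by
    refine continuous_iff_continuousAt.2 fun r => ?_
    obtain ⟨e, rfl⟩ := SmoothManifold.tder_extChartAt_symm_surjective y b
    set γ := (extChartAt X₀.I y).symm with hγ
    set q := extChartAt X₀.I y y with hq
    have hγq : γ q = y := SmoothManifold.extChartAt_symm_apply_self y
    have hγs : ContMDiffAt 𝓘(ℝ, X₀.E) X₀.I ∞ γ q :=
      (SmoothManifold.eventually_contMDiffAt_extChartAt_symm y).self_of_nhds
    have h1 : ∀ r : ℝ, ContMDiffAt 𝓘(ℝ, ℝ × X₀.E) 𝓔.total.I ∞ (fun p : ℝ × X₀.E =>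
        𝓔.act (Circle.exp p.1) (𝓔.groupoid.unit (γ p.2))) (r, q) := fun r => by
      refine 𝓔.contMDiffAt_act ?_ ?_
      · exact ContMDiffAt.comp (g := Circle.exp) (r, q) (contMDiff_circleExp r)
          contDiff_fst.contMDiff.contMDiffAt
      · exact ContMDiffAt.comp (g := fun q => 𝓔.groupoid.unit (γ q)) (r, q)
          ((𝓔.groupoid.smooth_unit _).comp q hγs) contDiff_snd.contMDiff.contMDiffAt
    have h2 := ((hθ _).contDiffAt_pullback (h1 r) ((0 : ℝ), e)).continuousAt
    have h3 : ContinuousAt (fun r : ℝ => (r, q)) r := by fun_prop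
    have h4 := ContinuousAt.comp (f := fun r : ℝ => (r, q)) h2 h3
    refine h4.congr (.of_forall fun r => ?_)
    have h5 := (h1 r).mdifferentiableAt (by simp)
    have h6 : MDifferentiableAt 𝓘(ℝ, X₀.E) 𝓘(ℝ, ℝ × X₀.E) (fun q : X₀.E => (r, q)) q :=
      (contDiff_prodMk_right r (n := ∞)).contMDiff.contMDiffAt.mdifferentiableAt (by simp)
    have h7 := tder_comp (f := fun q : X₀.E => (r, q)) h5 h6
    have h8 := tder_comp (g := fun y => 𝓔.act (Circle.exp r) (𝓔.groupoid.unit y))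
      (hs (Circle.exp r) (γ q) |>.mdifferentiableAt (by simp)) (hγs.mdifferentiableAt (by simp))
    have h9 : tder 𝓘(ℝ, X₀.E) 𝓘(ℝ, ℝ × X₀.E) (fun q : X₀.E => (r, q)) q e = (0, e) := by
      rw [tder_eq_fderiv, (hasFDerivAt_prodMk_right r q).fderiv]
      rfl
    have h10 := congrArg (fun g => g e) (h7.symm.trans h8)
    simp only [ContinuousLinearMap.comp_apply, h9, hγq] at h10
    change θ (𝓔.act (Circle.exp r) (𝓔.groupoid.unit (γ q))) _ = _
    rw [hγq]
    exact congrArg _ h10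
  have h1 : ρ 1 = 0 := by
    have := hadd 1 1
    rw [mul_one] at this
    linarith
  let g : ℝ →+ ℝ :=
    { toFun := fun r => ρ (Circle.exp r)
      map_zero' := by rw [Circle.exp_zero, h1]
      map_add' := fun r s => by rw [Circle.exp_add, hadd] }
  have hg : ∀ r, g r = r * g 1 := fun r => by
    have := (g.toRealLinearMap hcont).map_smul r 1
    simpa using this
  have h2 : g (2 * Real.pi) = 0 := by
    change ρ (Circle.exp (2 * Real.pi)) = 0
    rw [Circle.exp_two_pi, h1]
  have h3 : g 1 = 0 := by
    rw [hg] at h2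
    exact (mul_eq_zero.1 h2).resolve_left (by positivity)
  have h4 := hg (Complex.arg a)
  rw [h3, mul_zero] at h4
  change ρ (Circle.exp (Complex.arg a)) = 0 at h4
  rwa [Circle.exp_arg] at h4

theorem act_eq_of_isMultiplicative (hθ : ∀ x, θ.SmoothAt x) (hm : 𝓔.groupoid.IsMultiplicative θ)
    (a : Circle) (x : 𝓔.total) (v : 𝓔.total.E) :
    θ (𝓔.act a x) (tder 𝓔.total.I 𝓔.total.I (𝓔.act a) x v) = θ x v := by
  have hs : ContMDiff X₀.I 𝓔.total.I ∞ fun y => 𝓔.act a (𝓔.groupoid.unit y) := fun y =>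
    𝓔.contMDiffAt_act contMDiffAt_const (𝓔.groupoid.smooth_unit y)
  have h := multiplicative_tder hm (p := x) ((hs _).comp x (𝓔.groupoid.smooth_tgt x))
    contMDiffAt_id (fun x => by
      rw [Function.comp_apply, 𝓔.src_act, 𝓔.groupoid.src_unit, id]) v
  have h2 := tder_comp ((hs _).mdifferentiableAt (by simp))
    ((𝓔.groupoid.smooth_tgt x).mdifferentiableAt (by simp))
  have h3 : tder 𝓔.total.I 𝓔.total.I id x v = v := congrArg (fun g => g v) (tder_id x)
  have h4 := act_unit_eq_zero hθ hm a (𝓔.groupoid.tgt x) (tder 𝓔.total.I X₀.I 𝓔.groupoid.tgt x v)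
  simp only [Function.comp_apply, id, 𝓔.act_eq_mul] at h
  change _ = _ + θ x (tder 𝓔.total.I 𝓔.total.I id x v) at h
  rw [h3] at h
  refine h.trans ?_
  have h5 := congrArg (fun g => g v) h2
  refine (congrArg (fun r => r + θ x v) (?_ : _ = (0 : ℝ))).trans (zero_add _)
  rw [← h4]
  exact congrArg _ h5

variable (𝓔) in
theorem exists_isConnection_of_isProper (h𝒳 : 𝒳.IsProper) :
    ∃ θ : ∀ x : 𝓔.total, TangentSpace 𝓔.total.I x →L[ℝ] ℝ, 𝓔.IsConnection θ := by
  obtain ⟨θ, hθ, hm, hv⟩ : ∃ θ : OneForm 𝓔.total, (∀ x, θ.SmoothAt x) ∧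
      𝓔.groupoid.IsMultiplicative θ ∧
      ∀ x, θ x (tder 𝓘(ℝ, ℝ) 𝓔.total.I (𝓔.orbitMap x) 0 1) = 1 := by
    rcases isEmpty_or_nonempty X₀ with hX | hX
    · have : IsEmpty 𝓔.total := ⟨fun x => hX.false (𝓔.groupoid.src x)⟩
      exact ⟨fun _ => 0, isEmptyElim, isEmptyElim, isEmptyElim⟩
    choose Θ w hΘ hΘm hw hw0 hwi hwp hΘv using 𝓔.exists_local_form h𝒳
    obtain ⟨s, hs, hcov⟩ := TopologicalSpace.countable_cover_nhds (α := X₀)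
      (f := fun y => {z | 0 < w y z}) fun y =>
        (isOpen_lt continuous_const (hw y).continuous).mem_nhds (hwp y)
    obtain ⟨y₀⟩ := hX
    have hne : s.Nonempty := by
      obtain ⟨y, hy, -⟩ := mem_iUnion₂.1 (hcov ▸ mem_univ y₀)
      exact ⟨y, hy⟩
    obtain ⟨k, hk⟩ := hs.exists_eq_range hne
    obtain ⟨a, ha, haf, hai, ha1⟩ := SmoothManifold.exists_partition (u := fun n => w (k n))
      (fun n => hw _) (fun n => hw0 _) fun z => by
        obtain ⟨y, hy, hz⟩ := mem_iUnion₂.1 (hcov ▸ mem_univ z)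
        rw [hk] at hy
        obtain ⟨n, rfl⟩ := hy
        exact ⟨n, hz⟩
    have hai' : ∀ n x, a n (𝓔.groupoid.src x) = a n (𝓔.groupoid.tgt x) := fun n x =>
      hai _ _ (fun n => hwi _ x) n
    refine ⟨fun x => ∑ᶠ n, a n (𝓔.groupoid.tgt x) • Θ (k n) x,
      LieGroupoid.smoothAt_finsum (fun n => hΘ _) ha haf,
      LieGroupoid.IsMultiplicative.finsum (fun n => hΘm _) haf hai', fun x => ?_⟩
    have hfin : (Function.support fun n => a n (𝓔.groupoid.tgt x)).Finite := haf.point_finite _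
    refine (finsum_smul_clm_apply hfin _ _).trans (Eq.trans ?_ (ha1 (𝓔.groupoid.tgt x)))
    exact finsum_congr fun n => by rw [hΘv, hwi]
  refine ⟨θ, ⟨⟨hθ, act_eq_of_isMultiplicative hθ hm, fun x => ?_⟩, fun x y hxy v w hvw => ?_⟩⟩
  · have h : ∀ z, z = x → θ z (tder 𝓘(ℝ, ℝ) 𝓔.total.I (𝓔.orbitMap x) 0 1) = 1 := by
      rintro z rfl
      exact hv z
    exact h _ (𝓔.orbitMap_zero x)
  · have h := hm x y hxy v w hvw
    change θ y w - θ (𝓔.groupoid.mul x y) (𝓔.groupoid.dmul x y (v, w)) + θ x v = 0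
    rw [h]
    ring

end CentralExtension

theorem exists_local_section {Z X : SmoothManifold.{u}} {π : Z → X}
    (h : Manifold.IsSubmersion Z.I X.I ∞ π) (z : Z) :
    ∃ σ : X → Z, ContinuousAt σ (π z) ∧ σ (π z) = z ∧ ∀ᶠ x in 𝓝 (π z), π (σ x) = x := by
  obtain ⟨F, _, _, hF⟩ := h
  obtain ⟨c, hc⟩ := FibreChart.exists_of_isSubmersionAt (hF z)
  have h1 : ContinuousAt (fun x => (x, c.coord z)) (π z) := by fun_prop
  have hm := c.mem_cod z hc
  refine ⟨fun x => c.par (x, c.coord z),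
    ContinuousAt.comp (f := fun x => (x, c.coord z)) (c.contMDiffAt_par hm).continuousAt h1,
    c.par_coord z hc, ?_⟩
  filter_upwards [h1.preimage_mem_nhds (c.isOpen_cod.mem_nhds hm)] with x hx
  exact c.proj_par _ hx

theorem SmoothRightAction.isProper_groupoid {M G : SmoothManifold.{u}} [Group G]
    [LieGroup G.I ∞ G] [CompactSpace G] (ρ : SmoothRightAction M G) : ρ.groupoid.IsProper := by
  have h1 : Continuous fun p : M × G => (p.1, ρ.act p.1 p.2) :=
    continuous_fst.prodMk ρ.smooth.continuous
  exact isProperMap_of_comp_of_t2 (g := Prod.fst) h1 continuous_fst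
    (isProperMap_fst_of_compactSpace (X := M) (Y := G))

namespace LieGroupoidHom.IsMorita
variable {Z₁ Z₀ X₁ X₀ : SmoothManifold.{u}} {𝒵 : LieGroupoid Z₁ Z₀} {𝒳 : LieGroupoid X₁ X₀}
  {φ : LieGroupoidHom 𝒵 𝒳}

theorem isProper_source (hφ : φ.IsMorita) (h : 𝒳.IsProper) : 𝒵.IsProper := by
  obtain ⟨ψ, hψ, hψz, -⟩ := hφ.cartesian
  have hts := 𝒵.smooth_tgt.continuous.prodMk 𝒵.smooth_src.continuous
  refine isProperMap_iff_ultrafilter.2 ⟨hts, fun 𝒰 p hp => ?_⟩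
  have hp' := Prod.tendsto_iff _ _ |>.1 hp
  have h0 := φ.smooth₀.continuous
  obtain ⟨g, hg, hg'⟩ := (isProperMap_iff_ultrafilter.1 h).2 (𝒰 := 𝒰.map φ.map₁)
    (y := (φ.map₀ p.1, φ.map₀ p.2)) (by
      change Tendsto (fun z => (𝒳.tgt (φ.map₁ z), 𝒳.src (φ.map₁ z))) 𝒰 _
      simp only [φ.tgt_map, φ.src_map]
      exact ((h0.tendsto _).comp hp'.1).prodMk_nhds ((h0.tendsto _).comp hp'.2))
  have hg1 : 𝒳.tgt g = φ.map₀ p.1 := congrArg Prod.fst hg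
  have hg2 : 𝒳.src g = φ.map₀ p.2 := congrArg Prod.snd hg
  have hmem : (p.1, g, p.2) ∈ {p : Z₀ × (X₁ × Z₀) |
      φ.map₀ p.1 = 𝒳.tgt p.2.1 ∧ φ.map₀ p.2.2 = 𝒳.src p.2.1} := ⟨hg1.symm, hg2.symm⟩
  have h1 : Tendsto (fun z => (𝒵.tgt z, φ.map₁ z, 𝒵.src z)) 𝒰 (𝓝[{p : Z₀ × (X₁ × Z₀) |
      φ.map₀ p.1 = 𝒳.tgt p.2.1 ∧ φ.map₀ p.2.2 = 𝒳.src p.2.1}] (p.1, g, p.2)) :=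
    tendsto_nhdsWithin_iff.2 ⟨hp'.1.prodMk_nhds (Tendsto.prodMk_nhds hg' hp'.2),
      .of_forall fun z => ⟨(φ.tgt_map z).symm, (φ.src_map z).symm⟩⟩
  have h2 : Tendsto id 𝒰 (𝓝 (ψ (p.1, g, p.2))) :=
    ((hψ.continuousOn _ hmem).tendsto.comp h1).congr hψz
  refine ⟨ψ (p.1, g, p.2), tendsto_nhds_unique ((hts.tendsto _).comp h2) hp, h2⟩

theorem isProper_target (hφ : φ.IsMorita) (h : 𝒵.IsProper) : 𝒳.IsProper := by
  obtain ⟨ψ, -, -, hψ⟩ := hφ.cartesian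
  have hts := 𝒳.smooth_tgt.continuous.prodMk 𝒳.smooth_src.continuous
  refine isProperMap_iff_ultrafilter.2 ⟨hts, fun 𝒰 p hp => ?_⟩
  have hp' := Prod.tendsto_iff _ _ |>.1 hp
  obtain ⟨x, y⟩ := p
  obtain ⟨a, rfl⟩ := hφ.surjective x
  obtain ⟨b, rfl⟩ := hφ.surjective y
  obtain ⟨σ, hσ, hσa, hσs⟩ := exists_local_section hφ.submersion a
  obtain ⟨τ, hτ, hτb, hτs⟩ := exists_local_section hφ.submersion b
  have hl : ∀ᶠ g in (𝒰 : Filter X₁), 𝒵.tgt (ψ (σ (𝒳.tgt g), g, τ (𝒳.src g))) = σ (𝒳.tgt g) ∧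
      φ.map₁ (ψ (σ (𝒳.tgt g), g, τ (𝒳.src g))) = g ∧
      𝒵.src (ψ (σ (𝒳.tgt g), g, τ (𝒳.src g))) = τ (𝒳.src g) := by
    filter_upwards [hp'.1.eventually hσs, hp'.2.eventually hτs] with g h1 h2 using hψ _ _ _ h1 h2
  obtain ⟨z, -, hz⟩ := (isProperMap_iff_ultrafilter.1 h).2
    (𝒰 := 𝒰.map fun g => ψ (σ (𝒳.tgt g), g, τ (𝒳.src g))) (y := (a, b)) (by
      have h1 : Tendsto (fun g => (σ (𝒳.tgt g), τ (𝒳.src g))) 𝒰 (𝓝 (σ (φ.map₀ a), τ (φ.map₀ b))) :=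
        (hσ.tendsto.comp hp'.1).prodMk_nhds (hτ.tendsto.comp hp'.2)
      rw [hσa, hτb] at h1
      refine h1.congr' ?_
      filter_upwards [hl] with g hg
      rw [hg.1, hg.2.2])
  have h2 : Tendsto id 𝒰 (𝓝 (φ.map₁ z)) := by
    have h3 : Tendsto (fun g => φ.map₁ (ψ (σ (𝒳.tgt g), g, τ (𝒳.src g)))) 𝒰 (𝓝 (φ.map₁ z)) :=
      (φ.smooth₁.continuous.tendsto z).comp hz
    exact h3.congr' (hl.mono fun g hg => hg.2.1)
  exact ⟨φ.map₁ z, tendsto_nhds_unique ((hts.tendsto _).comp h2) hp, h2⟩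

end LieGroupoidHom.IsMorita

theorem mainTheorem6 :
    (∀ (X₁ X₀ : SmoothManifold.{u}) (𝒳 : LieGroupoid X₁ X₀), 𝒳.IsProper →
      ∀ 𝓔 : CentralExtension 𝒳,
        ∃ θ : ∀ x : 𝓔.total, TangentSpace 𝓔.total.I x →L[ℝ] ℝ, 𝓔.IsConnection θ) ∧
    (∀ (M G : SmoothManifold.{u}) [Group G] [LieGroup G.I ∞ G] [CompactSpace G]
      (ρ : SmoothRightAction M G) (α : ρ.EquivariantCohomology 3)
      (X₁ X₀ : SmoothManifold.{u}) (𝒳 : LieGroupoid X₁ X₀) (𝓔 : CentralExtension 𝒳),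
      𝓔.Represents ρ α →
        ∃ θ : ∀ x : 𝓔.total, TangentSpace 𝓔.total.I x →L[ℝ] ℝ, 𝓔.IsConnection θ) := by
  refine ⟨fun X₁ X₀ 𝒳 h 𝓔 => 𝓔.exists_isConnection_of_isProper h, ?_⟩
  rintro M G _ _ _ ρ α X₁ X₀ 𝒳 𝓔 ⟨Z₁, Z₀, 𝒵, q, r, hq, hr, -⟩
  exact 𝓔.exists_isConnection_of_isProper (hq.isProper_target (hr.isProper_source ρ.isProper_groupoid))
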